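/- **Setting.** Consider a POMDP with a separable metric state space $\mathcal X$, a finite action set $\mathcal A$ with $|\mathcal A|\ge 2$, a metric observation space $(\mathcal Z,D)$, transition kernel $\mathbb P_T$, observation density $\mathbb P_Z(z\mid x)$ with respect to a $\sigma$-finite reference measure, rewards $|r(x,a)|\le R_{\max}$, discount $\gamma\in[0,1)$ and initial belief $b_0$. Put $r(b,a)=\mathbb E_{x\sim b}\,r(x,a)$, let $\nu_{b,a}$ be the law of the next observation given $(b,a)$ and let $\psi(b,a,z)$ be the Bayesian update (defined when the normalizing constant is neither $0$ nor $\infty$, hence for $\nu_{b,a}$-almost all $z$). For $k\ge 0$ let $V^*_k(b)$ be the supremum over measurable policies of the expected discounted sum of the $k+1$ rewards collected when $k$ steps follow the present one; for horizon $L\ge 1$, $V^*=V^*_L$. Let $\mathcal B$ be a set of beliefs that contains $b_0$ and is closed under the update. **Assumptions.** There are constants $L_\psi,L_V>0$, $\alpha,\beta\in(0,1]$, $C_{\rm cov},c_\nu,r_0,k_Z>0$ and $D_Z$ such that, for all $b,b'\in\mathcal B$, $a\in\mathcal A$, $z,z'\in\mathcal Z$: (i) $W^1(\psi(b,a,z),\psi(b,a,z'))\le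 L_\psi D(z,z')^\alpha$ whenever both updates are defined; (ii) $|V_k^*(b)-V_k^*(b')|\le L_V W^1(b,b')^\beta$ for $0\le k\le L$; (iii) the covering numbers satisfy $N(\mathcal Z,r)\le C_{\rm cov}r^{-k_Z}$ for $r\in(0,1]$, and $D(z,z')\le D_Z$; (iv) $\nu_{b,a}(\{z':D(z,z')\le r\})\ge c_\nu r^{k_Z}$ for $r\in(0,r_0]$. **Partitioned tree.** Histories are $\tilde h=(a_0,c_1,a_1,c_2,\dots)$ with cells $c_i$. Each history-action node $\tilde ha$ finally has $m(\tilde ha)\ge1$ cells, whose centers are i.i.d. samples of $\nu_{\tilde b(\tilde h),a}$; the belief of the child with center $z^c$ is $\psi(\tilde b(\tilde h),a,z^c)$, and observations are assigned to the nearest center. The partition is adaptive: cells are created one at a time (the observation sampled at a creating visit becomes the new center) according to a schedule depending on the number of visits of $\tilde ha$, and at every node the partition is frozen after at most $S$ visits with at most $M$ cells (a partition fixed beforehand and progressive widening stopped at finitely many cells are special cases). Let $H_L$ be the set of history-action nodes $\tilde ha$ with $\tilde h$ of depth $<L$. The partitioned problem (with the frozen partition) has $Q^{p*}(\tilde h,a)=r(\tilde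 b,a)+\gamma\sum_cP(c\mid\tilde b,a)V^{p*}(\tilde hac)$, $V^{p*}=\max_aQ^{p*}$, and $V^{p*}=\max_a r(\tilde b,a)$ at depth $L$; let $\Delta_{\min}$ be the minimum of $V^{p*}(\tilde h)-Q^{p*}(\tilde h,a)$ over the $\tilde h$ of depth $<L$ and $a\ne a^*(\tilde h)$, where $a^*(\tilde h)$ maximizes $Q^{p*}(\tilde h,\cdot)$. Assume $\Delta_{\min}>0$ almost surely. **Solver.** $\hat V^p_n(b_0)$ is the average return of $n\ge1$ simulations from the root. The first visit of a node of depth $<L$ returns a rollout value (any simulated return at depth $d$ bounded by $R_{\max}\sum_{i=0}^{L-d}\gamma^i$). At later visits of a node of depth $d<L$ an untried action is taken if there is one, and otherwise an action maximizing $$\hat Q(\tilde h,a)+(\beta^{(d+1)})^{1/\xi^{(d+1)}}N(\tilde h)^{\alpha^{(d+1)}/\xi^{(d+1)}}N(\tilde h,a)^{-(1-\eta^{(d+1)})};$$ then $x\sim\tilde b(\tilde h)$ and an observation are sampled afresh from the generative model, $r(x,a)$ is collected, and the simulation continues, discounted by $\gamma$, at the child given by the current partition. A node of depth $L$ returns a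 sampled reward $r(x,a)$, $x\sim\tilde b$, of an action maximizing $r(\tilde b,\cdot)$. The parameters satisfy $\eta^{(L)}\in[\tfrac12,1)$, $\beta^{(d)}>1$ for $1\le d\le L$, $\alpha^{(1)}>2$ and, for $0\le d<L$, $$\xi^{(d+1)}\eta^{(d+1)}(1-\eta^{(d+1)})\le\alpha^{(d+1)}<\xi^{(d+1)}(1-\eta^{(d+1)}),\quad \xi^{(d)}=\alpha^{(d+1)}-1,\quad \eta^{(d)}=\frac{\alpha^{(d+1)}}{\xi^{(d+1)}(1-\eta^{(d+1)})}.$$ **Theorem.** There are a constant $C>0$ depending only on $(C_{\rm cov},c_\nu,r_0,k_Z,D_Z)$ and a number $\beta^{(0)}=\beta^{(0)}(\Delta_{\min})>1$ depending, besides $\Delta_{\min}$, only on these constants and on $R_{\max},\gamma,|\mathcal A|,L,M,S$ and the parameters $\alpha^{(\cdot)},\xi^{(\cdot)},\eta^{(\cdot)},\beta^{(1)},\dots,\beta^{(L)}$, such that for all $n\ge1$ and $\delta_1,\delta_2\in(0,1)$, with probability at least $1-(\delta_1+\delta_2)$, $$|\hat V_n^p(b_0)-V^*(b_0)|\le n^{-(1-\eta^{(0)})}\Bigl(\frac{2\beta^{(0)}}{\delta_1}\Bigr)^{1/\xi^{(0)}}+\frac{\gamma(1-\gamma^L)}{1-\gamma}L_VL_\psi^\beta\max_{\tilde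 ha\in H_L}\Bigl[C\Bigl(\frac{\log(m(\tilde ha)|H_L|/\delta_2)}{m(\tilde ha)}\Bigr)^{1/k_Z}\Bigr]^{\alpha\beta}.$$ In particular, with $\delta_1=\delta_2=\delta/2$ the bound holds with probability at least $1-\delta$ for every $\delta\in(0,1)$. -/

import Mathlib

open MeasureTheory ProbabilityTheory
open scoped ENNReal NNReal

noncomputable section

namespace ContPOMDP

/-! ## POMDPs, beliefs, Bayesian update, optimal value -/

/-- A POMDP with state space `X`, action space `A`, observation space `Z`. The observation model
`P_Z(z | x)` is given by a density `like x z` with respect to a reference measure on `Z`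
(Lebesgue measure for continuous observations, counting measure for discrete ones). -/
structure POMDP (X A Z : Type*) [MeasurableSpace X] [MeasurableSpace Z] where
  trans : A → Kernel X X
  trans_markov : ∀ a, IsMarkovKernel (trans a)
  ref : Measure Z
  ref_sigmaFinite : SigmaFinite ref
  like : X → Z → ℝ≥0∞
  like_measurable : Measurable (Function.uncurry like)
  like_norm : ∀ x, ∫⁻ z, like x z ∂ref = 1
  reward : X → A → ℝ
  reward_measurable : ∀ a, Measurable fun x => reward x a
  discount : ℝ
  b₀ : ProbabilityMeasure X

namespace POMDP

variable {X A Z : Type*} [MeasurableSpace X] [MeasurableSpace Z] (P : POMDP X A Z)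

/-- The propagated belief `b⁻`: the law of `x'` when `x ∼ b` and `x' ∼ P_T(· | x, a)`. -/
def predict (b : ProbabilityMeasure X) (a : A) : ProbabilityMeasure X :=
  ⟨(b : Measure X).bind (P.trans a), by
    have := P.trans_markov a
    infer_instance⟩

/-- The density `P(z | b, a)` of the next observation (the Bayesian normalizer). -/
def evidence (b : ProbabilityMeasure X) (a : A) (z : Z) : ℝ≥0∞ :=
  ∫⁻ x, P.like x z ∂(P.predict b a : Measure X)

/-- The Bayesian update is defined at `z`: the normalizer is neither zero nor infinite. This holds
for almost every observation generated from `(b, a)`. -/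
def Admissible (b : ProbabilityMeasure X) (a : A) (z : Z) : Prop :=
  P.evidence b a z ≠ 0 ∧ P.evidence b a z ≠ ∞

open Classical in
/-- The Bayesian belief update `ψ(b, a, z) ∝ P(z | x') b⁻(dx')`. (The propagated belief is a
placeholder value at the null set of observations where the update is undefined.) -/
def update (b : ProbabilityMeasure X) (a : A) (z : Z) : ProbabilityMeasure X :=
  if h : P.Admissible b a z then
    ⟨(P.evidence b a z)⁻¹ • (P.predict b a : Measure X).withDensity (fun x => P.like x z), by
      constructor
      rw [Measure.smul_apply, withDensity_apply _ MeasurableSet.univ, setLIntegral_univ,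
        smul_eq_mul]
      exact ENNReal.inv_mul_cancel h.1 h.2⟩
  else P.predict b a

/-- The observation law `P(· | b, a)` on `Z`. -/
def obsLaw (b : ProbabilityMeasure X) (a : A) : Measure Z :=
  P.ref.withDensity (P.evidence b a)

/-- The observation model as a kernel. -/
def obsKernel : Kernel X Z :=
  haveI := P.ref_sigmaFinite
  Kernel.withDensity (Kernel.const X P.ref) P.like

/-- The joint law of `(x, z)` where `x ∼ b`, `x' ∼ P_T(· | x, a)`, `z ∼ P_Z(· | x')`. -/
def stepLaw (b : ProbabilityMeasure X) (a : A) : Measure (X × Z) :=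
  (b : Measure X) ⊗ₘ (P.obsKernel ∘ₖ P.trans a)

/-- Expected immediate reward `r(b, a)`. -/
def beliefReward (b : ProbabilityMeasure X) (a : A) : ℝ :=
  ∫ x, P.reward x a ∂(b : Measure X)

/-- A deterministic policy: `act k b` is the action taken at belief `b` when `k` further steps
remain after the current one. -/
structure Policy (X A : Type*) [MeasurableSpace X] where
  act : ℕ → ProbabilityMeasure X → A
  measurable_act : ∀ k a, MeasurableSet {b | act k b = a}

/-- `V^π(b)` with `k` further steps after the current one (so `k + 1` rewards are collected). -/
def value (π : Policy X A) : ℕ → ProbabilityMeasure X → ℝ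
  | 0, b => P.beliefReward b (π.act 0 b)
  | k + 1, b => P.beliefReward b (π.act (k + 1) b) +
      P.discount * ∫ z, value π k (P.update b (π.act (k + 1) b) z) ∂(P.obsLaw b (π.act (k + 1) b))

/-- The optimal value `V^*(b) = sup_π V^π(b)` with `k` further steps after the current one. -/
def optValue (k : ℕ) (b : ProbabilityMeasure X) : ℝ :=
  ⨆ π : Policy X A, P.value π k b

end POMDP

/-- Wasserstein-1 distance: the infimum of the transport cost over all couplings. -/
def W1 {X : Type*} [MeasurableSpace X] [PseudoEMetricSpace X] (μ ν : ProbabilityMeasure X) :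
    ℝ≥0∞ :=
  ⨅ (c : Measure (X × X)) (_ : c.map Prod.fst = μ ∧ c.map Prod.snd = ν),
    ∫⁻ p, edist p.1 p.2 ∂c

/-! ## The partitioned tree -/

/-- A history `(a₀, c₁, a₁, c₂, …)` of the partitioned tree, most recent step first; a cell is
recorded by its index among the cells of its history-action node. -/
abbrev History (A : Type*) := List (A × ℕ)

/-- Index of the independent random seeds consumed by the solver: the `j`-th cell center of node
`(h, a)`, the `s`-th simulation step at node `(h, a)`, and the rollout at node `h`. -/
inductive Seed (A : Type*) where
  | center (h : History A) (a : A) (j : ℕ)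
  | sim (h : History A) (a : A) (s : ℕ)
  | rollout (h : History A)

/-- A generative model of the POMDP: from a belief, an action and a random seed with law `ρ` it
returns the sampled current state (which determines the reward) and the sampled observation. -/
structure Generator {X A Z : Type*} [MeasurableSpace X] [MeasurableSpace Z] (P : POMDP X A Z)
    {E : Type*} [MeasurableSpace E] (ρ : Measure E) where
  gen : ProbabilityMeasure X → A → E → X × Z
  measurable_gen : ∀ a, Measurable fun p : ProbabilityMeasure X × E => gen p.1 a p.2
  map_gen : ∀ b a, ρ.map (gen b a) = P.stepLaw b a

/-- An adaptive partition that is frozen after finitely many visits. `m h a` is the number of cells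
of node `(h, a)` in the frozen partition and `active h a s` the number of cells that exist just
before the `s`-th visit (`s = 0, 1, …`). A visit creates at most one cell, a visit that finds no
cell creates one, there are at most `M` cells, and from the visit number `S` on the partition is
frozen. Progressive widening `m ≤ k_z N(ha)^{α_z}` up to `m h a` cells and a partition fixed
beforehand (`active h a s = m h a`) are instances. -/
structure Widening (A : Type*) (M S : ℕ) where
  m : History A → A → ℕ
  m_pos : ∀ h a, 1 ≤ m h a
  m_le : ∀ h a, m h a ≤ M
  active : History A → A → ℕ → ℕ
  active_mono : ∀ h a s, active h a s ≤ active h a (s + 1)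
  active_step : ∀ h a s, active h a (s + 1) ≤ active h a s + 1
  active_zero : ∀ h a s, active h a s = 0 → active h a (s + 1) = 1
  active_le : ∀ h a s, active h a s ≤ m h a
  active_frozen : ∀ h a s, S ≤ s → active h a s = m h a

namespace Widening

variable {A : Type*} [Fintype A] [DecidableEq A] {M S : ℕ} (W : Widening A M S)

/-- The histories of depth `d` of the (frozen) partitioned tree. -/
def histories : ℕ → Finset (History A)
  | 0 => {[]}
  | d + 1 => (histories d).biUnion fun h => Finset.univ.biUnion fun a =>
      (Finset.range (W.m h a)).image fun j => (a, j) :: h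

/-- The histories of depth less than `L`, i.e. the decision nodes of the tree of depth `L`. -/
def decisionNodes (L : ℕ) : Finset (History A) :=
  (Finset.range L).biUnion W.histories

/-- The set `H_L` of history-action nodes of the tree of depth `L`. -/
def actionNodes (L : ℕ) : Finset (History A × A) :=
  W.decisionNodes L ×ˢ Finset.univ

/-- The partition-loss term, for confidence `δ`:
`γ(1-γ^L)/(1-γ) L_V L_ψ^β max_{ha ∈ H_L} [C (log(m(ha) |H_L| / δ) / m(ha))^{1/k_Z}]^{αβ}`. -/
def partitionLoss (L : ℕ) (γ LV Lψ α β C kZ δ : ℝ) : ℝ :=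
  γ * (1 - γ ^ L) / (1 - γ) * LV * Lψ ^ β *
    ⨆ p : {p // p ∈ W.actionNodes L},
      (C * (Real.log ((W.m p.1.1 p.1.2 : ℝ) * ((W.actionNodes L).card : ℝ) / δ) /
        (W.m p.1.1 p.1.2 : ℝ)) ^ (1 / kZ)) ^ (α * β)

end Widening

/-- The nearest-center rule: the index of the center nearest to `z` among `c 0, …, c (m - 1)`
(the smallest such index in case of a tie). -/
def nearest {Z : Type*} [PseudoMetricSpace Z] (c : ℕ → Z) (m : ℕ) (z : Z) : ℕ :=
  sInf {j | j < m ∧ ∀ i < m, dist z (c j) ≤ dist z (c i)}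

/-! ## Corrected-UCB -/

/-- Parameters `(α⁽ᵈ⁾, ξ⁽ᵈ⁾, η⁽ᵈ⁾, β⁽ᵈ⁾)` of the corrected-UCB rule, indexed by depth. -/
structure UCBParams where
  α : ℕ → ℝ
  ξ : ℕ → ℝ
  η : ℕ → ℝ
  β : ℕ → ℝ

/-- The recursive parameter requirements, from the leaves (depth `L`) to the root (depth `0`). The
values `β⁽¹⁾, …, β⁽ᴸ⁾ > 1` in the bonus are arbitrary. -/
structure UCBParams.Valid (q : UCBParams) (L : ℕ) : Prop where
  leaf : 1 / 2 ≤ q.η L ∧ q.η L < 1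
  α_lower : ∀ d < L, q.ξ (d + 1) * q.η (d + 1) * (1 - q.η (d + 1)) ≤ q.α (d + 1)
  α_upper : ∀ d < L, q.α (d + 1) < q.ξ (d + 1) * (1 - q.η (d + 1))
  ξ_rec : ∀ d < L, q.ξ d = q.α (d + 1) - 1
  η_rec : ∀ d < L, q.η d = q.α (d + 1) / (q.ξ (d + 1) * (1 - q.η (d + 1)))
  α_one : 2 < q.α 1
  β_gt : ∀ d, 1 ≤ d → d ≤ L → 1 < q.β d

section Bandit

variable {A : Type*} [Fintype A]

open Classical in
/-- The set of maximizers of `f`. -/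
def argmax (f : A → ℝ) : Finset A := Finset.univ.filter fun a => ∀ a', f a' ≤ f a

/-- Corrected-UCB index `Q̂(h,a) + β^{1/ξ} N(h)^{α/ξ} / N(h,a)^{1-η}` with the parameters of
depth `d`, where `cnt a = N(h,a)`, `N(h) = ∑ₐ N(h,a)` and `mean a = Q̂(h,a)`. -/
def ucbIndex (q : UCBParams) (d : ℕ) (cnt : A → ℕ) (mean : A → ℝ) (a : A) : ℝ :=
  mean a + q.β d ^ (1 / q.ξ d) * ((∑ a', cnt a' : ℕ) : ℝ) ^ (q.α d / q.ξ d) /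
    (cnt a : ℝ) ^ (1 - q.η d)

open Classical in
/-- Corrected-UCB action selection: an untried action (infinite bonus) if there is one, otherwise a
maximizer of the index; `tie` picks an element of a nonempty set of candidates. -/
def ucbSelect (q : UCBParams) (tie : Finset A → A) (d : ℕ) (cnt : A → ℕ) (mean : A → ℝ) : A :=
  if (Finset.univ.filter fun a => cnt a = 0).Nonempty then
    tie (Finset.univ.filter fun a => cnt a = 0)
  else tie (argmax (ucbIndex q d cnt mean))

/-- Empirical means `Q̂` when action `a` has been tried `cnt a` times and its `s`-th trial returned
`arm a s`. -/
def empMean (arm : A → ℕ → ℝ) (cnt : A → ℕ) (a : A) : ℝ :=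
  (∑ s ∈ Finset.range (cnt a), arm a s) / (cnt a : ℝ)

open Classical in
/-- The counts `N(h, ·)` after `t` selections by `sel`. -/
def counts (sel : (A → ℕ) → (A → ℝ) → A) (arm : A → ℕ → ℝ) : ℕ → A → ℕ
  | 0 => fun _ => 0
  | t + 1 => fun a => counts sel arm t a +
      if a = sel (counts sel arm t) (empMean arm (counts sel arm t)) then 1 else 0

/-- The action of selection number `t` (`t = 0, 1, …`). -/
def choice (sel : (A → ℕ) → (A → ℝ) → A) (arm : A → ℕ → ℝ) (t : ℕ) : A :=
  sel (counts sel arm t) (empMean arm (counts sel arm t))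

end Bandit

/-! ## The solver on the partitioned tree -/

/-- The data of the solver: a generative model, the adaptive partition, the depth, the corrected-UCB
parameters, a tie-breaking rule, and the rollout returns (an arbitrary rollout procedure). -/
structure Solver {X A Z : Type*} [MeasurableSpace X] [MeasurableSpace Z] (P : POMDP X A Z)
    {E : Type*} [MeasurableSpace E] (ρ : Measure E) (M S : ℕ) where
  G : Generator P ρ
  W : Widening A M S
  L : ℕ
  q : UCBParams
  tie : Finset A → A
  tie_mem : ∀ s : Finset A, s.Nonempty → tie s ∈ s
  rollout : History A → ProbabilityMeasure X → E → ℝ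
  measurable_rollout : ∀ h, Measurable (Function.uncurry (rollout h))

namespace Solver

variable {X A Z : Type*} [MeasurableSpace X] [MeasurableSpace Z] {P : POMDP X A Z}
  {E : Type*} [MeasurableSpace E] {ρ : Measure E} {M S : ℕ} (T : Solver P ρ M S)

/-- The centre-point belief `b̃` of a history, `b̃_{k+1} = ψ(b̃_k, a_k, z^c_{k+1})`. The centers of
the cells of `(h, a)` are sampled observations from the generative model at `(b̃(h), a)`. -/
def belief (ω : Seed A → E) : History A → ProbabilityMeasure X
  | [] => P.b₀
  | (a, j) :: h => P.update (belief ω h) a (T.G.gen (belief ω h) a (ω (.center h a j))).2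

/-- The generator call (sampled state, sampled observation) that creates cell `j` of `(h, a)`. -/
def centerDraw (ω : Seed A → E) (h : History A) (a : A) (j : ℕ) : X × Z :=
  T.G.gen (T.belief ω h) a (ω (.center h a j))

/-- The center `z^c` of the `j`-th cell of `(h, a)`. -/
def center (ω : Seed A → E) (h : History A) (a : A) (j : ℕ) : Z := (T.centerDraw ω h a j).2

/-- Visit number `s` of `(h, a)` creates a new cell. -/
def Creates (h : History A) (a : A) (s : ℕ) : Prop :=
  T.W.active h a s < T.W.active h a (s + 1)

open Classical in
/-- The generator call made at visit number `s` of node `(h, a)`. -/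
def draw (ω : Seed A → E) (h : History A) (a : A) (s : ℕ) : X × Z :=
  if T.Creates h a s then T.centerDraw ω h a (T.W.active h a s)
  else T.G.gen (T.belief ω h) a (ω (.sim h a s))

variable [PseudoMetricSpace Z]

open Classical in
/-- The cell to which visit number `s` of node `(h, a)` leads: the newly created one, or the nearest
one among those that exist at this visit. -/
def cell (ω : Seed A → E) (h : History A) (a : A) (s : ℕ) : ℕ :=
  if T.Creates h a s then T.W.active h a s
  else nearest (T.center ω h a) (T.W.active h a s) (T.draw ω h a s).2

open Classical in
/-- The return at visit number `s` of `(h, a)`, namely `r(x, a) + γ G`, where `G` is the return at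
the child `c` reached; `childRet h' i` is the return at visit number `i` of node `h'`, and the child
is being visited for the time numbered by its earlier visits through `(h, a)`. -/
def armReturn (ω : Seed A → E) (childRet : History A → ℕ → ℝ) (h : History A) (a : A) (s : ℕ) : ℝ :=
  P.reward (T.draw ω h a s).1 a + P.discount * childRet ((a, T.cell ω h a s) :: h)
    ((Finset.range s).filter fun s' => T.cell ω h a s' = T.cell ω h a s).card

variable [Fintype A]

/-- `nodeReturn ω k h i` is the return at visit number `i` of node `h` when `k` levels remain below
`h` (so `h` has depth `L - k`). Since a node is entered only through its parent, the statistics of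
the subtree of `h` depend only on the number of visits of `h`, which makes the simulation a recursion
on `k`.
* At a leaf (`k = 0`) a sampled immediate reward of an action maximizing `r(b̃, ·)` is returned.
* Otherwise the first visit expands the node and returns a rollout value, and each later visit
  selects an action by the corrected-UCB rule with the parameters of the child level. -/
def nodeReturn (ω : Seed A → E) : ℕ → History A → ℕ → ℝ
  | 0, h, i =>
      P.reward (T.G.gen (T.belief ω h) (T.tie (argmax (P.beliefReward (T.belief ω h))))
        (ω (.sim h (T.tie (argmax (P.beliefReward (T.belief ω h)))) i))).1
        (T.tie (argmax (P.beliefReward (T.belief ω h))))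
  | _ + 1, h, 0 => T.rollout h (T.belief ω h) (ω (.rollout h))
  | k + 1, h, t + 1 =>
      T.armReturn ω (nodeReturn ω k) h
        (choice (ucbSelect T.q T.tie (h.length + 1)) (T.armReturn ω (nodeReturn ω k) h) t)
        (counts (ucbSelect T.q T.tie (h.length + 1)) (T.armReturn ω (nodeReturn ω k) h) t
          (choice (ucbSelect T.q T.tie (h.length + 1)) (T.armReturn ω (nodeReturn ω k) h) t))

/-- The root estimate `V̂ᵖ_n(b₀)`: the average of the returns of the first `n` simulations. -/
def estimate (ω : Seed A → E) (n : ℕ) : ℝ :=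
  (∑ i ∈ Finset.range n, T.nodeReturn ω T.L [] i) / (n : ℝ)

/-- The law of the independent seeds. -/
def seedLaw (_T : Solver P ρ M S) [IsProbabilityMeasure ρ] : Measure (Seed A → E) :=
  Measure.infinitePi fun _ => ρ

/-- One Bellman backup in the partitioned problem: `Qᵖ(h, a) = r(b̃, a) + γ ∑_c P(c | b̃, a) V(hac)`,
with the cells of the frozen partition. -/
def backup (ω : Seed A → E) (V : History A → ℝ) (h : History A) (a : A) : ℝ :=
  P.beliefReward (T.belief ω h) a + P.discount * ∑ j ∈ Finset.range (T.W.m h a),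
    (P.obsLaw (T.belief ω h) a).real {z | nearest (T.center ω h a) (T.W.m h a) z = j} *
      V ((a, j) :: h)

/-- The optimal value `V^{p*}` of the partitioned problem, with `k` levels below the node. -/
def partValue (ω : Seed A → E) : ℕ → History A → ℝ
  | 0, h => ⨆ a, P.beliefReward (T.belief ω h) a
  | k + 1, h => ⨆ a, T.backup ω (partValue ω k) h a

/-- `Q^{p*}(h, a)` at a node of depth less than `L`. -/
def partQ (ω : Seed A → E) (h : History A) (a : A) : ℝ :=
  T.backup ω (T.partValue ω (T.L - h.length - 1)) h a

variable [DecidableEq A]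

/-- `Δ_min` of the partitioned problem: the minimum of `V^{p*}(h) - Q^{p*}(h, a)` over the decision
nodes `h` and the actions `a ≠ a^*(h)`, where `a^*(h)` is a maximizer of `Q^{p*}(h, ·)`. -/
def minGap (ω : Seed A → E) : ℝ :=
  ⨅ h : {h // h ∈ T.W.decisionNodes T.L},
    ⨅ a : {a // a ≠ T.tie (argmax (T.partQ ω h.1))}, ((⨆ a', T.partQ ω h.1 a') - T.partQ ω h.1 a.1)

end Solver

/-! ## Assumptions -/

section Assumptions

variable {X A Z : Type*} [MeasurableSpace X] [MeasurableSpace Z]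

/-- `B` is a belief space of the POMDP: it contains `b₀` and is closed under the belief update. -/
structure IsBeliefSpace (P : POMDP X A Z) (B : Set (ProbabilityMeasure X)) : Prop where
  init : P.b₀ ∈ B
  update : ∀ b ∈ B, ∀ a z, P.Admissible b a z → P.update b a z ∈ B

/-- Hölder continuity of the belief update in the observation. -/
def HolderUpdate [PseudoEMetricSpace X] [PseudoMetricSpace Z] (P : POMDP X A Z)
    (B : Set (ProbabilityMeasure X)) (Lψ α : ℝ) : Prop :=
  ∀ b ∈ B, ∀ a z z', P.Admissible b a z → P.Admissible b a z' →
    W1 (P.update b a z) (P.update b a z') ≤ ENNReal.ofReal (Lψ * dist z z' ^ α)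

/-- Hölder continuity of the optimal value in the belief, for every remaining horizon up to `L`. -/
def HolderValue [PseudoEMetricSpace X] (P : POMDP X A Z)
    (B : Set (ProbabilityMeasure X)) (L : ℕ) (LV β : ℝ) : Prop :=
  ∀ k ≤ L, ∀ b ∈ B, ∀ b' ∈ B,
    ENNReal.ofReal |P.optValue k b - P.optValue k b'| ≤ ENNReal.ofReal LV * W1 b b' ^ β

/-- Polynomial covering numbers of the observation space. -/
def CoveringBound (Z : Type*) [PseudoMetricSpace Z] (Ccov kZ : ℝ) : Prop :=
  ∀ r : ℝ≥0, 0 < r → r ≤ 1 →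
    (Metric.coveringNumber r (Set.univ : Set Z) : ℝ≥0∞) ≤ ENNReal.ofReal (Ccov * (r : ℝ) ^ (-kZ))

/-- Lower bound on the mass that the observation laws give to balls. -/
def BallMass [PseudoMetricSpace Z] (P : POMDP X A Z) (B : Set (ProbabilityMeasure X))
    (cν r₀ kZ : ℝ) : Prop :=
  ∀ b ∈ B, ∀ a (z : Z) (r : ℝ), 0 < r → r ≤ r₀ →
    ENNReal.ofReal (cν * r ^ kZ) ≤ P.obsLaw b a (Metric.closedBall z r)

end Assumptions

end ContPOMDP

end

open MeasureTheory ProbabilityTheory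
open scoped ENNReal NNReal

noncomputable section

namespace ContPOMDP

/-! ## Polynomial tails -/

section Tail

variable {Ω : Type*} [MeasurableSpace Ω] {μ : Measure Ω} {ξ s c : ℝ} {f g : Ω → ℝ}

/-! The error splits into a search error `|V̂ₙ - V^{p*}|` and a partition error `|V^{p*} - V*|`.

Search error. Freeze the seeds of all cell centers. Beliefs, cells, `V^{p*}` and `Δ_min` become
deterministic, and the solver is a tree of bandits on a finite problem. By induction from the
leaves, the sum of the first `n` returns of a node of depth `d` deviates from `n V^{p*}` by
`n^{η⁽ᵈ⁾} z` with probability at most `c z^{-ξ⁽ᵈ⁾}` (`exists_hasTail_nodeReturn`). Returns need be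
neither independent nor stationary, so every random sample size is replaced by a deterministic one,
and boundedness pays for the replacement. At an action node, rewards and cell frequencies obey
Hoeffding's inequality (the visits before the partition freezes are a bounded perturbation), and
child `j` is examined after exactly `⌊n p_j⌋` visits (`exists_hasTail_arm`). At a decision node,
more than `u` pulls of a suboptimal arm force a deviation of its mean at `u` pulls or of the best
arm's mean at some `s` pulls. The bonus makes the latter events have probability of order
`(u+s)^{-α}`, which sums to `u^{1-α}` (`measure_lt_counts_le`). Suboptimal pulls thus have tail
exponent `α - 1` at scale `T^{α/(ξ(1-η))}`: exactly the `ξ` and `η` of the level above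
(`exists_hasTail_ucb`). Fubini over the center seeds (`infinitePi_le_of_mix`) then removes the
freezing.

Partition error. Given the ancestors, the `m` centers of a node are i.i.d. from its observation law.
A union bound over a minimal `r`-cover shows that they fail to be a `2r`-net with probability at
most `Ccov r^{-k_Z} exp(-m cν r^{k_Z})`; solving for `r` gives the rate (`exists_fill_const`). When
every node of `H_L` is well filled, the partitioned backup integrates the child value at the center
nearest to `z` where the Bellman backup integrates `V*` at the update by `z`. Each level therefore
adds one Hölder error, discounted (`Solver.abs_partValue_sub_optValue_le`). This needs the dynamic
programming recursion for `V*`, obtained from a measurable greedy policy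
(`POMDP.optValue_eq_dpValue`). -/

/-- `f` has a polynomial tail of exponent `ξ` at scale `s` with constant `c`. -/
def HasTail (μ : Measure Ω) (ξ s c : ℝ) (f : Ω → ℝ) : Prop :=
  ∀ z : ℝ, 0 < z → μ {ω | s * z ≤ |f ω|} ≤ ENNReal.ofReal (c * z ^ (-ξ))

theorem HasTail.mono_abs (hf : HasTail μ ξ s c f) (h : ∀ ω, |g ω| ≤ |f ω|) :
    HasTail μ ξ s c g := fun z hz =>
  (measure_mono fun ω (hω : s * z ≤ |g ω|) => hω.trans (h ω)).trans (hf z hz)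

theorem HasTail.mono_scale {s' : ℝ} (hf : HasTail μ ξ s c f) (h : s ≤ s') :
    HasTail μ ξ s' c f := fun z hz =>
  (measure_mono fun ω (hω : s' * z ≤ |f ω|) =>
    (mul_le_mul_of_nonneg_right h hz.le).trans hω).trans (hf z hz)

theorem HasTail.mono_const {c' : ℝ} (hf : HasTail μ ξ s c f) (h : c ≤ c') :
    HasTail μ ξ s c' f := fun z hz =>
  (hf z hz).trans (ENNReal.ofReal_le_ofReal
    (mul_le_mul_of_nonneg_right h (Real.rpow_nonneg hz.le _)))

/-- For `z ≤ 1` the trivial bound by 1 suffices, which is why the constant becomes `max 1 c`; for `z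
≥ 1` a smaller exponent gives a weaker bound. -/
theorem HasTail.mono_exponent [IsProbabilityMeasure μ] {ξ' : ℝ} (hf : HasTail μ ξ s c f)
    (h0 : 0 ≤ ξ') (h : ξ' ≤ ξ) : HasTail μ ξ' s (max 1 c) f := by
  intro z hz
  rcases le_total z 1 with h1 | h1
  · refine prob_le_one.trans ?_
    rw [← ENNReal.ofReal_one]
    refine ENNReal.ofReal_le_ofReal ?_
    have : 1 ≤ z ^ (-ξ') := Real.one_le_rpow_of_pos_of_le_one_of_nonpos hz h1 (by linarith)
    nlinarith [le_max_left 1 c]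
  · refine ((hf.mono_const (le_max_right 1 c)) z hz).trans (ENNReal.ofReal_le_ofReal ?_)
    refine mul_le_mul_of_nonneg_left ?_ (by positivity)
    exact Real.rpow_le_rpow_of_exponent_le h1 (by linarith)

/-- If at most `K` terms add up to `s z`, one of them reaches `s z / K`. The union bound costs a
factor `K` and the rescaling a factor `K ^ ξ`; no independence enters. -/
theorem HasTail.sum {ι : Type*} {F : Finset ι} {f : ι → Ω → ℝ} {K : ℝ} (hK : 0 < K)
    (hF : (F.card : ℝ) ≤ K) (hs : 0 < s) (hc : 0 ≤ c) (hf : ∀ i ∈ F, HasTail μ ξ s c (f i)) :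
    HasTail μ ξ s (K * (c * K ^ ξ)) (fun ω => ∑ i ∈ F, |f i ω|) := by
  intro z hz
  have hsub : {ω | s * z ≤ |(∑ i ∈ F, |f i ω|)|} ⊆ ⋃ i ∈ F, {ω | s * (z / K) ≤ |f i ω|} := by
    intro ω hω
    simp only [Set.mem_ofPred_eq] at hω
    by_contra hcon
    simp only [Set.mem_iUnion, Set.mem_ofPred_eq, not_exists, not_le] at hcon
    rw [abs_of_nonneg (Finset.sum_nonneg fun i _ => abs_nonneg _)] at hω
    rcases F.eq_empty_or_nonempty with rfl | hne
    · simp only [Finset.sum_empty] at hω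
      nlinarith [mul_pos hs hz]
    · have h1 := Finset.sum_lt_sum_of_nonempty hne hcon
      simp only [Finset.sum_const, nsmul_eq_mul] at h1
      have h2 : (F.card : ℝ) * (s * (z / K)) ≤ K * (s * (z / K)) :=
        mul_le_mul_of_nonneg_right hF (by positivity)
      have h3 : K * (s * (z / K)) = s * z := by field_simp
      linarith
  refine (measure_mono hsub).trans ((measure_biUnion_finset_le _ _).trans ?_)
  refine (Finset.sum_le_sum fun i hi => hf i hi (z / K) (by positivity)).trans ?_
  rw [Finset.sum_const, nsmul_eq_mul, ← ENNReal.ofReal_natCast,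
    ← ENNReal.ofReal_mul (by positivity)]
  refine ENNReal.ofReal_le_ofReal ?_
  have : (z / K) ^ (-ξ) = K ^ ξ * z ^ (-ξ) := by
    rw [Real.div_rpow hz.le hK.le, Real.rpow_neg hK.le, div_inv_eq_mul, mul_comm]
  rw [this]
  have h0 : 0 ≤ c * (K ^ ξ * z ^ (-ξ)) := by positivity
  calc (F.card : ℝ) * (c * (K ^ ξ * z ^ (-ξ))) ≤ K * (c * (K ^ ξ * z ^ (-ξ))) :=
        mul_le_mul_of_nonneg_right hF h0
    _ = _ := by ring

theorem HasTail.add (hf : HasTail μ ξ s c f) (hg : HasTail μ ξ s c g) (hs : 0 < s) (hc : 0 ≤ c) :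
    HasTail μ ξ s (2 * (c * 2 ^ ξ)) (fun ω => |f ω| + |g ω|) := by
  have := HasTail.sum (μ := μ) (F := Finset.univ) (f := ![f, g]) (K := 2) (by norm_num)
    (by simp) hs hc (fun i _ => by fin_cases i <;> assumption)
  simpa [Fin.sum_univ_two] using this

theorem HasTail.const_mul {k : ℝ} (hf : HasTail μ ξ s c f) (hk : 0 < k) :
    HasTail μ ξ s (c * k ^ ξ) (fun ω => k * f ω) := by
  intro z hz
  have hsub : {ω | s * z ≤ |k * f ω|} ⊆ {ω | s * (z / k) ≤ |f ω|} := by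
    intro ω hω
    simp only [Set.mem_ofPred_eq, abs_mul, abs_of_pos hk] at hω ⊢
    rw [mul_div_assoc', div_le_iff₀ hk]
    linarith
  refine (measure_mono hsub).trans ((hf (z / k) (by positivity)).trans_eq ?_)
  rw [Real.div_rpow hz.le hk.le, Real.rpow_neg hk.le, div_inv_eq_mul]
  ring_nf

/-- Up to `z = K` the claimed bound is at least 1; beyond `K` the event is empty because `s ≥ 1`. -/
theorem hasTail_of_abs_le [IsProbabilityMeasure μ] {K : ℝ} (hK : 0 < K) (hs : 1 ≤ s) (hξ : 0 ≤ ξ)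
    (h : ∀ ω, |f ω| ≤ K) : HasTail μ ξ s (K ^ ξ) f := by
  intro z hz
  rcases le_or_gt z K with h1 | h1
  · refine prob_le_one.trans ?_
    rw [← ENNReal.ofReal_one]
    refine ENNReal.ofReal_le_ofReal ?_
    rw [Real.rpow_neg hz.le, ← div_eq_mul_inv, ← Real.div_rpow hK.le hz.le]
    exact Real.one_le_rpow ((one_le_div hz).2 h1) hξ
  · have : {ω | s * z ≤ |f ω|} = ∅ := by
      ext ω
      simp only [Set.mem_ofPred_eq, Set.mem_empty_iff_false, iff_false, not_le]
      nlinarith [h ω]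
    simp [this]

/-- Gaussian tails are dominated by polynomial ones. -/
theorem exists_exp_neg_sq_le_rpow (ξ a : ℝ) (hξ : 0 ≤ ξ) (ha : 0 < a) :
    ∃ c : ℝ, 0 ≤ c ∧ ∀ z : ℝ, 0 < z → 2 * Real.exp (-(a * z ^ 2)) ≤ c * z ^ (-ξ) := by
  -- For `z ≥ 1`, `x ^ k / k! ≤ exp x` at `x = a z²` gives decay `z ^ (-2k)`, faster than `z ^
  -- (-ξ)`; the 1 in the maximum handles `z ≤ 1`.
  obtain ⟨k, hk⟩ := exists_nat_ge ξ
  refine ⟨2 * max 1 (k.factorial / a ^ k), by positivity, fun z hz => ?_⟩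
  rw [mul_assoc]
  refine mul_le_mul_of_nonneg_left ?_ zero_le_two
  rcases le_total z 1 with h1 | h1
  · have h2 : 1 ≤ z ^ (-ξ) := Real.one_le_rpow_of_pos_of_le_one_of_nonpos hz h1 (by linarith)
    have h3 : Real.exp (-(a * z ^ 2)) ≤ 1 := Real.exp_le_one_iff.2 (by nlinarith [sq_nonneg z])
    nlinarith [le_max_left 1 ((k.factorial : ℝ) / a ^ k)]
  · have h2 := Real.pow_div_factorial_le_exp (a * z ^ 2) (by positivity) k
    have h3 : z ^ ξ ≤ z ^ (2 * k) := by
      rw [← Real.rpow_natCast]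
      refine Real.rpow_le_rpow_of_exponent_le h1 ?_
      push_cast
      linarith [(Nat.cast_nonneg k : (0 : ℝ) ≤ k)]
    have h4 : a ^ k / k.factorial * z ^ ξ ≤ Real.exp (a * z ^ 2) := by
      refine le_trans ?_ h2
      rw [mul_pow, ← pow_mul, mul_div_right_comm]
      exact mul_le_mul_of_nonneg_left h3 (by positivity)
    rw [Real.exp_neg, Real.rpow_neg hz.le]
    refine le_trans ?_ (mul_le_mul_of_nonneg_right (le_max_right _ _) (by positivity))
    rw [← inv_div, ← mul_inv]
    exact inv_anti₀ (by positivity) h4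

/-- The Hoeffding inequality as a polynomial tail. -/
theorem exists_hasTail_sum_iid (ξ R : ℝ) (hξ : 0 ≤ ξ) (hR : 0 < R) :
    ∃ c : ℝ, 0 ≤ c ∧ ∀ {Ω : Type*} [MeasurableSpace Ω] (μ : Measure Ω) [IsProbabilityMeasure μ]
      (Y : ℕ → Ω → ℝ) (m : ℝ), iIndepFun Y μ → (∀ i, Measurable (Y i)) → (∀ i ω, |Y i ω| ≤ R) →
      (∀ i, ∫ ω, Y i ω ∂μ = m) → ∀ n : ℕ, 1 ≤ n →
      HasTail μ ξ (√n) c (fun ω => ∑ i ∈ Finset.range n, Y i ω - n * m) := by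
  -- A variable with values in `[-R, R]` is sub-Gaussian with variance proxy `R²`, so a deviation
  -- `√n z` of the sum costs `exp (-z² / (2R²))` on each side.
  obtain ⟨c, hc0, hc⟩ := exists_exp_neg_sq_le_rpow ξ (1 / (2 * R ^ 2)) hξ (by positivity)
  refine ⟨c, hc0, ?_⟩
  intro Ω _ μ _ Y m hind hmeas hbd hmean n hn z hz
  have hsub : ∀ i, HasSubgaussianMGF (fun ω => Y i ω - m) ((‖R - -R‖₊ / 2) ^ 2) μ := fun i => by
    have := hasSubgaussianMGF_of_mem_Icc (a := -R) (b := R) (hmeas i).aemeasurable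
      (ae_of_all μ fun ω => abs_le.1 (hbd i ω))
    rwa [hmean i] at this
  have hpar : (((‖R - -R‖₊ / 2) ^ 2 : ℝ≥0) : ℝ) = R ^ 2 := by
    push_cast
    rw [Real.norm_eq_abs, sub_neg_eq_add, abs_of_pos (by linarith)]
    ring
  have hnR : (0 : ℝ) < n := by exact_mod_cast hn
  have hexp : ∀ b : ℝ, 0 < b → -(√n * z) ^ 2 / (2 * n * b) = -(1 / (2 * b) * z ^ 2) := by
    intro b hb
    rw [mul_pow, Real.sq_sqrt hnR.le]
    field_simp
  have hind1 : iIndepFun (fun i ω => Y i ω - m) μ :=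
    hind.comp (fun _ x => x - m) (fun _ => by fun_prop)
  have hind2 : iIndepFun (fun i ω => -(Y i ω - m)) μ :=
    hind.comp (fun _ x => -(x - m)) (fun _ => by fun_prop)
  have h1 := HasSubgaussianMGF.measure_sum_range_ge_le_of_iIndepFun hind1 (n := n)
    (fun i _ => hsub i) (ε := √n * z) (by positivity)
  have h2 := HasSubgaussianMGF.measure_sum_range_ge_le_of_iIndepFun hind2 (n := n)
    (fun i _ => (hsub i).neg) (ε := √n * z) (by positivity)
  rw [hpar, hexp _ (by positivity)] at h1 h2
  have hcover : {ω | √n * z ≤ |∑ i ∈ Finset.range n, Y i ω - n * m|} ⊆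
      {ω | √n * z ≤ ∑ i ∈ Finset.range n, (Y i ω - m)} ∪
        {ω | √n * z ≤ ∑ i ∈ Finset.range n, -(Y i ω - m)} := by
    intro ω hω
    simp only [Set.mem_ofPred_eq, Set.mem_union, Finset.sum_sub_distrib, Finset.sum_neg_distrib,
      Finset.sum_const, Finset.card_range, nsmul_eq_mul] at hω ⊢
    exact le_abs.1 hω
  refine (measure_mono hcover).trans ((measure_union_le _ _).trans ?_)
  rw [← ofReal_measureReal, ← ofReal_measureReal, ← ENNReal.ofReal_add (by positivity)
    (by positivity)]
  refine ENNReal.ofReal_le_ofReal (le_trans ?_ (hc z hz))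
  linarith

end Tail

/-! ## The corrected-UCB bandit -/

section Bandit

variable {A : Type*} (sel : (A → ℕ) → (A → ℝ) → A) (arm : A → ℕ → ℝ)

theorem counts_choice_succ (t : ℕ) :
    counts sel arm (t + 1) (choice sel arm t) = counts sel arm t (choice sel arm t) + 1 := by
  simp [counts, choice]

theorem counts_succ_of_ne {t : ℕ} {a : A} (h : a ≠ choice sel arm t) :
    counts sel arm (t + 1) a = counts sel arm t a := by
  unfold choice at h
  simp [counts, h]

/-- A count starts at 0 and grows by at most one per selection, so it passes through `u` at the
moment of an actual pull. -/
theorem exists_choice_of_lt_counts {T u : ℕ} {a : A} (h : u < counts sel arm T a) :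
    ∃ t < T, counts sel arm t a = u ∧ choice sel arm t = a := by
  induction T with
  | zero => simp [counts] at h
  | succ T ih =>
    rcases lt_or_ge u (counts sel arm T a) with h1 | h1
    · obtain ⟨t, ht, h2⟩ := ih h1
      exact ⟨t, ht.trans (Nat.lt_succ_self T), h2⟩
    · by_cases h2 : a = choice sel arm T
      · refine ⟨T, Nat.lt_succ_self T, ?_, h2.symm⟩
        rw [h2, counts_choice_succ] at h
        rw [h2] at h1 ⊢
        omega
      · rw [counts_succ_of_ne _ _ h2] at h
        omega

variable [Fintype A]

theorem sum_counts (t : ℕ) : ∑ a, counts sel arm t a = t := by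
  classical
  induction t with
  | zero => simp [counts]
  | succ t ih => simp [counts, Finset.sum_add_distrib, ih]

/-- The returns collected in `T` selections are the first returns of each arm. -/
theorem sum_arm_choice (T : ℕ) :
    ∑ t ∈ Finset.range T, arm (choice sel arm t) (counts sel arm t (choice sel arm t)) =
      ∑ a, ∑ s ∈ Finset.range (counts sel arm T a), arm a s := by
  classical
  induction T with
  | zero => simp [counts]
  | succ T ih =>
    rw [Finset.sum_range_succ, ih, ← Finset.add_sum_erase _ _ (Finset.mem_univ (choice sel arm T)),
      ← Finset.add_sum_erase (a := choice sel arm T) (f := fun a =>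
        ∑ s ∈ Finset.range (counts sel arm (T + 1) a), arm a s) _ (Finset.mem_univ _),
      counts_choice_succ, Finset.sum_range_succ]
    have : ∑ x ∈ Finset.univ.erase (choice sel arm T),
        ∑ s ∈ Finset.range (counts sel arm (T + 1) x), arm x s =
        ∑ x ∈ Finset.univ.erase (choice sel arm T),
        ∑ s ∈ Finset.range (counts sel arm T x), arm x s :=
      Finset.sum_congr rfl fun a ha => by rw [counts_succ_of_ne _ _ (Finset.ne_of_mem_erase ha)]
    rw [this]
    ring

theorem mem_argmax {f : A → ℝ} {a : A} : a ∈ argmax f ↔ ∀ a', f a' ≤ f a := by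
  simp [argmax]

theorem argmax_nonempty [Nonempty A] (f : A → ℝ) : (argmax f).Nonempty := by
  obtain ⟨a, ha⟩ := Finite.exists_max f
  exact ⟨a, mem_argmax.2 ha⟩

theorem apply_tie_argmax [Nonempty A] {tie : Finset A → A}
    (htie : ∀ s : Finset A, s.Nonempty → tie s ∈ s) (f : A → ℝ) (a : A) :
    f a ≤ f (tie (argmax f)) :=
  mem_argmax.1 (htie _ (argmax_nonempty f)) a

/-- Untried arms take precedence, so selecting an arm already tried certifies that no arm is untried
and that the index was maximized. -/
theorem ucbIndex_le_of_ucbSelect_eq {q : UCBParams} {tie : Finset A → A}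
    (htie : ∀ s : Finset A, s.Nonempty → tie s ∈ s) {d : ℕ} {cnt : A → ℕ} {mean : A → ℝ} {a : A}
    (h : ucbSelect q tie d cnt mean = a) (ha : cnt a ≠ 0) (a' : A) :
    cnt a' ≠ 0 ∧ ucbIndex q d cnt mean a' ≤ ucbIndex q d cnt mean a := by
  have : Nonempty A := ⟨a⟩
  unfold ucbSelect at h
  split_ifs at h with hne
  · have := htie _ hne
    rw [h] at this
    simp [ha] at this
  · constructor
    · intro h0
      exact hne ⟨a', by simp [h0]⟩
    · rw [← h]
      exact apply_tie_argmax htie _ _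

/-- If a suboptimal arm is pulled more than `u` times, then its empirical mean after `u` pulls was
too large, or the upper confidence bound of the optimal arm was too small at some time. -/
theorem lt_counts_imp {q : UCBParams} {tie : Finset A → A}
    (htie : ∀ s : Finset A, s.Nonempty → tie s ∈ s) {d T u : ℕ} {a a₀ : A} (hne : a ≠ a₀)
    (hu : 1 ≤ u) {m Δ : ℝ} (hβ : 0 ≤ q.β d) (hα : 0 ≤ q.α d / q.ξ d)
    (hbonus : q.β d ^ (1 / q.ξ d) * (T : ℝ) ^ (q.α d / q.ξ d) / (u : ℝ) ^ (1 - q.η d) ≤ Δ / 2)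
    (h : u < counts (ucbSelect q tie d) arm T a) :
    m - Δ / 2 ≤ (∑ s ∈ Finset.range u, arm a s) / u ∨
    ∃ s ∈ Finset.Icc 1 T, (∑ i ∈ Finset.range s, arm a₀ i) / s +
      q.β d ^ (1 / q.ξ d) * ((u + s : ℕ) : ℝ) ^ (q.α d / q.ξ d) / (s : ℝ) ^ (1 - q.η d) ≤ m := by
  classical
  -- At the time `t` of the pull that finds `u` earlier ones, failure of both alternatives puts the
  -- index of `a` below `(m - Δ/2) + Δ/2 = m` and that of `a₀` above `m`, so `a` could not have been
  -- selected.
  obtain ⟨t, htT, hcu, hch⟩ := exists_choice_of_lt_counts _ _ h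
  set sel := ucbSelect q tie d with hsel
  have hsum := sum_counts sel arm t
  obtain ⟨h0, hidx⟩ := ucbIndex_le_of_ucbSelect_eq htie (a' := a₀) hch (by omega)
  by_contra! hcon
  obtain ⟨hc1, hc2⟩ := hcon
  -- Since `t` is at least `u + s` with `s` the count of `a₀`, the bonus of `a₀` at time `t`
  -- dominates the one at `u + s`. The time disappears from the bad event, leaving a union over `s`
  -- alone.
  have hpair : counts sel arm t a + counts sel arm t a₀ ≤ t := by
    have := Finset.sum_le_sum_of_subset (f := counts sel arm t)
      (Finset.subset_univ ({a, a₀} : Finset A))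
    rwa [Finset.sum_pair hne, hsum] at this
  have hb := hc2 (counts sel arm t a₀) (Finset.mem_Icc.2 ⟨by omega, by omega⟩)
  simp only [ucbIndex, hsum, empMean, hcu] at hidx
  have hβ' : 0 ≤ q.β d ^ (1 / q.ξ d) := Real.rpow_nonneg hβ _
  have e1 : q.β d ^ (1 / q.ξ d) * ((u + counts sel arm t a₀ : ℕ) : ℝ) ^ (q.α d / q.ξ d) /
      (counts sel arm t a₀ : ℝ) ^ (1 - q.η d) ≤
      q.β d ^ (1 / q.ξ d) * (t : ℝ) ^ (q.α d / q.ξ d) / (counts sel arm t a₀ : ℝ) ^ (1 - q.η d) := by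
    have : ((u + counts sel arm t a₀ : ℕ) : ℝ) ≤ t := by exact_mod_cast (by omega)
    gcongr
  have e2 : q.β d ^ (1 / q.ξ d) * (t : ℝ) ^ (q.α d / q.ξ d) / (u : ℝ) ^ (1 - q.η d) ≤
      q.β d ^ (1 / q.ξ d) * (T : ℝ) ^ (q.α d / q.ξ d) / (u : ℝ) ^ (1 - q.η d) := by
    have : (t : ℝ) ≤ T := by exact_mod_cast htT.le
    gcongr
  linarith

end Bandit

/-- Tail sums of `x ^ (-α)`. -/
theorem sum_rpow_neg_le {α : ℝ} (hα : 2 ≤ α) {u : ℕ} (hu : 1 ≤ u) (T : ℕ) :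
    ∑ s ∈ Finset.Icc 1 T, ((u + s : ℕ) : ℝ) ^ (-α) ≤ (u : ℝ) ^ (1 - α) := by
  -- Telescoping form. By Bernoulli's inequality, `x^(1-α) - (x+1)^(1-α) ≥ (α-1)(x+1)^(1-α)/x`,
  -- which dominates `(x+1)^(-α)` because `α - 1 ≥ 1`.
  suffices h : ∑ s ∈ Finset.Icc 1 T, ((u + s : ℕ) : ℝ) ^ (-α) ≤
      (u : ℝ) ^ (1 - α) - ((u + T : ℕ) : ℝ) ^ (1 - α) by
    have : (0 : ℝ) ≤ ((u + T : ℕ) : ℝ) ^ (1 - α) := by positivity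
    linarith
  induction T with
  | zero => simp
  | succ T ih =>
    rw [Finset.sum_Icc_succ_top (by omega)]
    set x : ℝ := ((u + T : ℕ) : ℝ) with hx
    have hx0 : 0 < x := by rw [hx]; exact_mod_cast (by omega)
    have hx1 : ((u + (T + 1) : ℕ) : ℝ) = x + 1 := by rw [hx]; push_cast; ring
    rw [hx1]
    have hb : 1 + (α - 1) * (1 / x) ≤ (1 + 1 / x) ^ (α - 1) :=
      one_add_mul_self_le_rpow_one_add (by have : 0 < 1 / x := by positivity
                                           linarith) (by linarith)
    have e1 : x ^ (1 - α) = (x + 1) ^ (1 - α) * (1 + 1 / x) ^ (α - 1) := by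
      have : 1 + 1 / x = (x + 1) / x := by field_simp
      rw [this, Real.div_rpow (by positivity) hx0.le, mul_div_assoc', ← Real.rpow_add (by positivity),
        show 1 - α + (α - 1) = 0 by ring, Real.rpow_zero, one_div, ← Real.rpow_neg hx0.le]
      ring_nf
    have e2 : (x + 1) ^ (-α) ≤ (x + 1) ^ (1 - α) * (1 / x) := by
      have : (x + 1) ^ (-α) = (x + 1) ^ (1 - α) * (1 / (x + 1)) := by
        rw [show -α = (1 - α) + (-1) by ring, Real.rpow_add (by positivity), Real.rpow_neg_one,
          one_div]
      rw [this]
      have : (0 : ℝ) ≤ (x + 1) ^ (1 - α) := by positivity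
      gcongr
      linarith
    have e3 : 0 ≤ (x + 1) ^ (1 - α) * (1 / x) := by positivity
    have e4 : (x + 1) ^ (1 - α) * (1 + (α - 1) * (1 / x)) ≤ x ^ (1 - α) := by
      rw [e1]
      exact mul_le_mul_of_nonneg_left hb (by positivity)
    nlinarith

/-! ### Tail bounds for pull counts and total return of corrected-UCB -/

section BanditTail

variable {A : Type*} [Fintype A] {Ω : Type*} [MeasurableSpace Ω] {μ : Measure Ω}

/-- The sample sizes `u` and `s` in the bad events are deterministic, so the arm tails apply
although the pulls are adaptive. A deviation `u Δ/2` at scale `u^η` costs `u^(-ξ(1-η))`, at most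
`u^(1-α)` by `hαξ`. A deviation of the size of the bonus at `s` pulls costs `β⁻¹ (u+s)^(-α)`, whose
sum over `s` is at most `β⁻¹ u^(1-α)`. -/
theorem measure_lt_counts_le {q : UCBParams} {tie : Finset A → A}
    (htie : ∀ s : Finset A, s.Nonempty → tie s ∈ s) {d T u : ℕ} {a a₀ : A} (hne : a ≠ a₀)
    (hu : 1 ≤ u) {Δ c : ℝ} (hβ : 0 < q.β d) (hα : 2 ≤ q.α d) (hξ : 0 < q.ξ d) (hc : 0 ≤ c)
    (hαξ : q.α d ≤ q.ξ d * (1 - q.η d)) (hΔ : 0 < Δ)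
    (hbonus : q.β d ^ (1 / q.ξ d) * (T : ℝ) ^ (q.α d / q.ξ d) / (u : ℝ) ^ (1 - q.η d) ≤ Δ / 2)
    {arm : Ω → A → ℕ → ℝ} {m : A → ℝ} (hgap : Δ ≤ m a₀ - m a)
    (htail : ∀ a (n : ℕ), 1 ≤ n → HasTail μ (q.ξ d) ((n : ℝ) ^ q.η d) c
      (fun ω => ∑ s ∈ Finset.range n, arm ω a s - n * m a)) :
    μ {ω | u < counts (ucbSelect q tie d) (arm ω) T a} ≤
      ENNReal.ofReal (c * ((Δ / 2) ^ (-q.ξ d) + (q.β d)⁻¹) * (u : ℝ) ^ (1 - q.α d)) := by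
  have hu0 : (0 : ℝ) < u := by exact_mod_cast hu
  have hu1 : (1 : ℝ) ≤ u := by exact_mod_cast hu
  set b := q.β d ^ (1 / q.ξ d) with hb
  have hb0 : 0 < b := by positivity
  have hsub : {ω | u < counts (ucbSelect q tie d) (arm ω) T a} ⊆
      {ω | (u : ℝ) ^ q.η d * ((u : ℝ) ^ (1 - q.η d) * (Δ / 2)) ≤
        |∑ s ∈ Finset.range u, arm ω a s - u * m a|} ∪
      ⋃ s ∈ Finset.Icc 1 T, {ω | (s : ℝ) ^ q.η d * (b * ((u + s : ℕ) : ℝ) ^ (q.α d / q.ξ d)) ≤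
        |∑ i ∈ Finset.range s, arm ω a₀ i - s * m a₀|} := by
    intro ω hω
    rcases lt_counts_imp (arm ω) htie hne hu (m := m a₀) hβ.le (by positivity) hbonus hω with
      h1 | ⟨s, hs, h1⟩
    · left
      rw [le_div_iff₀ hu0] at h1
      rw [Set.mem_ofPred_eq, ← mul_assoc, ← Real.rpow_add hu0, add_sub_cancel, Real.rpow_one]
      refine le_trans ?_ (le_abs_self _)
      nlinarith
    · right
      refine Set.mem_biUnion hs ?_
      have hs0 : (0 : ℝ) < s := by exact_mod_cast (Finset.mem_Icc.1 hs).1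
      rw [Set.mem_ofPred_eq]
      refine le_trans ?_ (neg_le_abs _)
      have e : (s : ℝ) ^ q.η d * (b * ((u + s : ℕ) : ℝ) ^ (q.α d / q.ξ d)) =
          s * (b * ((u + s : ℕ) : ℝ) ^ (q.α d / q.ξ d) / (s : ℝ) ^ (1 - q.η d)) := by
        have : (s : ℝ) = (s : ℝ) ^ q.η d * (s : ℝ) ^ (1 - q.η d) := by
          rw [← Real.rpow_add hs0, add_sub_cancel, Real.rpow_one]
        have h0 : (s : ℝ) ^ (1 - q.η d) ≠ 0 := (Real.rpow_pos_of_pos hs0 _).ne'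
        calc _ = (s : ℝ) ^ q.η d * (s : ℝ) ^ (1 - q.η d) *
              (b * ((u + s : ℕ) : ℝ) ^ (q.α d / q.ξ d) / (s : ℝ) ^ (1 - q.η d)) := by field_simp
          _ = _ := by rw [← this]
      rw [e]
      have h2 := mul_le_mul_of_nonneg_left h1 hs0.le
      rw [mul_add, mul_div_cancel₀ _ hs0.ne'] at h2
      linarith
  refine (measure_mono hsub).trans ((measure_union_le _ _).trans ?_)
  have hA : μ {ω | (u : ℝ) ^ q.η d * ((u : ℝ) ^ (1 - q.η d) * (Δ / 2)) ≤
      |∑ s ∈ Finset.range u, arm ω a s - u * m a|} ≤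
      ENNReal.ofReal (c * (Δ / 2) ^ (-q.ξ d) * (u : ℝ) ^ (1 - q.α d)) := by
    refine (htail a u hu _ (by positivity)).trans (ENNReal.ofReal_le_ofReal ?_)
    rw [Real.mul_rpow (by positivity) (by positivity), ← Real.rpow_mul hu0.le, mul_comm (_ ^ _),
      mul_assoc]
    gcongr
    nlinarith
  have hB : μ (⋃ s ∈ Finset.Icc 1 T,
      {ω | (s : ℝ) ^ q.η d * (b * ((u + s : ℕ) : ℝ) ^ (q.α d / q.ξ d)) ≤
        |∑ i ∈ Finset.range s, arm ω a₀ i - s * m a₀|}) ≤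
      ENNReal.ofReal (c * (q.β d)⁻¹ * (u : ℝ) ^ (1 - q.α d)) := by
    refine (measure_biUnion_finset_le _ _).trans ?_
    have hterm : ∀ s ∈ Finset.Icc 1 T,
        μ {ω | (s : ℝ) ^ q.η d * (b * ((u + s : ℕ) : ℝ) ^ (q.α d / q.ξ d)) ≤
        |∑ i ∈ Finset.range s, arm ω a₀ i - s * m a₀|} ≤
        ENNReal.ofReal (c * (q.β d)⁻¹ * ((u + s : ℕ) : ℝ) ^ (-q.α d)) := by
      intro s hs
      have hus : (0 : ℝ) < ((u + s : ℕ) : ℝ) := by exact_mod_cast (by omega)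
      refine (htail a₀ s (Finset.mem_Icc.1 hs).1 _ (by positivity)).trans_eq ?_
      rw [Real.mul_rpow hb0.le (by positivity), ← Real.rpow_mul hus.le, hb, ← Real.rpow_mul hβ.le,
        show 1 / q.ξ d * -q.ξ d = -1 by field_simp, Real.rpow_neg_one,
        show q.α d / q.ξ d * -q.ξ d = -q.α d by field_simp, mul_assoc]
    refine (Finset.sum_le_sum hterm).trans ?_
    rw [← ENNReal.ofReal_sum_of_nonneg (fun s _ => by positivity)]
    refine ENNReal.ofReal_le_ofReal ?_
    rw [← Finset.mul_sum]
    exact mul_le_mul_of_nonneg_left (sum_rpow_neg_le hα hu T) (by positivity)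
  refine (add_le_add hA hB).trans_eq ?_
  rw [← ENNReal.ofReal_add (by positivity) (by positivity)]
  ring_nf

/-- The number of pulls of a suboptimal arm. -/
theorem exists_hasTail_counts (q : UCBParams) (d : ℕ) (Δ c : ℝ) (hβ : 0 < q.β d) (hα : 2 < q.α d)
    (hξ : 0 < q.ξ d) (hη : q.η d < 1) (hc : 0 ≤ c)
    (hαξ : q.α d ≤ q.ξ d * (1 - q.η d)) (hΔ : 0 < Δ) :
    ∃ c' : ℝ, 0 ≤ c' ∧ ∀ {A : Type*} [Fintype A] {Ω : Type*} [MeasurableSpace Ω] (μ : Measure Ω)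
      [IsProbabilityMeasure μ] (tie : Finset A → A) (_ : ∀ s : Finset A, s.Nonempty → tie s ∈ s)
      (T : ℕ) (a a₀ : A) (arm : Ω → A → ℕ → ℝ) (m : A → ℝ), 1 ≤ T → a ≠ a₀ → Δ ≤ m a₀ - m a →
      (∀ a (n : ℕ), 1 ≤ n → HasTail μ (q.ξ d) ((n : ℝ) ^ q.η d) c
        (fun ω => ∑ s ∈ Finset.range n, arm ω a s - n * m a)) →
      HasTail μ (q.α d - 1) ((T : ℝ) ^ (q.α d / (q.ξ d * (1 - q.η d)))) c'
        (fun ω => (counts (ucbSelect q tie d) (arm ω) T a : ℝ)) := by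
  -- With `e` the scale exponent, the bonus at horizon `T` is at most `Δ/2` after `κ T^e` pulls. For
  -- `z ≤ z₀` the tail bound is at least 1; for larger `z`, `y/2` exceeds both 1 and `κ T^e`.
  set κ : ℝ := (q.β d ^ (1 / q.ξ d) * (2 / Δ)) ^ (1 / (1 - q.η d)) with hκ
  set z₀ : ℝ := max 2 (2 * κ) with hz₀
  set C₁ : ℝ := c * ((Δ / 2) ^ (-q.ξ d) + (q.β d)⁻¹) with hC₁
  have h1η : 0 < 1 - q.η d := by linarith
  have hz₀0 : 0 < z₀ := lt_of_lt_of_le two_pos (le_max_left _ _)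
  have hC₁0 : 0 ≤ C₁ := by positivity
  refine ⟨max (z₀ ^ (q.α d - 1)) (C₁ * 2 ^ (q.α d - 1)), by positivity, ?_⟩
  intro A _ Ω _ μ _ tie htie T a a₀ arm m hT hne hgap htail z hz
  set e := q.α d / (q.ξ d * (1 - q.η d)) with he
  have he0 : 0 ≤ e := by positivity
  have hT1 : (1 : ℝ) ≤ T := by exact_mod_cast hT
  have hTe : 1 ≤ (T : ℝ) ^ e := Real.one_le_rpow hT1 he0
  rcases le_or_gt z z₀ with hzz | hzz
  · refine prob_le_one.trans ?_
    rw [← ENNReal.ofReal_one]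
    refine ENNReal.ofReal_le_ofReal ?_
    refine le_trans ?_ (mul_le_mul_of_nonneg_right (le_max_left _ _) (by positivity))
    rw [Real.rpow_neg hz.le, ← div_eq_mul_inv, ← Real.div_rpow hz₀0.le hz.le]
    exact Real.one_le_rpow ((one_le_div hz).2 hzz) (by linarith)
  · have hz2 : 2 < z := lt_of_le_of_lt (le_max_left _ _) hzz
    have hzκ : 2 * κ < z := lt_of_le_of_lt (le_max_right _ _) hzz
    set y : ℝ := (T : ℝ) ^ e * z with hy
    have hy2 : 2 ≤ y := by nlinarith
    -- A count of at least `y` is at least `⌈y⌉₊`, hence strictly above `u`; and `u ≥ y - 1 ≥ y / 2`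
    -- since `y ≥ 2`.
    set u : ℕ := ⌈y⌉₊ - 1 with hu
    have hceil : y ≤ (⌈y⌉₊ : ℝ) := Nat.le_ceil y
    have hc2 : 2 ≤ ⌈y⌉₊ := by
      have : (2 : ℝ) ≤ (⌈y⌉₊ : ℝ) := hy2.trans hceil
      exact_mod_cast this
    have huc : (u : ℝ) = (⌈y⌉₊ : ℝ) - 1 := by
      rw [hu, Nat.cast_sub (by omega), Nat.cast_one]
    have huy : y / 2 ≤ u := by rw [huc]; linarith
    have hu1 : 1 ≤ u := by omega
    have hu0 : (0 : ℝ) < u := by exact_mod_cast hu1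
    have hsub : {ω | (T : ℝ) ^ e * z ≤ |(counts (ucbSelect q tie d) (arm ω) T a : ℝ)|} ⊆
        {ω | u < counts (ucbSelect q tie d) (arm ω) T a} := by
      intro ω hω
      rw [Set.mem_ofPred_eq, Nat.abs_cast] at hω
      have := Nat.ceil_le.2 hω
      show u < _
      have : ⌈y⌉₊ ≤ counts (ucbSelect q tie d) (arm ω) T a := this
      omega
    have hbonus : q.β d ^ (1 / q.ξ d) * (T : ℝ) ^ (q.α d / q.ξ d) / (u : ℝ) ^ (1 - q.η d) ≤
        Δ / 2 := by
      rw [div_le_iff₀ (by positivity)]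
      have h1 : (κ * (T : ℝ) ^ e) ^ (1 - q.η d) ≤ (u : ℝ) ^ (1 - q.η d) := by
        refine Real.rpow_le_rpow (by positivity) ?_ h1η.le
        refine le_trans ?_ huy
        rw [hy]
        nlinarith
      rw [Real.mul_rpow (by positivity) (by positivity), ← Real.rpow_mul (by positivity),
        ← Real.rpow_mul (by positivity), show 1 / (1 - q.η d) * (1 - q.η d) = 1 by field_simp,
        Real.rpow_one, show e * (1 - q.η d) = q.α d / q.ξ d by rw [he]; field_simp] at h1
      calc q.β d ^ (1 / q.ξ d) * (T : ℝ) ^ (q.α d / q.ξ d)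
          = Δ / 2 * (q.β d ^ (1 / q.ξ d) * (2 / Δ) * (T : ℝ) ^ (q.α d / q.ξ d)) := by field_simp
        _ ≤ _ := mul_le_mul_of_nonneg_left h1 (by positivity)
    refine (measure_mono hsub).trans ((measure_lt_counts_le htie hne hu1 hβ hα.le hξ hc hαξ hΔ hbonus
      hgap htail).trans (ENNReal.ofReal_le_ofReal ?_))
    refine le_trans ?_ (mul_le_mul_of_nonneg_right (le_max_right _ _) (by positivity))
    rw [← hC₁, mul_assoc C₁]
    refine mul_le_mul_of_nonneg_left ?_ hC₁0
    have : (2 : ℝ) ^ (q.α d - 1) * z ^ (-(q.α d - 1)) = (z / 2) ^ (1 - q.α d) := by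
      rw [Real.div_rpow hz.le two_pos.le, neg_sub, div_eq_mul_inv, ← Real.rpow_neg two_pos.le,
        neg_sub, mul_comm]
    rw [this]
    refine Real.rpow_le_rpow_of_nonpos (by positivity) (le_trans ?_ huy) (by linarith)
    rw [hy]
    nlinarith

/-- Corrected-UCB turns polynomial tails of the arms into a polynomial tail of its total return. -/
theorem exists_hasTail_ucb (K : ℕ) (q : UCBParams) (d : ℕ) (R Δ c : ℝ) (hβ : 0 < q.β d)
    (hα : 2 < q.α d) (hξ : 0 < q.ξ d) (hη0 : 0 ≤ q.η d) (hη : q.η d < 1) (hc : 0 ≤ c)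
    (hlow : q.ξ d * q.η d * (1 - q.η d) ≤ q.α d) (hαξ : q.α d < q.ξ d * (1 - q.η d))
    (hΔ : 0 < Δ) (hR : 0 < R) :
    ∃ c' : ℝ, 0 ≤ c' ∧ ∀ {A : Type*} [Fintype A] {Ω : Type*} [MeasurableSpace Ω] (μ : Measure Ω)
      [IsProbabilityMeasure μ] (tie : Finset A → A) (_ : ∀ s : Finset A, s.Nonempty → tie s ∈ s)
      (T : ℕ) (a₀ : A) (arm : Ω → A → ℕ → ℝ) (m : A → ℝ), Fintype.card A ≤ K → 1 ≤ T →
      (∀ a ≠ a₀, Δ ≤ m a₀ - m a) →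
      (∀ ω a s, |arm ω a s| ≤ R) → (∀ a, |m a| ≤ R) →
      (∀ a (n : ℕ), 1 ≤ n → HasTail μ (q.ξ d) ((n : ℝ) ^ q.η d) c
        (fun ω => ∑ s ∈ Finset.range n, arm ω a s - n * m a)) →
      HasTail μ (q.α d - 1) ((T : ℝ) ^ (q.α d / (q.ξ d * (1 - q.η d)))) c'
        (fun ω => ∑ t ∈ Finset.range T, arm ω (choice (ucbSelect q tie d) (arm ω) t)
            (counts (ucbSelect q tie d) (arm ω) t (choice (ucbSelect q tie d) (arm ω) t)) -
          T * m a₀) := by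
  classical
  obtain ⟨c₁, hc₁0, hc₁⟩ := exists_hasTail_counts q d Δ c hβ hα hξ hη hc hαξ.le hΔ
  set ξ' := q.α d - 1 with hξ'
  set c₂ : ℝ := c₁ * (4 * R) ^ ξ' with hc₂
  have hc₂0 : 0 ≤ c₂ := by positivity
  set c₃ : ℝ := max (max 1 c) ((K + 1 : ℝ) * (c₂ * (K + 1 : ℝ) ^ ξ')) with hc₃
  have hc₃0 : 0 ≤ c₃ := by positivity
  refine ⟨2 * (c₃ * 2 ^ ξ'), by positivity, ?_⟩
  intro A _ Ω _ μ _ tie htie T a₀ arm m hK hT hgap harm hm htail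
  set e := q.α d / (q.ξ d * (1 - q.η d)) with he
  have h1η : 0 < 1 - q.η d := by linarith
  have hden : 0 < q.ξ d * (1 - q.η d) := by positivity
  have hT1 : (1 : ℝ) ≤ T := by exact_mod_cast hT
  have hTe : 0 < (T : ℝ) ^ e := by positivity
  -- The lower requirement on `α` says exactly that `e ≥ η`, so the fluctuation `T^η` of the best
  -- arm fits into the scale `T^e`. The upper one gives `α - 1 ≤ ξ`.
  have hηe : q.η d ≤ e := by
    rw [he, le_div_iff₀ hden]
    linarith
  have hξξ : ξ' ≤ q.ξ d := by nlinarith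
  have h1 : HasTail μ ξ' ((T : ℝ) ^ e) c₃
      (fun ω => ∑ s ∈ Finset.range T, arm ω a₀ s - T * m a₀) :=
    (((htail a₀ T hT).mono_exponent (by linarith) hξξ).mono_scale
      (Real.rpow_le_rpow_of_exponent_le hT1 hηe)).mono_const (le_max_left _ _)
  have h2 : HasTail μ ξ' ((T : ℝ) ^ e) c₃ (fun ω => ∑ a ∈ Finset.univ.erase a₀,
      |4 * R * (counts (ucbSelect q tie d) (arm ω) T a : ℝ)|) := by
    refine (HasTail.sum (K := (K + 1 : ℝ)) (by positivity) ?_ hTe hc₂0 fun a ha =>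
      (hc₁ μ tie htie T a a₀ arm m hT (Finset.ne_of_mem_erase ha)
        (hgap a (Finset.ne_of_mem_erase ha)) htail).const_mul (by positivity)).mono_const
        (le_max_right _ _)
    have : ((Finset.univ.erase a₀).card : ℝ) ≤ K := by
      exact_mod_cast (Finset.card_le_univ _).trans hK
    linarith
  refine (h1.add h2 hTe hc₃0).mono_abs fun ω => ?_
  set N : A → ℕ := counts (ucbSelect q tie d) (arm ω) T with hN
  have hsumN : ∑ a, N a = T := sum_counts _ _ T
  rw [sum_arm_choice, ← hN, ← Finset.add_sum_erase _ _ (Finset.mem_univ a₀)]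
  have hsplit : (T : ℝ) = N a₀ + ∑ a ∈ Finset.univ.erase a₀, (N a : ℝ) := by
    rw [Finset.add_sum_erase _ (fun a => (N a : ℝ)) (Finset.mem_univ a₀), ← hsumN]
    push_cast
    rfl
  have hN₀ : N a₀ ≤ T := hsumN ▸ Finset.single_le_sum (f := N) (fun _ _ => Nat.zero_le _)
    (Finset.mem_univ a₀)
  have hsumabs : ∀ (a : A) (F : Finset ℕ), |∑ s ∈ F, arm ω a s| ≤ F.card * R := fun a F => by
    refine (Finset.abs_sum_le_sum_abs _ _).trans ?_
    refine (Finset.sum_le_card_nsmul _ _ R fun s _ => harm ω a s).trans_eq ?_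
    rw [nsmul_eq_mul]
  -- The best arm is evaluated at `T` returns instead of its random count. The `T - N a₀` added
  -- returns are as many as the suboptimal pulls `S`; they and the suboptimal returns contribute at
  -- most `R S` each.
  have hdiff : ∑ s ∈ Finset.range T, arm ω a₀ s = ∑ s ∈ Finset.range (N a₀), arm ω a₀ s +
      ∑ s ∈ Finset.Ico (N a₀) T, arm ω a₀ s := by
    rw [Finset.sum_range_add_sum_Ico _ hN₀]
  have hIco : |∑ s ∈ Finset.Ico (N a₀) T, arm ω a₀ s| ≤
      (∑ a ∈ Finset.univ.erase a₀, (N a : ℝ)) * R := by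
    refine (hsumabs a₀ _).trans_eq ?_
    rw [Nat.card_Ico, Nat.cast_sub hN₀, hsplit]
    ring
  have hoth : |∑ a ∈ Finset.univ.erase a₀, ∑ s ∈ Finset.range (N a), arm ω a s| ≤
      (∑ a ∈ Finset.univ.erase a₀, (N a : ℝ)) * R := by
    rw [Finset.sum_mul]
    refine (Finset.abs_sum_le_sum_abs _ _).trans (Finset.sum_le_sum fun a _ => ?_)
    simpa using hsumabs a (Finset.range (N a))
  have hS0 : 0 ≤ ∑ a ∈ Finset.univ.erase a₀, (N a : ℝ) := Finset.sum_nonneg fun _ _ => by positivity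
  have hbig : ∑ a ∈ Finset.univ.erase a₀, |4 * R * (N a : ℝ)| =
      4 * R * ∑ a ∈ Finset.univ.erase a₀, (N a : ℝ) := by
    rw [Finset.mul_sum]
    exact Finset.sum_congr rfl fun a _ => abs_of_nonneg (by positivity)
  rw [hbig, hdiff]
  set S := ∑ a ∈ Finset.univ.erase a₀, (N a : ℝ)
  rw [abs_of_nonneg (by positivity : (0 : ℝ) ≤ 4 * R * S)]
  refine le_trans ?_ (le_abs_self _)
  have hr := abs_le.1 hIco
  have ho := abs_le.1 hoth
  rw [abs_le]
  have hl := neg_abs_le (∑ s ∈ Finset.range (N a₀), arm ω a₀ s +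
      ∑ s ∈ Finset.Ico (N a₀) T, arm ω a₀ s - T * m a₀)
  have hu := le_abs_self (∑ s ∈ Finset.range (N a₀), arm ω a₀ s +
      ∑ s ∈ Finset.Ico (N a₀) T, arm ω a₀ s - T * m a₀)
  have hSR : 0 ≤ S * R := by positivity
  constructor <;> nlinarith

end BanditTail

/-! ## The return of an action node -/

theorem hasTail_zero {Ω : Type*} [MeasurableSpace Ω] {μ : Measure Ω} {ξ s c : ℝ} (hs : 0 < s) :
    HasTail μ ξ s c (fun _ => 0) := by
  intro z hz
  have : {ω : Ω | s * z ≤ |(0 : ℝ)|} = ∅ := by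
    ext ω
    simp only [abs_zero, Set.mem_ofPred_eq, Set.mem_empty_iff_false, iff_false, not_le]
    positivity
  change μ {ω : Ω | s * z ≤ |(0 : ℝ)|} ≤ _
  rw [this, measure_empty]
  exact zero_le

/-- A bounded sequence that is i.i.d. from index `S` on. -/
theorem exists_hasTail_sum_eventually_iid (ξ R : ℝ) (S : ℕ) (hξ : 0 ≤ ξ) (hR : 0 < R) :
    ∃ c : ℝ, 0 ≤ c ∧ ∀ {Ω : Type*} [MeasurableSpace Ω] (μ : Measure Ω) [IsProbabilityMeasure μ]
      (Y Y' : ℕ → Ω → ℝ) (m : ℝ), iIndepFun Y μ → (∀ i, Measurable (Y i)) →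
      (∀ i ω, |Y i ω| ≤ R) → (∀ i, ∫ ω, Y i ω ∂μ = m) → (∀ i ω, |Y' i ω| ≤ R) →
      (∀ i ω, S ≤ i → Y' i ω = Y i ω) → ∀ n : ℕ, 1 ≤ n →
      HasTail μ ξ (√n) c (fun ω => ∑ i ∈ Finset.range n, Y' i ω - n * m) := by
  obtain ⟨c, hc0, hc⟩ := exists_hasTail_sum_iid ξ R hξ hR
  -- The two sequences differ at no more than `S` indices, by at most `2R` each; `S + 1` keeps the
  -- bound positive.
  set c₁ : ℝ := max c ((2 * R * (S + 1)) ^ ξ)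
  have hc₁ : 0 ≤ c₁ := hc0.trans (le_max_left _ _)
  refine ⟨2 * (c₁ * 2 ^ ξ), by positivity, ?_⟩
  intro Ω _ μ _ Y Y' m hind hmeas hbd hmean hbd' heq n hn
  have hn1 : 1 ≤ √(n : ℝ) := Real.one_le_sqrt.2 (by exact_mod_cast hn)
  have h1 := (hc μ Y m hind hmeas hbd hmean n hn).mono_const (le_max_left c ((2 * R * (S + 1)) ^ ξ))
  have h2 : HasTail μ ξ (√n) c₁ (fun _ => 2 * R * (S + 1)) :=
    (hasTail_of_abs_le (K := 2 * R * (S + 1)) (by positivity) hn1 hξ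
      (fun _ => (abs_of_pos (by positivity)).le)).mono_const (le_max_right _ _)
  refine (h1.add h2 (by positivity) hc₁).mono_abs fun ω => ?_
  refine le_trans ?_ (le_abs_self _)
  have hdiff : |∑ i ∈ Finset.range n, (Y' i ω - Y i ω)| ≤ 2 * R * (S + 1) := by
    have hle : ∀ i ∈ Finset.range n, |Y' i ω - Y i ω| ≤ if i < S then 2 * R else 0 := by
      intro i _
      split_ifs with h
      · calc |Y' i ω - Y i ω| ≤ |Y' i ω| + |Y i ω| := abs_sub _ _
          _ ≤ 2 * R := by linarith [hbd i ω, hbd' i ω]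
      · rw [heq i ω (not_lt.1 h), sub_self, abs_zero]
    refine (Finset.abs_sum_le_sum_abs _ _).trans ((Finset.sum_le_sum hle).trans ?_)
    rw [← Finset.sum_filter, Finset.sum_const, nsmul_eq_mul, mul_comm]
    have hcard : ((Finset.range n).filter (· < S)).card ≤ S := by
      refine (Finset.card_le_card (t := Finset.range S) fun i hi => ?_).trans
        (Finset.card_range S).le
      simpa using (Finset.mem_filter.1 hi).2
    have : (((Finset.range n).filter (· < S)).card : ℝ) ≤ S + 1 := by
      exact_mod_cast hcard.trans (Nat.le_succ S)
    gcongr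
  rw [Finset.sum_sub_distrib] at hdiff
  rw [abs_of_pos (by positivity : 0 < 2 * R * ((S : ℝ) + 1))]
  calc |∑ i ∈ Finset.range n, Y' i ω - n * m|
      = |(∑ i ∈ Finset.range n, Y i ω - n * m) +
        (∑ i ∈ Finset.range n, Y' i ω - ∑ i ∈ Finset.range n, Y i ω)| := by ring_nf
    _ ≤ _ := (abs_add_le _ _).trans (by gcongr)

open Classical in
/-- The returns of the children, regrouped by child. -/
theorem sum_child_returns (G : ℕ → ℕ → ℝ) (cell : ℕ → ℕ) {m : ℕ} (hcell : ∀ s, cell s < m) (n : ℕ) :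
    ∑ s ∈ Finset.range n, G (cell s)
        ((Finset.range s).filter fun s' => cell s' = cell s).card =
      ∑ j ∈ Finset.range m,
        ∑ i ∈ Finset.range ((Finset.range n).filter fun s' => cell s' = j).card, G j i := by
  induction n with
  | zero => simp
  | succ n ih =>
    rw [Finset.sum_range_succ, ih,
      ← Finset.add_sum_erase _ _ (Finset.mem_range.2 (hcell n)),
      ← Finset.add_sum_erase (a := cell n) (f := fun j =>
        ∑ i ∈ Finset.range ((Finset.range (n + 1)).filter fun s' => cell s' = j).card, G j i) _
        (Finset.mem_range.2 (hcell n))]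
    have h1 : ((Finset.range (n + 1)).filter fun s' => cell s' = cell n).card =
        ((Finset.range n).filter fun s' => cell s' = cell n).card + 1 := by
      rw [Finset.range_add_one, Finset.filter_insert, if_pos rfl, Finset.card_insert_of_notMem]
      simp
    have h2 : ∀ j ∈ (Finset.range m).erase (cell n),
        ((Finset.range (n + 1)).filter fun s' => cell s' = j).card =
        ((Finset.range n).filter fun s' => cell s' = j).card := by
      intro j hj
      rw [Finset.range_add_one, Finset.filter_insert, if_neg (Finset.ne_of_mem_erase hj).symm]
    have h3 : ∑ j ∈ (Finset.range m).erase (cell n), ∑ i ∈ Finset.range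
        ((Finset.range (n + 1)).filter fun s' => cell s' = j).card, G j i =
        ∑ j ∈ (Finset.range m).erase (cell n), ∑ i ∈ Finset.range
        ((Finset.range n).filter fun s' => cell s' = j).card, G j i :=
      Finset.sum_congr rfl fun j hj => by rw [h2 j hj]
    rw [h1, Finset.sum_range_succ, h3]
    ring

/-- Comparison of the returns of the first `N` visits with those of a fixed number of visits. -/
theorem abs_sum_sub_mul_le {G : ℕ → ℝ} {V R p : ℝ} (hR : 0 ≤ R) (hG : ∀ i, |G i| ≤ R) (hV : |V| ≤ R)
    (hp : 0 ≤ p) (N n : ℕ) :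
    |∑ i ∈ Finset.range N, G i - n * (p * V)| ≤
      |∑ i ∈ Finset.range ⌊n * p⌋₊, G i - ⌊n * p⌋₊ * V| + 3 * R * |(N : ℝ) - n * p| + 2 * R := by
  -- The index `k` is deterministic, so a tail bound for the returns applies without any
  -- independence from `N`. Passing from `N` to `k` terms costs `2R` per term, replacing `N V` by `n
  -- p V` costs `R` per unit, and rounding costs `2R`.
  set k := ⌊n * p⌋₊ with hk
  have hsum : ∀ a b : ℕ, a ≤ b → |∑ i ∈ Finset.range b, (G i - V) - ∑ i ∈ Finset.range a, (G i - V)| ≤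
      2 * R * ((b : ℝ) - a) := by
    intro a b hab
    rw [Finset.sum_range_sub_sum_range hab]
    have : ∀ i ∈ (Finset.range b).filter (fun i => a ≤ i), |G i - V| ≤ 2 * R := fun i _ =>
      (abs_sub _ _).trans (by linarith [hG i])
    refine (Finset.abs_sum_le_sum_abs _ _).trans ((Finset.sum_le_card_nsmul _ _ _ this).trans_eq ?_)
    have hc : ((Finset.range b).filter (fun i => a ≤ i)).card = b - a := by
      rw [← Nat.card_Ico]
      congr 1
      ext i
      simp [and_comm]
    rw [hc, nsmul_eq_mul, Nat.cast_sub hab]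
    ring
  have hNk : |∑ i ∈ Finset.range N, (G i - V) - ∑ i ∈ Finset.range k, (G i - V)| ≤
      2 * R * |(N : ℝ) - k| := by
    rcases le_total k N with h | h
    · rw [abs_of_nonneg (a := (N : ℝ) - k) (by simpa using h)]
      exact hsum k N h
    · rw [abs_sub_comm, abs_sub_comm (N : ℝ), abs_of_nonneg (a := (k : ℝ) - N) (by simpa using h)]
      exact hsum N k h
  have hk1 : |(N : ℝ) - k| ≤ |(N : ℝ) - n * p| + 1 := by
    have h1 : (k : ℝ) ≤ n * p := Nat.floor_le (by positivity)
    have h2 : n * p < k + 1 := Nat.lt_floor_add_one _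
    calc |(N : ℝ) - k| = |((N : ℝ) - n * p) + (n * p - k)| := by ring_nf
      _ ≤ |(N : ℝ) - n * p| + |n * p - k| := abs_add_le _ _
      _ ≤ _ := by gcongr; rw [abs_le]; constructor <;> linarith
  have hlast : |((N : ℝ) - n * p) * V| ≤ R * |(N : ℝ) - n * p| := by
    rw [abs_mul, mul_comm]
    gcongr
  simp only [Finset.sum_sub_distrib, Finset.sum_const, Finset.card_range, nsmul_eq_mul] at hNk
  calc |∑ i ∈ Finset.range N, G i - n * (p * V)|
      = |(∑ i ∈ Finset.range k, G i - k * V) + (∑ i ∈ Finset.range N, G i - N * V -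
        (∑ i ∈ Finset.range k, G i - k * V)) + ((N : ℝ) - n * p) * V| := by ring_nf
    _ ≤ |∑ i ∈ Finset.range k, G i - k * V| + |∑ i ∈ Finset.range N, G i - N * V -
        (∑ i ∈ Finset.range k, G i - k * V)| + |((N : ℝ) - n * p) * V| := abs_add_three _ _ _
    _ ≤ |∑ i ∈ Finset.range k, G i - k * V| + 2 * R * (|(N : ℝ) - n * p| + 1) +
        R * |(N : ℝ) - n * p| := by
        refine add_le_add (add_le_add le_rfl (hNk.trans ?_)) hlast
        gcongr
    _ = _ := by ring

open Classical in
/-- The total return of an action node, given tails for the sampled rewards, the visit frequencies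
of the cells, and the returns of the children. -/
theorem exists_hasTail_arm (M : ℕ) (ξ η R c : ℝ) (hξ : 0 ≤ ξ) (hη : 1 / 2 ≤ η) (hR : 0 < R)
    (hc : 0 ≤ c) :
    ∃ c' : ℝ, 0 ≤ c' ∧ ∀ {Ω : Type*} [MeasurableSpace Ω] (μ : Measure Ω) [IsProbabilityMeasure μ]
      (r : ℕ → Ω → ℝ) (cell : ℕ → Ω → ℕ) (G : ℕ → ℕ → Ω → ℝ) (rbar γ : ℝ) (p V : ℕ → ℝ) (m : ℕ),
      m ≤ M → 0 ≤ γ → γ ≤ 1 → (∀ s ω, cell s ω < m) → (∀ j i ω, |G j i ω| ≤ R) →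
      (∀ j, |V j| ≤ R) → (∀ j, 0 ≤ p j) → (∀ j, p j ≤ 1) →
      (∀ n : ℕ, 1 ≤ n → HasTail μ ξ (√n) c (fun ω => ∑ s ∈ Finset.range n, r s ω - n * rbar)) →
      (∀ j < m, ∀ n : ℕ, 1 ≤ n → HasTail μ ξ (√n) c
        (fun ω => ∑ s ∈ Finset.range n, (if cell s ω = j then 1 else 0) - n * p j)) →
      (∀ j < m, ∀ n : ℕ, 1 ≤ n → HasTail μ ξ ((n : ℝ) ^ η) c
        (fun ω => ∑ i ∈ Finset.range n, G j i ω - n * V j)) →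
      ∀ n : ℕ, 1 ≤ n → HasTail μ ξ ((n : ℝ) ^ η) c' (fun ω => ∑ s ∈ Finset.range n,
        (r s ω + γ * G (cell s ω)
          ((Finset.range s).filter fun s' => cell s' ω = cell s ω).card ω) -
        n * (rbar + γ * ∑ j ∈ Finset.range m, p j * V j)) := by
  set c₁ : ℝ := max c (c * (3 * R) ^ ξ)
  have hc₁ : 0 ≤ c₁ := hc.trans (le_max_left _ _)
  set c₂ : ℝ := max (2 * (c₁ * 2 ^ ξ)) ((2 * R) ^ ξ)
  have hc₂ : 0 ≤ c₂ := le_trans (by positivity) (le_max_left _ _)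
  set c₃ : ℝ := max c ((M + 1 : ℝ) * (2 * (c₂ * 2 ^ ξ) * (M + 1 : ℝ) ^ ξ))
  have hc₃ : 0 ≤ c₃ := hc.trans (le_max_left _ _)
  refine ⟨2 * (c₃ * 2 ^ ξ), by positivity, ?_⟩
  intro Ω _ μ _ r cell G rbar γ p V m hmM hγ0 hγ1 hcell hG hV hp0 hp1 hr hN hchild n hn
  have hn1 : (1 : ℝ) ≤ n := by exact_mod_cast hn
  have hs1 : 1 ≤ (n : ℝ) ^ η := Real.one_le_rpow hn1 (by linarith)
  have hs0 : 0 < (n : ℝ) ^ η := by positivity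
  -- Rewards and visit frequencies fluctuate at scale `√n`, which `η ≥ 1/2` absorbs into `n^η`.
  have hsqrt : √(n : ℝ) ≤ (n : ℝ) ^ η := by
    rw [Real.sqrt_eq_rpow]
    exact Real.rpow_le_rpow_of_exponent_le hn1 hη
  have hD : ∀ j < m, HasTail μ ξ ((n : ℝ) ^ η) c₁
      (fun ω => ∑ i ∈ Finset.range ⌊n * p j⌋₊, G j i ω - ⌊n * p j⌋₊ * V j) := by
    intro j hj
    -- Child tails are available only from one visit on; with no visits the sum is empty.
    rcases Nat.eq_zero_or_pos ⌊n * p j⌋₊ with h0 | h0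
    · simp only [h0, Finset.range_zero, Finset.sum_empty, Nat.cast_zero, zero_mul, sub_zero]
      exact hasTail_zero hs0
    · refine ((hchild j hj _ h0).mono_scale ?_).mono_const (le_max_left _ _)
      refine Real.rpow_le_rpow (by positivity) ?_ (by linarith)
      exact (Nat.floor_le (by have := hp0 j; positivity)).trans
        (mul_le_of_le_one_right (by positivity) (hp1 j))
  have hE : ∀ j < m, HasTail μ ξ ((n : ℝ) ^ η) c₁
      (fun ω => 3 * R * (∑ s ∈ Finset.range n, (if cell s ω = j then 1 else 0) - n * p j)) :=
    fun j hj => (((hN j hj n hn).mono_scale hsqrt).const_mul (by positivity)).mono_const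
      (le_max_right _ _)
  have hF : HasTail μ ξ ((n : ℝ) ^ η) c₂ (fun _ => 2 * R) :=
    (hasTail_of_abs_le (by positivity) hs1 hξ
      (fun _ => (abs_of_pos (by positivity)).le)).mono_const (le_max_right _ _)
  -- Three errors per child: its returns at `⌊n p j⌋` visits, `3R` times the deviation of its visit
  -- count, and the rounding.
  have hj := fun j (hj : j < m) =>
    (((hD j hj).add (hE j hj) hs0 hc₁).mono_const (le_max_left _ _)).add hF hs0 hc₂
  have hsum := (HasTail.sum (F := Finset.range m) (K := (M + 1 : ℝ)) (by positivity)
    (by rw [Finset.card_range]; exact_mod_cast hmM.trans (Nat.le_succ M)) hs0 (by positivity)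
    (fun j h => hj j (Finset.mem_range.1 h))).mono_const (le_max_right c _)
  have hrew := ((hr n hn).mono_scale hsqrt).mono_const
    (le_max_left c ((M + 1 : ℝ) * (2 * (c₂ * 2 ^ ξ) * (M + 1 : ℝ) ^ ξ)))
  refine (hrew.add hsum hs0 hc₃).mono_abs fun ω => ?_
  refine le_trans ?_ (le_abs_self _)
  have hregroup := sum_child_returns (fun j i => G j i ω) (fun s => cell s ω) (fun s => hcell s ω) n
  rw [Finset.sum_add_distrib, ← Finset.mul_sum, hregroup]
  have hterm : ∀ j ∈ Finset.range m,
      |∑ i ∈ Finset.range ((Finset.range n).filter fun s' => cell s' ω = j).card, G j i ω -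
        n * (p j * V j)| ≤
      |(|(|∑ i ∈ Finset.range ⌊n * p j⌋₊, G j i ω - ⌊n * p j⌋₊ * V j| +
        |3 * R * (∑ s ∈ Finset.range n, (if cell s ω = j then 1 else 0) - n * p j)|)| +
        |2 * R|)| := by
    intro j _
    refine le_trans (abs_sum_sub_mul_le hR.le (fun i => hG j i ω) (hV j) (hp0 j) _ n) ?_
    refine le_trans (le_of_eq ?_) (le_abs_self _)
    rw [abs_of_nonneg (by positivity : 0 ≤ |∑ i ∈ Finset.range ⌊n * p j⌋₊, G j i ω -
      ⌊n * p j⌋₊ * V j| + |3 * R * (∑ s ∈ Finset.range n, (if cell s ω = j then 1 else 0) -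
        n * p j)|), abs_mul (3 * R), abs_of_pos (by positivity : 0 < 3 * R),
        abs_of_pos (by positivity : 0 < 2 * R), Finset.sum_boole]
  have hge := Finset.sum_le_sum hterm
  rw [abs_of_nonneg (a := ∑ j ∈ Finset.range m, _) (Finset.sum_nonneg fun _ _ => abs_nonneg _)]
  calc _ = |(∑ s ∈ Finset.range n, r s ω - n * rbar) + γ * ∑ j ∈ Finset.range m,
        (∑ i ∈ Finset.range ((Finset.range n).filter fun s' => cell s' ω = j).card, G j i ω -
          n * (p j * V j))| := by
        rw [Finset.sum_sub_distrib, ← Finset.mul_sum]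
        ring_nf
    _ ≤ |∑ s ∈ Finset.range n, r s ω - n * rbar| + γ * |∑ j ∈ Finset.range m,
        (∑ i ∈ Finset.range ((Finset.range n).filter fun s' => cell s' ω = j).card, G j i ω -
          n * (p j * V j))| := by
        refine (abs_add_le _ _).trans ?_
        rw [abs_mul, abs_of_nonneg hγ0]
    _ ≤ |∑ s ∈ Finset.range n, r s ω - n * rbar| + |∑ j ∈ Finset.range m,
        (∑ i ∈ Finset.range ((Finset.range n).filter fun s' => cell s' ω = j).card, G j i ω -
          n * (p j * V j))| := by
        gcongr
        exact mul_le_of_le_one_left (abs_nonneg _) hγ1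
    _ ≤ _ := by
        gcongr
        exact (Finset.abs_sum_le_sum_abs _ _).trans hge

/-! ## Parameters -/

namespace UCBParams.Valid

variable {q : UCBParams} {L : ℕ}

/-- The lower requirement on `α` reads `η⁽ᵈ⁾ ≥ η⁽ᵈ⁺¹⁾`, so `1/2` propagates from the leaf to the
root; the upper one reads `η⁽ᵈ⁾ < 1`. -/
theorem η_mem (hq : q.Valid L) {d : ℕ} (hd : d ≤ L) : 1 / 2 ≤ q.η d ∧ q.η d < 1 := by
  induction hd using Nat.decreasingInduction with
  | self => exact hq.leaf
  | of_succ d hd ih =>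
    have h1 := hq.α_lower d hd
    have h2 := hq.α_upper d hd
    have hη : 0 < 1 - q.η (d + 1) := by linarith [ih.2]
    -- The sign of `ξ` is forced by the two bounds on `α`: together they give `ξ η (1-η) < ξ (1-η)`,
    -- that is `ξ (1-η)² > 0`.
    have hξ : 0 < q.ξ (d + 1) * (1 - q.η (d + 1)) := by
      have : 0 < (q.ξ (d + 1) * (1 - q.η (d + 1))) * (1 - q.η (d + 1)) := by nlinarith
      exact pos_of_mul_pos_left this hη.le
    rw [hq.η_rec d hd]
    refine ⟨?_, (div_lt_one hξ).2 h2⟩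
    rw [le_div_iff₀ hξ]
    nlinarith [ih.1]

theorem ξ_pos (hq : q.Valid L) {d : ℕ} (hd : d < L) : 0 < q.ξ (d + 1) := by
  have h1 := hq.α_lower d hd
  have h2 := hq.α_upper d hd
  obtain ⟨-, h3⟩ := hq.η_mem (d := d + 1) hd
  have hη : 0 < 1 - q.η (d + 1) := by linarith
  have : 0 < q.ξ (d + 1) * ((1 - q.η (d + 1)) * (1 - q.η (d + 1))) := by nlinarith
  exact pos_of_mul_pos_left this (by positivity)

/-- This propagates from the root downwards: `α⁽ᵈ⁺²⁾ = ξ⁽ᵈ⁺¹⁾ + 1`, and `ξ⁽ᵈ⁺¹⁾ > α⁽ᵈ⁺¹⁾` by the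
upper requirement. -/
theorem two_lt_α (hq : q.Valid L) {d : ℕ} (hd : d < L) : 2 < q.α (d + 1) := by
  induction d with
  | zero => exact hq.α_one
  | succ d ih =>
    have h1 := ih (by omega)
    have h2 := hq.α_upper d (by omega)
    have h3 := hq.ξ_rec (d + 1) hd
    obtain ⟨h4, h5⟩ := hq.η_mem (d := d + 1) (by omega)
    have h6 := hq.ξ_pos (d := d) (by omega)
    nlinarith

end UCBParams.Valid

/-! ## Observation laws -/

section ObsLaw

variable {X A Z : Type*} [MeasurableSpace X] [MeasurableSpace Z] (P : POMDP X A Z)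

theorem POMDP.obsKernel_apply (x : X) : P.obsKernel x = P.ref.withDensity (P.like x) := by
  have := P.ref_sigmaFinite
  rw [POMDP.obsKernel, Kernel.withDensity_apply _ P.like_measurable, Kernel.const_apply]

theorem POMDP.isMarkovKernel_obsKernel : IsMarkovKernel P.obsKernel := by
  refine ⟨fun x => ⟨?_⟩⟩
  rw [P.obsKernel_apply, withDensity_apply _ MeasurableSet.univ, setLIntegral_univ, P.like_norm]

/-- Tonelli for the σ-finite reference measure. It identifies the law with density `evidence` with
the observation marginal of a simulation step. -/
theorem POMDP.lintegral_bind_obsKernel (b : ProbabilityMeasure X) (a : A) {s : Set Z}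
    (hs : MeasurableSet s) :
    ∫⁻ x, P.obsKernel x s ∂(P.predict b a : Measure X) = P.obsLaw b a s := by
  have := P.ref_sigmaFinite
  rw [POMDP.obsLaw, withDensity_apply _ hs]
  simp only [P.obsKernel_apply, withDensity_apply _ hs, POMDP.evidence]
  rw [lintegral_lintegral_swap]
  exact P.like_measurable.aemeasurable

theorem POMDP.map_fst_stepLaw (b : ProbabilityMeasure X) (a : A) :
    (P.stepLaw b a).map Prod.fst = b := by
  have := P.trans_markov a
  have := P.isMarkovKernel_obsKernel
  exact Measure.fst_compProd _ _

theorem POMDP.map_snd_stepLaw (b : ProbabilityMeasure X) (a : A) :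
    (P.stepLaw b a).map Prod.snd = P.obsLaw b a := by
  have := P.trans_markov a
  have := P.isMarkovKernel_obsKernel
  change (P.stepLaw b a).snd = _
  rw [POMDP.stepLaw, Measure.snd_compProd]
  ext s hs
  rw [← P.lintegral_bind_obsKernel b a hs, ← Measure.comp_assoc,
    Measure.bind_apply hs (Kernel.aemeasurable _)]
  rfl

instance POMDP.isProbabilityMeasure_obsLaw (b : ProbabilityMeasure X) (a : A) :
    IsProbabilityMeasure (P.obsLaw b a) := by
  have := P.trans_markov a
  have := P.isMarkovKernel_obsKernel
  rw [← P.map_snd_stepLaw]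
  have : IsProbabilityMeasure (P.stepLaw b a) := by
    unfold POMDP.stepLaw
    infer_instance
  exact Measure.isProbabilityMeasure_map measurable_snd.aemeasurable

variable {P} {E : Type*} [MeasurableSpace E] {ρ : Measure E} (G : Generator P ρ)

theorem Generator.measurable_gen_right (b : ProbabilityMeasure X) (a : A) : Measurable (G.gen b a) :=
  (G.measurable_gen a).comp measurable_prodMk_left

theorem Generator.map_snd (b : ProbabilityMeasure X) (a : A) :
    ρ.map (fun e => (G.gen b a e).2) = P.obsLaw b a := by
  rw [← P.map_snd_stepLaw, ← G.map_gen, Measure.map_map measurable_snd (G.measurable_gen_right b a)]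
  rfl

theorem Generator.map_fst (b : ProbabilityMeasure X) (a : A) :
    ρ.map (fun e => (G.gen b a e).1) = b := by
  rw [← P.map_fst_stepLaw b a, ← G.map_gen,
    Measure.map_map measurable_fst (G.measurable_gen_right b a)]
  rfl

theorem Generator.integral_reward (b : ProbabilityMeasure X) (a : A) :
    ∫ e, P.reward (G.gen b a e).1 a ∂ρ = P.beliefReward b a := by
  rw [POMDP.beliefReward, ← G.map_fst b a, integral_map
    (G.measurable_gen_right b a).fst.aemeasurable (P.reward_measurable a).aestronglyMeasurable]

end ObsLaw

/-! ## Resampling a block of seeds -/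

section Mix

variable {ι E : Type*}

open Classical in
/-- The family that agrees with `ω` on `I` and with `ω'` off `I`. -/
def mix (I : Set ι) (ω ω' : ι → E) : ι → E := fun i => if i ∈ I then ω i else ω' i

theorem mix_of_mem {I : Set ι} {i : ι} (h : i ∈ I) (ω ω' : ι → E) : mix I ω ω' i = ω i := by
  simp [mix, h]

theorem mix_of_notMem {I : Set ι} {i : ι} (h : i ∉ I) (ω ω' : ι → E) : mix I ω ω' i = ω' i := by
  simp [mix, h]

variable [MeasurableSpace E]

theorem measurable_mix (I : Set ι) :
    Measurable fun p : (ι → E) × (ι → E) => mix I p.1 p.2 := by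
  refine measurable_pi_lambda _ fun i => ?_
  by_cases h : i ∈ I
  · simp only [mix, h, if_true]
    fun_prop
  · simp only [mix, h, if_false]
    fun_prop

/-- It suffices to test finite boxes, whose preimage is a box in the coordinates of `I` times a box
in the others. -/
theorem map_mix_infinitePi (I : Set ι) (ρ : Measure E) [IsProbabilityMeasure ρ] :
    ((Measure.infinitePi fun _ : ι => ρ).prod (Measure.infinitePi fun _ : ι => ρ)).map
      (fun p => mix I p.1 p.2) = Measure.infinitePi fun _ : ι => ρ := by
  classical
  refine Measure.eq_infinitePi _ fun s t ht => ?_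
  rw [Measure.map_apply (measurable_mix I) (.pi s.countable_toSet fun i _ => ht i)]
  have : (fun p : (ι → E) × (ι → E) => mix I p.1 p.2) ⁻¹' (Set.pi s t) =
      (Set.pi (s.filter (· ∈ I) : Finset ι) t) ×ˢ (Set.pi (s.filter (· ∉ I) : Finset ι) t) := by
    ext ⟨ω, ω'⟩
    simp only [Set.mem_preimage, Set.mem_pi, Finset.mem_coe, Set.mem_prod, Finset.mem_filter, mix]
    constructor
    · intro h
      exact ⟨fun i hi => by simpa [hi.2] using h i hi.1, fun i hi => by simpa [hi.2] using h i hi.1⟩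
    · rintro ⟨h1, h2⟩ i hi
      split_ifs with h
      · exact h1 i ⟨hi, h⟩
      · exact h2 i ⟨hi, h⟩
  rw [this, Measure.prod_prod, Measure.infinitePi_pi _ (fun i _ => ht i),
    Measure.infinitePi_pi _ (fun i _ => ht i), Finset.prod_filter_mul_prod_filter_not]

/-- Fubini for a product of seed laws: a set whose sections over almost every choice of one block of
seeds are small is small. -/
theorem infinitePi_le_of_mix (I : Set ι) (ρ : Measure E) [IsProbabilityMeasure ρ]
    {s : Set (ι → E)} (hs : MeasurableSet s) {c : ℝ≥0∞}
    (h : ∀ᵐ ω ∂(Measure.infinitePi fun _ : ι => ρ),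
      (Measure.infinitePi fun _ : ι => ρ) {ω' | mix I ω ω' ∈ s} ≤ c) :
    (Measure.infinitePi fun _ : ι => ρ) s ≤ c := by
  rw [← map_mix_infinitePi I ρ, Measure.map_apply (measurable_mix I) hs,
    Measure.prod_apply (measurable_mix I hs)]
  exact (lintegral_mono_ae h).trans (by simp)

end Mix

/-! ## Dependence of the tree on the seeds -/

section Seeds

variable {X A Z : Type*} [MeasurableSpace X] [MeasurableSpace Z] {P : POMDP X A Z}
  {E : Type*} [MeasurableSpace E] {ρ : Measure E} {M S : ℕ} (T : Solver P ρ M S)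

/-- The seeds of the cell centers. -/
def centerSeeds (A : Type*) : Set (Seed A) := {i | ∃ h a j, i = .center h a j}

/-- Only centers at strictly smaller depth enter a belief; strictness is what later allows
resampling the centers of `h` itself while its belief stays fixed. -/
theorem Solver.belief_congr {ω ω' : Seed A → E} {h : History A}
    (hω : ∀ h' a j, h'.length < h.length → ω (.center h' a j) = ω' (.center h' a j)) :
    T.belief ω h = T.belief ω' h := by
  induction h with
  | nil => rfl
  | cons p h ih =>
    obtain ⟨a, j⟩ := p
    simp only [Solver.belief]
    rw [ih fun h' a j hlt => hω h' a j (hlt.trans (by simp)), hω h a j (by simp)]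

theorem Solver.belief_mix (ω₀ ω : Seed A → E) (h : History A) :
    T.belief (mix (centerSeeds A) ω₀ ω) h = T.belief ω₀ h :=
  T.belief_congr fun h' a j _ => mix_of_mem (show Seed.center h' a j ∈ centerSeeds A from
    ⟨_, _, _, rfl⟩) _ _

theorem Solver.centerDraw_mix (ω₀ ω : Seed A → E) (h : History A) :
    T.centerDraw (mix (centerSeeds A) ω₀ ω) h = T.centerDraw ω₀ h := by
  funext a j
  simp only [Solver.centerDraw, T.belief_mix, mix_of_mem (show Seed.center h a j ∈ centerSeeds A from
    ⟨_, _, _, rfl⟩)]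

theorem Solver.center_mix (ω₀ ω : Seed A → E) (h : History A) :
    T.center (mix (centerSeeds A) ω₀ ω) h = T.center ω₀ h := by
  funext a j
  simp only [Solver.center, T.centerDraw_mix]

end Seeds

theorem mix_sim {A E : Type*} (ω₀ ω : Seed A → E) (h : History A) (a : A) (s : ℕ) :
    mix (centerSeeds A) ω₀ ω (.sim h a s) = ω (.sim h a s) :=
  mix_of_notMem (by rintro ⟨_, _, _, h⟩; cases h) _ _

/-! ## The nearest-center rule -/

section Nearest

variable {Z : Type*} [PseudoMetricSpace Z]

theorem nearest_spec (c : ℕ → Z) {m : ℕ} (hm : 1 ≤ m) (z : Z) :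
    nearest c m z < m ∧ ∀ i < m, dist z (c (nearest c m z)) ≤ dist z (c i) := by
  have : {j | j < m ∧ ∀ i < m, dist z (c j) ≤ dist z (c i)}.Nonempty := by
    obtain ⟨j, hj, hmin⟩ := Finset.exists_min_image (Finset.range m) (fun j => dist z (c j))
      ⟨0, Finset.mem_range.2 hm⟩
    exact ⟨j, by simpa using hj, fun i hi => hmin i (by simpa using hi)⟩
  exact Nat.sInf_mem this

/-- Characterization of the fibres of the nearest-center rule. -/
theorem nearest_eq_iff (c : ℕ → Z) {m : ℕ} (hm : 1 ≤ m) (z : Z) (j : ℕ) :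
    nearest c m z = j ↔ (j < m ∧ ∀ i < m, dist z (c j) ≤ dist z (c i)) ∧
      ∀ k < j, ¬ (k < m ∧ ∀ i < m, dist z (c k) ≤ dist z (c i)) := by
  constructor
  · rintro rfl
    exact ⟨nearest_spec c hm z, fun k hk => Nat.notMem_of_lt_sInf hk⟩
  · rintro ⟨h1, h2⟩
    refine le_antisymm (Nat.sInf_le h1) ?_
    by_contra hlt
    exact h2 _ (not_le.1 hlt) (nearest_spec c hm z)

/-- Each fibre is a Boolean combination of finitely many comparisons of distances, so measurability
of these distances is enough. -/
theorem measurable_nearest {Y : Type*} [MeasurableSpace Y] {c : Y → ℕ → Z} {z : Y → Z}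
    {m : ℕ} (hm : 1 ≤ m) (hdist : ∀ i, Measurable fun y => dist (z y) (c y i)) :
    Measurable fun y => nearest (c y) m (z y) := by
  refine measurable_to_countable' fun j => ?_
  have : (fun y => nearest (c y) m (z y)) ⁻¹' {j} =
      {y | (j < m ∧ ∀ i < m, dist (z y) (c y j) ≤ dist (z y) (c y i)) ∧
      ∀ k < j, ¬ (k < m ∧ ∀ i < m, dist (z y) (c y k) ≤ dist (z y) (c y i))} := by
    ext y
    exact nearest_eq_iff _ hm _ _
  rw [this]
  have hmeas : ∀ k, Measurable
      fun y => k < m ∧ ∀ i < m, dist (z y) (c y k) ≤ dist (z y) (c y i) := fun k =>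
    measurable_const.and (.forall fun i => .forall fun _ =>
      measurableSet_setOfPred.1 (measurableSet_le (hdist k) (hdist i)))
  exact measurableSet_setOfPred.2 ((hmeas j).and (.forall fun k => .forall fun _ => (hmeas k).not))

end Nearest

/-! ## Bounds on rewards, values and returns -/

section Bounds

variable {X A Z : Type*} [MeasurableSpace X] [MeasurableSpace Z] {P : POMDP X A Z}
  {E : Type*} [MeasurableSpace E] {ρ : Measure E} {M S : ℕ} (T : Solver P ρ M S)

/-- The bound `R / (1 - γ)` on discounted returns. -/
def returnBound (R γ : ℝ) : ℝ := |R| / (1 - γ)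

theorem returnBound_nonneg (R : ℝ) {γ : ℝ} (hγ : γ < 1) : 0 ≤ returnBound R γ :=
  div_nonneg (abs_nonneg R) (by linarith)

/-- The bound is the fixed point of `v ↦ |R| + γ v`, hence is preserved by every backup and serves
all depths at once. -/
theorem returnBound_eq (R : ℝ) {γ : ℝ} (hγ : γ < 1) :
    |R| + γ * returnBound R γ = returnBound R γ := by
  have : 1 - γ ≠ 0 := by linarith
  unfold returnBound
  field_simp
  ring

theorem abs_le_returnBound (R : ℝ) {γ : ℝ} (h0 : 0 ≤ γ) (h1 : γ < 1) : |R| ≤ returnBound R γ := by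
  have := returnBound_eq R h1
  have := mul_nonneg h0 (returnBound_nonneg R h1)
  linarith

theorem abs_add_mul_le_returnBound {R γ r v : ℝ} (h0 : 0 ≤ γ) (h1 : γ < 1) (hr : |r| ≤ |R|)
    (hv : |v| ≤ returnBound R γ) : |r + γ * v| ≤ returnBound R γ := by
  rw [← returnBound_eq R h1]
  refine (abs_add_le _ _).trans ?_
  rw [abs_mul, abs_of_nonneg h0]
  gcongr

theorem mul_sum_pow_le_returnBound (R : ℝ) {γ : ℝ} (h0 : 0 ≤ γ) (h1 : γ < 1) (n : ℕ) :
    R * ∑ i ∈ Finset.range n, γ ^ i ≤ returnBound R γ := by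
  have hs0 : 0 ≤ ∑ i ∈ Finset.range n, γ ^ i := Finset.sum_nonneg fun i _ => pow_nonneg h0 i
  have hs : ∑ i ∈ Finset.range n, γ ^ i ≤ (1 - γ)⁻¹ := by
    rw [← tsum_geometric_of_lt_one h0 h1]
    exact (summable_geometric_of_lt_one h0 h1).sum_le_tsum _ fun i _ => pow_nonneg h0 i
  calc R * ∑ i ∈ Finset.range n, γ ^ i ≤ |R| * ∑ i ∈ Finset.range n, γ ^ i :=
        mul_le_mul_of_nonneg_right (le_abs_self R) hs0
    _ ≤ |R| * (1 - γ)⁻¹ := by gcongr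
    _ = _ := (div_eq_mul_inv _ _).symm

theorem POMDP.abs_beliefReward_le {R : ℝ} (hR : ∀ x a, |P.reward x a| ≤ R)
    (b : ProbabilityMeasure X) (a : A) : |P.beliefReward b a| ≤ |R| := by
  have := norm_integral_le_of_norm_le_const (μ := (b : Measure X)) (f := fun x => P.reward x a)
    (C := |R|) (ae_of_all _ fun x => (hR x a).trans (le_abs_self R))
  simpa [POMDP.beliefReward] using this

theorem abs_ciSup_le {ι : Type*} [Finite ι] [Nonempty ι] {f : ι → ℝ} {B : ℝ} (h : ∀ i, |f i| ≤ B) :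
    |⨆ i, f i| ≤ B := by
  obtain ⟨i, hi⟩ := exists_eq_ciSup_of_finite (f := f)
  rw [← hi]
  exact h i

variable [PseudoMetricSpace Z]

theorem Solver.abs_armReturn_le {R γ : ℝ} (hγ0 : 0 ≤ γ) (hγ1 : γ < 1) (hdisc : P.discount = γ)
    (hR : ∀ x a, |P.reward x a| ≤ R) {ω : Seed A → E} {childRet : History A → ℕ → ℝ}
    (hchild : ∀ h i, |childRet h i| ≤ returnBound R γ) (h : History A) (a : A) (s : ℕ) :
    |T.armReturn ω childRet h a s| ≤ returnBound R γ := by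
  unfold Solver.armReturn
  rw [hdisc]
  exact abs_add_mul_le_returnBound hγ0 hγ1 ((hR _ _).trans (le_abs_self R)) (hchild _ _)

theorem Solver.abs_nodeReturn_le [Fintype A] {R γ : ℝ} {L : ℕ} (hγ0 : 0 ≤ γ) (hγ1 : γ < 1)
    (hdisc : P.discount = γ) (hR : ∀ x a, |P.reward x a| ≤ R)
    (hroll : ∀ h b e, |T.rollout h b e| ≤ R * ∑ i ∈ Finset.range (L - h.length + 1), γ ^ i)
    (ω : Seed A → E) (k : ℕ) (h : History A) (i : ℕ) :
    |T.nodeReturn ω k h i| ≤ returnBound R γ := by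
  induction k generalizing h i with
  | zero =>
    simp only [Solver.nodeReturn]
    exact (hR _ _).trans ((le_abs_self R).trans (abs_le_returnBound R hγ0 hγ1))
  | succ k ih =>
    cases i with
    | zero =>
      simp only [Solver.nodeReturn]
      exact (hroll _ _ _).trans (mul_sum_pow_le_returnBound R hγ0 hγ1 _)
    | succ t =>
      simp only [Solver.nodeReturn]
      exact T.abs_armReturn_le hγ0 hγ1 hdisc hR ih _ _ _

variable [OpensMeasurableSpace Z]

theorem measurableSet_nearest_eq (c : ℕ → Z) {m : ℕ} (hm : 1 ≤ m) (j : ℕ) :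
    MeasurableSet {z | nearest c m z = j} :=
  measurable_nearest (c := fun _ => c) (z := fun z => z) hm
    (fun _ => (continuous_id.dist continuous_const).measurable) (measurableSet_singleton j)

theorem sum_measureReal_nearest (ν : Measure Z) [IsProbabilityMeasure ν] (c : ℕ → Z) {m : ℕ}
    (hm : 1 ≤ m) : ∑ j ∈ Finset.range m, ν.real {z | nearest c m z = j} = 1 := by
  rw [← measureReal_biUnion_finset]
  · have : ⋃ j ∈ Finset.range m, {z | nearest c m z = j} = Set.univ := by
      ext z
      simpa using (nearest_spec c hm z).1
    rw [this]
    simp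
  · intro i _ j _ hij
    refine Set.disjoint_left.2 fun z (hz : nearest c m z = i) (hz' : nearest c m z = j) => hij ?_
    rw [← hz, ← hz']
  · exact fun j _ => measurableSet_nearest_eq c hm j

theorem Solver.abs_backup_le {R γ : ℝ} (hγ0 : 0 ≤ γ) (hγ1 : γ < 1) (hdisc : P.discount = γ)
    (hR : ∀ x a, |P.reward x a| ≤ R) (ω : Seed A → E) {V : History A → ℝ}
    (hV : ∀ h, |V h| ≤ returnBound R γ) (h : History A) (a : A) :
    |T.backup ω V h a| ≤ returnBound R γ := by
  unfold Solver.backup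
  rw [hdisc]
  refine abs_add_mul_le_returnBound hγ0 hγ1 (P.abs_beliefReward_le hR _ _) ?_
  refine (Finset.abs_sum_le_sum_abs _ _).trans ?_
  calc _ ≤ ∑ j ∈ Finset.range (T.W.m h a), (P.obsLaw (T.belief ω h) a).real
        {z | nearest (T.center ω h a) (T.W.m h a) z = j} * returnBound R γ := by
        refine Finset.sum_le_sum fun j _ => ?_
        rw [abs_mul, abs_of_nonneg measureReal_nonneg]
        exact mul_le_mul_of_nonneg_left (hV _) measureReal_nonneg
    _ = _ := by rw [← Finset.sum_mul, sum_measureReal_nearest _ _ (T.W.m_pos h a), one_mul]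

theorem Solver.abs_partValue_le [Fintype A] [Nonempty A] {R γ : ℝ} (hγ0 : 0 ≤ γ) (hγ1 : γ < 1)
    (hdisc : P.discount = γ) (hR : ∀ x a, |P.reward x a| ≤ R) (ω : Seed A → E) (k : ℕ)
    (h : History A) : |T.partValue ω k h| ≤ returnBound R γ := by
  induction k generalizing h with
  | zero =>
    exact abs_ciSup_le fun a => (P.abs_beliefReward_le hR _ _).trans (abs_le_returnBound R hγ0 hγ1)
  | succ k ih => exact abs_ciSup_le fun a => T.abs_backup_le hγ0 hγ1 hdisc hR ω ih h a

end Bounds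

/-! ## Cells and visits -/

section Cells

variable {X A Z : Type*} [MeasurableSpace X] [MeasurableSpace Z] {P : POMDP X A Z}
  {E : Type*} [MeasurableSpace E] {ρ : Measure E} {M S : ℕ} (T : Solver P ρ M S)

theorem Solver.not_creates_of_le {h : History A} {a : A} {s : ℕ} (hs : S ≤ s) :
    ¬ T.Creates h a s := by
  unfold Solver.Creates
  rw [T.W.active_frozen h a s hs, T.W.active_frozen h a (s + 1) (hs.trans (Nat.le_succ s))]
  exact lt_irrefl _

theorem Solver.draw_of_le (ω : Seed A → E) {h : History A} {a : A} {s : ℕ} (hs : S ≤ s) :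
    T.draw ω h a s = T.G.gen (T.belief ω h) a (ω (.sim h a s)) := by
  simp [Solver.draw, T.not_creates_of_le hs]

variable [PseudoMetricSpace Z]

theorem Solver.cell_of_le (ω : Seed A → E) {h : History A} {a : A} {s : ℕ} (hs : S ≤ s) :
    T.cell ω h a s = nearest (T.center ω h a) (T.W.m h a)
      (T.G.gen (T.belief ω h) a (ω (.sim h a s))).2 := by
  simp [Solver.cell, T.not_creates_of_le hs, T.draw_of_le ω hs, T.W.active_frozen h a s hs]

theorem Solver.cell_lt (ω : Seed A → E) (h : History A) (a : A) (s : ℕ) :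
    T.cell ω h a s < T.W.m h a := by
  unfold Solver.cell
  split_ifs with hc
  · exact lt_of_lt_of_le hc (T.W.active_le h a (s + 1))
  -- A visit that finds no cell must create one, so the nearest-center rule is never applied to an
  -- empty set of centers.
  · have h0 : 1 ≤ T.W.active h a s := by
      by_contra hcon
      have h0 : T.W.active h a s = 0 := by omega
      exact hc (by rw [Solver.Creates, h0, T.W.active_zero h a s h0]; exact one_pos)
    exact lt_of_lt_of_le (nearest_spec _ h0 _).1 (T.W.active_le h a s)

end Cells

section Histories

variable {A : Type*} [Fintype A] [DecidableEq A] {M S : ℕ} (W : Widening A M S)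

theorem Widening.mem_histories_succ {d : ℕ} {h : History A} (hh : h ∈ W.histories d) (a : A) {j : ℕ}
    (hj : j < W.m h a) : (a, j) :: h ∈ W.histories (d + 1) := by
  simp only [Widening.histories, Finset.mem_biUnion, Finset.mem_univ, true_and, Finset.mem_image,
    Finset.mem_range]
  exact ⟨h, hh, a, j, hj, rfl⟩

theorem Widening.length_of_mem_histories {d : ℕ} {h : History A} (hh : h ∈ W.histories d) :
    h.length = d := by
  induction d generalizing h with
  | zero =>
    simp only [Widening.histories, Finset.mem_singleton] at hh
    simp [hh]
  | succ d ih =>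
    simp only [Widening.histories, Finset.mem_biUnion, Finset.mem_univ, true_and, Finset.mem_image,
      Finset.mem_range] at hh
    obtain ⟨h', hh', a, j, -, rfl⟩ := hh
    simp [ih hh']

theorem Widening.mem_decisionNodes {L d : ℕ} (hd : d < L) {h : History A}
    (hh : h ∈ W.histories d) : h ∈ W.decisionNodes L :=
  Finset.mem_biUnion.2 ⟨d, Finset.mem_range.2 hd, hh⟩

end Histories

/-! ## Concentration of the returns for fixed cell centers -/

section Concentration

theorem iIndepFun_sim {A E : Type*} [MeasurableSpace E] (ρ : Measure E) [IsProbabilityMeasure ρ]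
    {f : E → ℝ} (hf : Measurable f) (h : History A) (a : A) :
    iIndepFun (fun (s : ℕ) (ω : Seed A → E) => f (ω (.sim h a s)))
      (Measure.infinitePi fun _ : Seed A => ρ) := by
  have := iIndepFun_infinitePi (ι := Seed A) (P := fun _ => ρ) (X := fun _ => f) (fun _ => hf)
  exact this.precomp (g := fun s : ℕ => Seed.sim h a s) fun s t hst => by
    simpa using hst

theorem integral_infinitePi_eval {ι E : Type*} [MeasurableSpace E] (ρ : Measure E)
    [IsProbabilityMeasure ρ] {f : E → ℝ} (hf : Measurable f) (i : ι) :
    ∫ ω, f (ω i) ∂(Measure.infinitePi fun _ : ι => ρ) = ∫ e, f e ∂ρ := by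
  conv_rhs => rw [← Measure.infinitePi_map_eval (fun _ : ι => ρ) i]
  rw [integral_map (measurable_pi_apply i).aemeasurable hf.aestronglyMeasurable]

/-- The tail of the total return of an action node, given the tails of its children. -/
theorem exists_hasTail_armReturn (M S : ℕ) (ξ η R γ c : ℝ) (hξ : 0 ≤ ξ) (hη : 1 / 2 ≤ η)
    (hγ0 : 0 ≤ γ) (hγ1 : γ < 1) (hc : 0 ≤ c) :
    ∃ c' : ℝ, 0 ≤ c' ∧ ∀ {X A Z E : Type*} [MeasurableSpace X] [MeasurableSpace Z]
      [PseudoMetricSpace Z] [OpensMeasurableSpace Z] [Fintype A] [Nonempty A] [MeasurableSpace E]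
      (ρ : Measure E) [IsProbabilityMeasure ρ] (P : POMDP X A Z) (T : Solver P ρ M S) (L k : ℕ)
      (ω₀ : Seed A → E) (h : History A) (a : A), P.discount = γ → (∀ x a, |P.reward x a| ≤ R) →
      (∀ h b e, |T.rollout h b e| ≤ R * ∑ i ∈ Finset.range (L - h.length + 1), γ ^ i) →
      (∀ j < T.W.m h a, ∀ n : ℕ, 1 ≤ n → HasTail T.seedLaw ξ ((n : ℝ) ^ η) c (fun ω =>
        ∑ i ∈ Finset.range n, T.nodeReturn (mix (centerSeeds A) ω₀ ω) k ((a, j) :: h) i -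
          n * T.partValue ω₀ k ((a, j) :: h))) →
      ∀ n : ℕ, 1 ≤ n → HasTail T.seedLaw ξ ((n : ℝ) ^ η) c' (fun ω =>
        ∑ s ∈ Finset.range n, T.armReturn (mix (centerSeeds A) ω₀ ω)
          (T.nodeReturn (mix (centerSeeds A) ω₀ ω) k) h a s -
          n * T.backup ω₀ (T.partValue ω₀ k) h a) := by
  classical
  -- The added 1 makes the bound strictly positive even for zero rewards.
  set R' : ℝ := returnBound R γ + 1 with hR'
  have hB0 := returnBound_nonneg R hγ1
  have hR'0 : 0 < R' := by linarith
  have hBR : returnBound R γ ≤ R' := by linarith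
  obtain ⟨c₀, hc₀, hiid⟩ := exists_hasTail_sum_eventually_iid ξ R' S hξ hR'0
  obtain ⟨c', hc', harm⟩ := exists_hasTail_arm M ξ η R' (max c c₀) hξ hη hR'0
    (hc.trans (le_max_left _ _))
  refine ⟨c', hc', ?_⟩
  intro X A Z E _ _ _ _ _ _ _ ρ _ P T L k ω₀ h a hdisc hR hroll hchild
  have : IsProbabilityMeasure T.seedLaw := by unfold Solver.seedLaw; infer_instance
  have hm := T.W.m_pos h a
  have hrew : ∀ x a, |P.reward x a| ≤ R' := fun x a =>
    ((hR x a).trans (le_abs_self R)).trans ((abs_le_returnBound R hγ0 hγ1).trans hBR)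
  have hgen := T.G.measurable_gen_right (T.belief ω₀ h) a
  -- With the centers frozen, visits from number `S` on use fresh seeds at a fixed belief and are
  -- i.i.d.; earlier visits, among them the creating ones that reuse frozen center draws, are
  -- covered by the eventually i.i.d. estimate.
  have hsimbel : ∀ ω s, S ≤ s → T.draw (mix (centerSeeds A) ω₀ ω) h a s =
      T.G.gen (T.belief ω₀ h) a (ω (.sim h a s)) := fun ω s hs => by
    rw [T.draw_of_le _ hs, T.belief_mix, mix_sim]
  have hr : ∀ n : ℕ, 1 ≤ n → HasTail T.seedLaw ξ (√n) (max c c₀) (fun ω => ∑ s ∈ Finset.range n,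
      P.reward (T.draw (mix (centerSeeds A) ω₀ ω) h a s).1 a -
        n * P.beliefReward (T.belief ω₀ h) a) := by
    have hf : Measurable fun e => P.reward (T.G.gen (T.belief ω₀ h) a e).1 a :=
      (P.reward_measurable a).comp hgen.fst
    intro n hn
    refine (hiid T.seedLaw (fun s ω => P.reward (T.G.gen (T.belief ω₀ h) a (ω (.sim h a s))).1 a)
      _ _ (iIndepFun_sim ρ hf h a) (fun s => hf.comp (measurable_pi_apply _))
      (fun _ _ => hrew _ _) (fun s => ?_) (fun _ _ => hrew _ _) (fun s ω hs => ?_) n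
      hn).mono_const (le_max_right _ _)
    · rw [← T.G.integral_reward]
      exact integral_infinitePi_eval ρ hf _
    · rw [hsimbel ω s hs]
  have hN : ∀ j < T.W.m h a, ∀ n : ℕ, 1 ≤ n → HasTail T.seedLaw ξ (√n) (max c c₀)
      (fun ω => ∑ s ∈ Finset.range n,
        (if T.cell (mix (centerSeeds A) ω₀ ω) h a s = j then (1 : ℝ) else 0) -
        n * (P.obsLaw (T.belief ω₀ h) a).real
          {z | nearest (T.center ω₀ h a) (T.W.m h a) z = j}) := by
    intro j _ n hn
    have hset := measurableSet_nearest_eq (T.center ω₀ h a) hm j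
    set F : E → ℝ := fun e =>
      if nearest (T.center ω₀ h a) (T.W.m h a) (T.G.gen (T.belief ω₀ h) a e).2 = j then 1 else 0
      with hF
    have hf : Measurable F := Measurable.ite (hgen.snd hset) measurable_const measurable_const
    have hone : ∀ p : Prop, ∀ [Decidable p], |(if p then (1 : ℝ) else 0)| ≤ R' := fun p _ => by
      split_ifs
      · rw [abs_one]; linarith
      · rw [abs_zero]; exact hR'0.le
    refine (hiid T.seedLaw (fun s ω => F (ω (.sim h a s))) _ _ (iIndepFun_sim ρ hf h a)
      (fun s => hf.comp (measurable_pi_apply _)) (fun _ _ => hone _) (fun s => ?_)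
      (fun _ _ => hone _) (fun s ω hs => ?_) n hn).mono_const (le_max_right _ _)
    · refine (integral_infinitePi_eval ρ hf _).trans ?_
      rw [← T.G.map_snd, map_measureReal_apply hgen.snd hset]
      have : F = Set.indicator ((fun e => (T.G.gen (T.belief ω₀ h) a e).2) ⁻¹'
          {z | nearest (T.center ω₀ h a) (T.W.m h a) z = j}) 1 := by
        funext e
        simp [hF, Set.indicator_apply]
      rw [this, integral_indicator_one (hgen.snd hset)]
    · simp only [hF]
      rw [T.cell_of_le _ hs, T.belief_mix, T.center_mix, mix_sim]
  have key := harm T.seedLaw (fun s ω => P.reward (T.draw (mix (centerSeeds A) ω₀ ω) h a s).1 a)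
    (fun s ω => T.cell (mix (centerSeeds A) ω₀ ω) h a s)
    (fun j i ω => T.nodeReturn (mix (centerSeeds A) ω₀ ω) k ((a, j) :: h) i)
    (P.beliefReward (T.belief ω₀ h) a) γ _ (fun j => T.partValue ω₀ k ((a, j) :: h))
    (T.W.m h a) (T.W.m_le h a) hγ0 hγ1.le (fun s ω => T.cell_lt _ h a s)
    (fun j i ω => (T.abs_nodeReturn_le hγ0 hγ1 hdisc hR hroll _ _ _ _).trans hBR)
    (fun j => (T.abs_partValue_le hγ0 hγ1 hdisc hR _ _ _).trans hBR)
    (fun j => measureReal_nonneg) (fun j => measureReal_le_one) hr hN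
    (fun j hj n hn => (hchild j hj n hn).mono_const (le_max_left _ _))
  intro n hn
  simpa only [Solver.armReturn, Solver.backup, hdisc] using key n hn

/-- The tail of the total return of a node when the cell centers are fixed and the gaps of the
partitioned problem are at least `Δ`. -/
theorem exists_hasTail_nodeReturn (K M S L : ℕ) (R γ Δ : ℝ) (q : UCBParams)
    (hL : 1 ≤ L) (hγ0 : 0 ≤ γ) (hγ1 : γ < 1) (hq : q.Valid L) (hΔ : 0 < Δ) (k : ℕ) (hk : k ≤ L) :
    ∃ c : ℝ, 0 ≤ c ∧ ∀ {X A Z E : Type*} [MeasurableSpace X] [MeasurableSpace Z]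
      [PseudoMetricSpace Z] [OpensMeasurableSpace Z] [Fintype A] [DecidableEq A] [Nonempty A]
      [MeasurableSpace E]
      (ρ : Measure E) [IsProbabilityMeasure ρ] (P : POMDP X A Z) (T : Solver P ρ M S)
      (ω₀ : Seed A → E), Fintype.card A ≤ K → P.discount = γ → T.L = L → T.q = q →
      (∀ x a, |P.reward x a| ≤ R) →
      (∀ h b e, |T.rollout h b e| ≤ R * ∑ i ∈ Finset.range (L - h.length + 1), γ ^ i) →
      Δ ≤ T.minGap ω₀ → ∀ h ∈ T.W.histories (L - k), ∀ n : ℕ, 1 ≤ n →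
      HasTail T.seedLaw (q.ξ (L - k)) ((n : ℝ) ^ q.η (L - k)) c (fun ω =>
        ∑ i ∈ Finset.range n, T.nodeReturn (mix (centerSeeds A) ω₀ ω) k h i -
          n * T.partValue ω₀ k h) := by
  set R' : ℝ := returnBound R γ + 1 with hR'
  have hB0 := returnBound_nonneg R hγ1
  have hR'0 : 0 < R' := by linarith
  have hBR : returnBound R γ ≤ R' := by linarith
  induction k with
  | zero =>
    rw [Nat.sub_zero]
    have hξ : 0 < q.ξ L := by
      have := hq.ξ_pos (d := L - 1) (by omega)
      rwa [Nat.sub_add_cancel hL] at this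
    obtain ⟨c, hc, hiid⟩ := exists_hasTail_sum_iid (q.ξ L) R' hξ.le hR'0
    refine ⟨c, hc, ?_⟩
    intro X A Z E _ _ _ _ _ _ _ _ ρ _ P T ω₀ _ _ _ _ hR _ _ h _ n hn
    have : IsProbabilityMeasure T.seedLaw := by unfold Solver.seedLaw; infer_instance
    set b := T.belief ω₀ h with hb
    set a := T.tie (argmax (P.beliefReward b)) with ha
    have hf : Measurable fun e => P.reward (T.G.gen b a e).1 a :=
      (P.reward_measurable a).comp (T.G.measurable_gen_right b a).fst
    have hV : T.partValue ω₀ 0 h = P.beliefReward b a := by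
      simp only [Solver.partValue, ← hb]
      exact le_antisymm (ciSup_le fun a' => apply_tie_argmax T.tie_mem _ a')
        (le_ciSup (Set.finite_range (P.beliefReward b)).bddAbove a)
    have key := hiid T.seedLaw (fun i ω => P.reward (T.G.gen b a (ω (.sim h a i))).1 a)
      (P.beliefReward b a) (iIndepFun_sim ρ hf h a) (fun s => hf.comp (measurable_pi_apply _))
      (fun _ _ => ((hR _ _).trans (le_abs_self R)).trans
        ((abs_le_returnBound R hγ0 hγ1).trans hBR))
      (fun i => (integral_infinitePi_eval ρ hf _).trans (T.G.integral_reward b a)) n hn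
    have hn1 : (1 : ℝ) ≤ n := by exact_mod_cast hn
    refine HasTail.mono_scale ?_ (s := √n) ?_
    · rw [hV]
      simpa only [Solver.nodeReturn, T.belief_mix, mix_sim] using key
    · rw [Real.sqrt_eq_rpow]
      exact Real.rpow_le_rpow_of_exponent_le hn1 hq.leaf.1
  | succ k ih =>
    obtain ⟨c, hc, hchild⟩ := ih (by omega)
    set d := L - (k + 1) with hd
    have hdL : d < L := by omega
    have hd1 : L - k = d + 1 := by omega
    rw [hd1] at hchild
    have hξ := hq.ξ_pos hdL
    have hα := hq.two_lt_α hdL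
    have hη := hq.η_mem (d := d + 1) hdL
    have hβ := hq.β_gt (d + 1) (by omega) hdL
    obtain ⟨c₁, hc₁, harm⟩ := exists_hasTail_armReturn M S (q.ξ (d + 1)) (q.η (d + 1)) R γ c hξ.le
      hη.1 hγ0 hγ1 hc
    obtain ⟨c₂, hc₂, hucb⟩ := exists_hasTail_ucb K q (d + 1) R' Δ c₁ (by linarith) hα hξ
      (by linarith [hη.1]) hη.2 hc₁ (hq.α_lower d hdL) (hq.α_upper d hdL) hΔ hR'0
    -- The tail exponent and scale produced by the bandit are by definition the parameters of depth
    -- `d`, so the induction closes.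
    rw [← hq.ξ_rec d hdL, ← hq.η_rec d hdL] at hucb
    set c₃ : ℝ := max c₂ ((2 * R') ^ q.ξ d)
    have hc₃ : 0 ≤ c₃ := hc₂.trans (le_max_left _ _)
    refine ⟨2 * (c₃ * 2 ^ q.ξ d), by positivity, ?_⟩
    intro X A Z E _ _ _ _ _ _ _ _ ρ _ P T ω₀ hK hdisc hTL hTq hR hroll hgap h hh n hn
    have : IsProbabilityMeasure T.seedLaw := by unfold Solver.seedLaw; infer_instance
    have hlen := T.W.length_of_mem_histories hh
    have hQ : T.partQ ω₀ h = T.backup ω₀ (T.partValue ω₀ k) h := by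
      funext a
      rw [Solver.partQ, hTL, hlen, show L - d - 1 = k by omega]
    set a₀ := T.tie (argmax (T.partQ ω₀ h)) with ha₀
    have hbdd : ∀ f : A → ℝ, BddAbove (Set.range f) := fun f => (Set.finite_range f).bddAbove
    have hV : T.partValue ω₀ (k + 1) h = T.backup ω₀ (T.partValue ω₀ k) h a₀ := by
      simp only [Solver.partValue]
      rw [← hQ]
      exact le_antisymm (ciSup_le fun a' => apply_tie_argmax T.tie_mem _ a') (le_ciSup (hbdd _) a₀)
    have hgap' : ∀ a ≠ a₀, Δ ≤ T.backup ω₀ (T.partValue ω₀ k) h a₀ -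
        T.backup ω₀ (T.partValue ω₀ k) h a := by
      intro a ha
      have h1 : T.minGap ω₀ ≤ ⨅ a : {a // a ≠ a₀}, ((⨆ a', T.partQ ω₀ h a') - T.partQ ω₀ h a.1) :=
        ciInf_le (f := fun h : {h // h ∈ T.W.decisionNodes T.L} =>
          ⨅ a : {a // a ≠ T.tie (argmax (T.partQ ω₀ h.1))},
            ((⨆ a', T.partQ ω₀ h.1 a') - T.partQ ω₀ h.1 a.1)) (Set.finite_range _).bddBelow
          ⟨h, T.W.mem_decisionNodes (hTL ▸ hdL) hh⟩
      have h2 := ciInf_le (f := fun a : {a // a ≠ a₀} =>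
        ((⨆ a', T.partQ ω₀ h a') - T.partQ ω₀ h a.1)) (Set.finite_range _).bddBelow ⟨a, ha⟩
      have h3 := hgap.trans (h1.trans h2)
      rw [← hV]
      simpa only [hQ, Solver.partValue] using h3
    set arm : (Seed A → E) → A → ℕ → ℝ := fun ω => T.armReturn (mix (centerSeeds A) ω₀ ω)
      (T.nodeReturn (mix (centerSeeds A) ω₀ ω) k) h with harmdef
    have hnode := fun k h i ω => T.abs_nodeReturn_le hγ0 hγ1 hdisc hR hroll ω k h i
    have htail : ∀ a (n : ℕ), 1 ≤ n → HasTail T.seedLaw (q.ξ (d + 1)) ((n : ℝ) ^ q.η (d + 1)) c₁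
        (fun ω => ∑ s ∈ Finset.range n, arm ω a s - n * T.backup ω₀ (T.partValue ω₀ k) h a) :=
      fun a n hn => harm ρ P T L k ω₀ h a hdisc hR hroll (fun j hj =>
        hchild ρ P T ω₀ hK hdisc hTL hTq hR hroll hgap ((a, j) :: h)
          (T.W.mem_histories_succ hh a hj)) n hn
    have hn1 : (1 : ℝ) ≤ n := by exact_mod_cast hn
    have hη0 : 0 ≤ q.η d := by linarith [(hq.η_mem hdL.le).1]
    have hs1 : 1 ≤ (n : ℝ) ^ q.η d := Real.one_le_rpow hn1 hη0
    have hξd : 0 ≤ q.ξ d := by rw [hq.ξ_rec d hdL]; linarith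
    -- The first visit returns a rollout, so `n` visits are `n - 1` bandit selections plus one
    -- bounded term.
    obtain ⟨N, rfl⟩ : ∃ N, n = N + 1 := ⟨n - 1, by omega⟩
    have hf1 : HasTail T.seedLaw (q.ξ d) (((N + 1 : ℕ) : ℝ) ^ q.η d) c₃ (fun ω =>
        ∑ t ∈ Finset.range N, arm ω (choice (ucbSelect q T.tie (d + 1)) (arm ω) t)
            (counts (ucbSelect q T.tie (d + 1)) (arm ω) t
              (choice (ucbSelect q T.tie (d + 1)) (arm ω) t)) -
          N * T.backup ω₀ (T.partValue ω₀ k) h a₀) := by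
      rcases Nat.eq_zero_or_pos N with rfl | hN
      · simpa using hasTail_zero (by positivity)
      · refine ((hucb T.seedLaw T.tie T.tie_mem N a₀ arm _ hK hN hgap' (fun ω a s =>
          (T.abs_armReturn_le hγ0 hγ1 hdisc hR (fun h i => hnode k h i _) _ _ _).trans hBR)
          (fun a => (T.abs_backup_le hγ0 hγ1 hdisc hR ω₀
            (T.abs_partValue_le hγ0 hγ1 hdisc hR ω₀ k) h a).trans hBR)
          htail).mono_scale ?_).mono_const (le_max_left _ _)
        exact Real.rpow_le_rpow (by positivity) (by push_cast; linarith) hη0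
    have hf2 : HasTail T.seedLaw (q.ξ d) (((N + 1 : ℕ) : ℝ) ^ q.η d) c₃ (fun ω =>
        T.nodeReturn (mix (centerSeeds A) ω₀ ω) (k + 1) h 0 - T.partValue ω₀ (k + 1) h) := by
      refine (hasTail_of_abs_le (K := 2 * R') (by positivity) hs1 hξd
        fun ω => ?_).mono_const (le_max_right _ _)
      refine (abs_sub _ _).trans ?_
      have h1 := hnode (k + 1) h 0 (mix (centerSeeds A) ω₀ ω)
      have h2 := T.abs_partValue_le hγ0 hγ1 hdisc hR ω₀ (k + 1) h
      linarith
    refine (hf1.add hf2 (by positivity) hc₃).mono_abs fun ω => ?_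
    refine le_trans ?_ (le_abs_self _)
    refine le_trans (le_of_eq ?_) (abs_add_le _ _)
    congr 1
    rw [Finset.sum_range_succ', hV]
    have : ∀ t, T.nodeReturn (mix (centerSeeds A) ω₀ ω) (k + 1) h (t + 1) =
        arm ω (choice (ucbSelect q T.tie (d + 1)) (arm ω) t)
            (counts (ucbSelect q T.tie (d + 1)) (arm ω) t
              (choice (ucbSelect q T.tie (d + 1)) (arm ω) t)) := fun t => by
      simp only [Solver.nodeReturn, hTq, hlen, harmdef]
    simp only [this]
    push_cast
    ring

end Concentration

/-! ## Measurability of the belief dynamics -/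

section BeliefMeasurability

variable {X A Z : Type*} [MeasurableSpace X] [MeasurableSpace Z] (P : POMDP X A Z)

theorem POMDP.measurable_predict (a : A) : Measurable fun b => P.predict b a :=
  Measurable.subtype_mk
    ((Measure.measurable_bind' (P.trans a).measurable).comp measurable_subtype_coe)

/-- The propagated belief as a kernel. -/
def POMDP.predictKernel (a : A) : Kernel (ProbabilityMeasure X) X :=
  ⟨fun b => (P.predict b a : Measure X), measurable_subtype_coe.comp (P.measurable_predict a)⟩

instance POMDP.isMarkovKernel_predictKernel (a : A) : IsMarkovKernel (P.predictKernel a) :=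
  ⟨fun b => inferInstanceAs (IsProbabilityMeasure (P.predict b a : Measure X))⟩

/-- The belief itself as a kernel. -/
def beliefKernel (X : Type*) [MeasurableSpace X] : Kernel (ProbabilityMeasure X) X :=
  ⟨fun b => (b : Measure X), measurable_subtype_coe⟩

instance : IsMarkovKernel (beliefKernel X) :=
  ⟨fun b => inferInstanceAs (IsProbabilityMeasure (b : Measure X))⟩

/-- Treating the belief as the parameter of a kernel turns joint measurability in belief and
observation into measurability of a kernel integral. -/
theorem POMDP.measurable_setLIntegral_like (a : A) {s : Set X} (hs : MeasurableSet s) :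
    Measurable fun p : ProbabilityMeasure X × Z =>
      ∫⁻ x in s, P.like x p.2 ∂(P.predict p.1 a : Measure X) := by
  set κ : Kernel (ProbabilityMeasure X × Z) X := (P.predictKernel a).comap Prod.fst measurable_fst
  have h : Measurable fun p : ProbabilityMeasure X × Z =>
      ∫⁻ x, s.indicator (fun x => P.like x p.2) x ∂(κ p) := by
    refine Measurable.lintegral_kernel_prod_right
      (f := fun (p : ProbabilityMeasure X × Z) x => s.indicator (fun x => P.like x p.2) x) ?_
    have : Function.uncurry (fun (p : ProbabilityMeasure X × Z) x =>
        s.indicator (fun x => P.like x p.2) x) =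
        (Prod.snd ⁻¹' s).indicator fun q => Function.uncurry P.like (q.2, q.1.2) := by
      funext q
      rfl
    rw [this]
    exact (P.like_measurable.comp (by fun_prop)).indicator (measurable_snd hs)
  simp only [lintegral_indicator hs] at h
  exact h

theorem POMDP.measurable_evidence (a : A) :
    Measurable fun p : ProbabilityMeasure X × Z => P.evidence p.1 a p.2 := by
  simpa [POMDP.evidence] using P.measurable_setLIntegral_like a MeasurableSet.univ

theorem POMDP.measurableSet_admissible (a : A) :
    MeasurableSet {p : ProbabilityMeasure X × Z | P.Admissible p.1 a p.2} :=
  (P.measurable_evidence a (measurableSet_singleton 0)).compl.inter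
    (P.measurable_evidence a (measurableSet_singleton ∞)).compl

theorem POMDP.coe_update (b : ProbabilityMeasure X) (a : A) (z : Z) (h : P.Admissible b a z)
    (s : Set X) (hs : MeasurableSet s) : (P.update b a z : Measure X) s =
      (P.evidence b a z)⁻¹ * ∫⁻ x in s, P.like x z ∂(P.predict b a : Measure X) := by
  have h1 : (P.update b a z : Measure X) =
      (P.evidence b a z)⁻¹ • (P.predict b a : Measure X).withDensity (fun x => P.like x z) :=
    congrArg Subtype.val (dif_pos h)
  rw [h1, Measure.smul_apply, smul_eq_mul, withDensity_apply _ hs]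

theorem POMDP.measurable_update (a : A) :
    Measurable fun p : ProbabilityMeasure X × Z => P.update p.1 a p.2 := by
  classical
  refine Measurable.subtype_mk (f := fun p : ProbabilityMeasure X × Z =>
    (P.update p.1 a p.2 : Measure X)) (h := fun p => (P.update p.1 a p.2).2) ?_
  refine Measure.measurable_of_measurable_coe _ fun s hs => ?_
  have : (fun p : ProbabilityMeasure X × Z => (P.update p.1 a p.2 : Measure X) s) = fun p =>
      if P.Admissible p.1 a p.2 then (P.evidence p.1 a p.2)⁻¹ *
        ∫⁻ x in s, P.like x p.2 ∂(P.predict p.1 a : Measure X)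
      else (P.predict p.1 a : Measure X) s := by
    funext p
    split_ifs with h
    · exact P.coe_update _ _ _ h s hs
    · exact congrArg (fun b : ProbabilityMeasure X => (b : Measure X) s) (dif_neg h)
  rw [this]
  refine Measurable.ite (P.measurableSet_admissible a)
    ((P.measurable_evidence a).inv.mul (P.measurable_setLIntegral_like a hs)) ?_
  exact (Measure.measurable_coe hs).comp
    ((measurable_subtype_coe.comp (P.measurable_predict a)).comp measurable_fst)

/-- The observation law as a kernel. -/
def POMDP.obsLawKernel (a : A) : Kernel (ProbabilityMeasure X) Z :=
  haveI := P.ref_sigmaFinite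
  Kernel.withDensity (Kernel.const _ P.ref) fun b z => P.evidence b a z

theorem POMDP.obsLawKernel_apply (a : A) (b : ProbabilityMeasure X) :
    P.obsLawKernel a b = P.obsLaw b a := by
  have := P.ref_sigmaFinite
  rw [POMDP.obsLawKernel, Kernel.withDensity_apply _ (P.measurable_evidence a), Kernel.const_apply]
  rfl

instance POMDP.isMarkovKernel_obsLawKernel (a : A) : IsMarkovKernel (P.obsLawKernel a) :=
  ⟨fun b => by rw [P.obsLawKernel_apply]; infer_instance⟩

theorem POMDP.measurable_beliefReward (a : A) : Measurable fun b => P.beliefReward b a := by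
  have := StronglyMeasurable.integral_kernel_prod_right (κ := beliefKernel X)
    (f := fun _ x => P.reward x a)
    ((P.reward_measurable a).comp measurable_snd).stronglyMeasurable
  exact this.measurable

end BeliefMeasurability

/-! ## Maps into countable types -/

section Discrete

variable {Ω : Type*} [MeasurableSpace Ω] {β β' : Type*}

/-- Measurability of a map into a countable type, for its discrete σ-algebra. -/
def MeasurableFibers (g : Ω → β) : Prop := ∀ y, MeasurableSet {ω | g ω = y}

theorem Measurable.measurableFibers [MeasurableSpace β] [MeasurableSingletonClass β] {g : Ω → β}
    (hg : Measurable g) : MeasurableFibers g := fun y => hg (measurableSet_singleton y)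

theorem measurableFibers_const (y : β) : MeasurableFibers fun _ : Ω => y := fun _ => .const _

/-- Splitting over the countably many values of `g` handles random indices such as chosen actions,
visit counts and cells. -/
theorem MeasurableFibers.bind [Countable β] {g : Ω → β} (hg : MeasurableFibers g)
    {F : β → Ω → β'} (hF : ∀ x, MeasurableFibers (F x)) :
    MeasurableFibers fun ω => F (g ω) ω := by
  intro y
  have : {ω | F (g ω) ω = y} = ⋃ x, {ω | g ω = x} ∩ {ω | F x ω = y} := by
    ext ω
    simp
  rw [this]
  exact .iUnion fun x => (hg x).inter (hF x y)

theorem MeasurableFibers.eval [Countable β] [MeasurableSpace β'] {g : Ω → β}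
    (hg : MeasurableFibers g) {F : β → Ω → β'} (hF : ∀ x, Measurable (F x)) :
    Measurable fun ω => F (g ω) ω := by
  intro t ht
  have : (fun ω => F (g ω) ω) ⁻¹' t = ⋃ x, {ω | g ω = x} ∩ F x ⁻¹' t := by
    ext ω
    simp
  rw [this]
  exact .iUnion fun x => (hg x).inter (hF x ht)

theorem MeasurableFibers.comp [Countable β] {g : Ω → β} (hg : MeasurableFibers g) (G : β → β') :
    MeasurableFibers fun ω => G (g ω) :=
  hg.bind fun x => measurableFibers_const (G x)

theorem MeasurableFibers.pi {ι : Type*} [Countable ι] {g : Ω → ι → β}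
    (hg : ∀ i, MeasurableFibers fun ω => g ω i) : MeasurableFibers g := by
  intro y
  have : {ω | g ω = y} = ⋂ i, {ω | g ω i = y i} := by
    ext ω
    simp [funext_iff]
  rw [this]
  exact .iInter fun i => hg i (y i)

variable {A : Type*} [Fintype A]

theorem measurableFibers_argmax {f : Ω → A → ℝ} (hf : ∀ a, Measurable fun ω => f ω a) :
    MeasurableFibers fun ω => argmax (f ω) := by
  intro s
  have : {ω | argmax (f ω) = s} = {ω | ∀ a, (∀ a', f ω a' ≤ f ω a) ↔ a ∈ s} := by
    ext ω
    simp [Finset.ext_iff, mem_argmax]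
  rw [this]
  exact measurableSet_setOfPred.2 (.forall fun a => .iff (.forall fun a' =>
    measurableSet_setOfPred.1 (measurableSet_le (hf a') (hf a))) measurable_const)

theorem measurableFibers_ucbSelect (q : UCBParams) (tie : Finset A → A) (d : ℕ) {cnt : Ω → A → ℕ}
    {mean : Ω → A → ℝ} (hcnt : MeasurableFibers cnt) (hmean : ∀ a, Measurable fun ω => mean ω a) :
    MeasurableFibers fun ω => ucbSelect q tie d (cnt ω) (mean ω) := by
  refine hcnt.bind (F := fun c ω => ucbSelect q tie d c (mean ω)) fun c => ?_
  unfold ucbSelect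
  split_ifs with h
  · exact measurableFibers_const _
  · refine (measurableFibers_argmax fun a => ?_).comp tie
    exact (hmean a).add measurable_const

theorem measurable_empMean {arm : Ω → A → ℕ → ℝ} (harm : ∀ a s, Measurable fun ω => arm ω a s)
    {cnt : Ω → A → ℕ} (hcnt : MeasurableFibers cnt) (a : A) :
    Measurable fun ω => empMean (arm ω) (cnt ω) a :=
  hcnt.eval (F := fun c ω => empMean (arm ω) c a) fun _ =>
    (Finset.measurable_sum _ fun s _ => harm a s).div_const _

theorem measurableFibers_counts (q : UCBParams) (tie : Finset A → A) (d : ℕ) {arm : Ω → A → ℕ → ℝ}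
    (harm : ∀ a s, Measurable fun ω => arm ω a s) (t : ℕ) :
    MeasurableFibers fun ω => counts (ucbSelect q tie d) (arm ω) t := by
  induction t with
  | zero => exact measurableFibers_const _
  | succ t ih =>
    classical
    refine .pi fun a => ?_
    simp only [counts]
    exact ih.bind (F := fun c ω => c a + if a = ucbSelect q tie d (counts _ (arm ω) t)
      (empMean (arm ω) (counts _ (arm ω) t)) then 1 else 0) fun c =>
      (measurableFibers_ucbSelect q tie d ih (measurable_empMean harm ih)).comp
        fun a' => c a + if a = a' then 1 else 0

theorem measurableFibers_choice (q : UCBParams) (tie : Finset A → A) (d : ℕ) {arm : Ω → A → ℕ → ℝ}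
    (harm : ∀ a s, Measurable fun ω => arm ω a s) (t : ℕ) :
    MeasurableFibers fun ω => choice (ucbSelect q tie d) (arm ω) t :=
  measurableFibers_ucbSelect q tie d (measurableFibers_counts q tie d harm t)
    (measurable_empMean harm (measurableFibers_counts q tie d harm t))

end Discrete

/-! ## Measurability of the solver in the seeds -/

section SolverMeasurability

variable {X A Z : Type*} [MeasurableSpace X] [MeasurableSpace Z] {P : POMDP X A Z}
  {E : Type*} [MeasurableSpace E] {ρ : Measure E} {M S : ℕ} (T : Solver P ρ M S)

theorem Solver.measurable_belief (h : History A) : Measurable fun ω => T.belief ω h := by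
  induction h with
  | nil => exact measurable_const
  | cons p h ih =>
    obtain ⟨a, j⟩ := p
    simp only [Solver.belief]
    have hgen : Measurable fun ω : Seed A → E => T.G.gen (T.belief ω h) a (ω (.center h a j)) :=
      (T.G.measurable_gen a).comp (ih.prodMk (measurable_pi_apply _))
    have hpair := ih.prodMk hgen.snd
    have := (P.measurable_update a).comp hpair
    simpa only [Function.comp_def] using this

theorem Solver.measurable_gen_seed (h : History A) (a : A) (i : Seed A) :
    Measurable fun ω : Seed A → E => T.G.gen (T.belief ω h) a (ω i) :=
  (T.G.measurable_gen a).comp ((T.measurable_belief h).prodMk (measurable_pi_apply i))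

theorem Solver.measurable_center (h : History A) (a : A) (j : ℕ) :
    Measurable fun ω => T.center ω h a j :=
  (T.measurable_gen_seed h a _).snd

theorem Solver.measurable_draw (h : History A) (a : A) (s : ℕ) :
    Measurable fun ω => T.draw ω h a s := by
  unfold Solver.draw
  split_ifs
  · exact T.measurable_gen_seed h a _
  · exact T.measurable_gen_seed h a _

variable [PseudoMetricSpace Z] [OpensMeasurableSpace Z] [SecondCountableTopology Z]

theorem Solver.measurable_cell (h : History A) (a : A) (s : ℕ) :
    Measurable fun ω => T.cell ω h a s := by
  unfold Solver.cell
  split_ifs with hc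
  · exact measurable_const
  · have h0 : 1 ≤ T.W.active h a s := by
      by_contra hcon
      have h0 : T.W.active h a s = 0 := by omega
      exact hc (by rw [Solver.Creates, h0, T.W.active_zero h a s h0]; exact one_pos)
    -- Observation and center are both random; second countability makes their distance measurable.
    exact measurable_nearest h0 fun i => (T.measurable_draw h a s).snd.dist (T.measurable_center h a i)

theorem Solver.measurable_armReturn {childRet : (Seed A → E) → History A → ℕ → ℝ}
    (hchild : ∀ h i, Measurable fun ω => childRet ω h i) (h : History A) (a : A) (s : ℕ) :
    Measurable fun ω => T.armReturn ω (childRet ω) h a s := by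
  classical
  unfold Solver.armReturn
  refine ((P.reward_measurable a).comp (T.measurable_draw h a s).fst).add (.const_mul ?_ _)
  have hcard : Measurable fun ω =>
      ((Finset.range s).filter fun s' => T.cell ω h a s' = T.cell ω h a s).card := by
    simp only [Finset.card_filter]
    exact Finset.measurable_sum _ fun s' _ => Measurable.ite
      (measurableSet_eq_fun (T.measurable_cell h a s') (T.measurable_cell h a s))
      measurable_const measurable_const
  have h1 := MeasurableFibers.eval (Measurable.measurableFibers
    ((T.measurable_cell h a s).prodMk hcard))
    (F := fun x ω => childRet ω ((a, x.1) :: h) x.2) fun x => hchild _ _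
  convert h1

theorem Solver.measurable_nodeReturn [Fintype A] (k : ℕ) (h : History A) (i : ℕ) :
    Measurable fun ω => T.nodeReturn ω k h i := by
  induction k generalizing h i with
  | zero =>
    simp only [Solver.nodeReturn]
    exact ((measurableFibers_argmax fun a =>
      (P.measurable_beliefReward a).comp (T.measurable_belief h)).comp T.tie).eval
      (F := fun a ω => P.reward (T.G.gen (T.belief ω h) a (ω (.sim h a i))).1 a) fun a =>
      (P.reward_measurable a).comp (T.measurable_gen_seed h a _).fst
  | succ k ih =>
    cases i with
    | zero =>
      simp only [Solver.nodeReturn]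
      exact (T.measurable_rollout h).comp ((T.measurable_belief h).prodMk (measurable_pi_apply _))
    | succ t =>
      simp only [Solver.nodeReturn]
      have harm := T.measurable_armReturn ih h
      refine (measurableFibers_choice T.q T.tie (h.length + 1) harm t).eval (F := fun a ω =>
        T.armReturn ω (T.nodeReturn ω k) h a (counts (ucbSelect T.q T.tie (h.length + 1))
          (T.armReturn ω (T.nodeReturn ω k) h) t a)) fun a => ?_
      exact (measurableFibers_counts T.q T.tie (h.length + 1) harm t).eval (F := fun c ω =>
        T.armReturn ω (T.nodeReturn ω k) h a (c a)) fun c => harm a (c a)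

theorem Solver.measurable_estimate [Fintype A] (n : ℕ) : Measurable fun ω => T.estimate ω n :=
  (Finset.measurable_sum _ fun i _ => T.measurable_nodeReturn T.L [] i).div_const _

theorem Solver.measurable_backup {V : (Seed A → E) → History A → ℝ}
    (hV : ∀ h, Measurable fun ω => V ω h) (h : History A) (a : A) :
    Measurable fun ω => T.backup ω (V ω) h a := by
  unfold Solver.backup
  refine ((P.measurable_beliefReward a).comp (T.measurable_belief h)).add (.const_mul ?_ _)
  refine Finset.measurable_sum _ fun j _ => Measurable.mul ?_ (hV _)
  refine Measurable.ennreal_toReal ?_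
  -- Both the observation law and the cell vary with `ω`, so the mass is a kernel evaluated on the
  -- sections of a measurable set in the product.
  have hset : MeasurableSet {p : (Seed A → E) × Z |
      nearest (T.center p.1 h a) (T.W.m h a) p.2 = j} :=
    measurable_nearest (c := fun p : (Seed A → E) × Z => T.center p.1 h a) (z := Prod.snd)
      (T.W.m_pos h a) (fun i => measurable_snd.dist ((T.measurable_center h a i).comp measurable_fst))
      (measurableSet_singleton j)
  have := Kernel.measurable_kernel_prodMk_left
    (κ := (P.obsLawKernel a).comap _ (T.measurable_belief h)) hset
  simp only [Kernel.comap_apply, P.obsLawKernel_apply] at this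
  exact this

theorem Solver.measurable_partValue [Fintype A] (k : ℕ) (h : History A) :
    Measurable fun ω => T.partValue ω k h := by
  induction k generalizing h with
  | zero =>
    exact Measurable.iSup fun a => (P.measurable_beliefReward a).comp (T.measurable_belief h)
  | succ k ih => exact Measurable.iSup fun a => T.measurable_backup ih h a

theorem Solver.measurable_minGap [Fintype A] [DecidableEq A] : Measurable fun ω => T.minGap ω := by
  unfold Solver.minGap
  refine Measurable.iInf fun h => ?_
  have hQ : ∀ a, Measurable fun ω => T.partQ ω h.1 a := fun a =>
    T.measurable_backup (T.measurable_partValue _) h.1 a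
  -- The index set of the inner infimum depends on the maximizer, which is therefore fixed first.
  exact ((measurableFibers_argmax hQ).comp T.tie).eval (F := fun a₀ ω =>
    ⨅ a : {a // a ≠ a₀}, ((⨆ a', T.partQ ω h.1 a') - T.partQ ω h.1 a.1)) fun a₀ =>
    Measurable.iInf fun a => (Measurable.iSup hQ).sub (hQ a.1)

end SolverMeasurability

/-! ## The estimation error -/

section PartitionedMix

variable {X A Z : Type*} [MeasurableSpace X] [MeasurableSpace Z] {P : POMDP X A Z}
  {E : Type*} [MeasurableSpace E] {ρ : Measure E} {M S : ℕ} (T : Solver P ρ M S)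
  [PseudoMetricSpace Z]

theorem Solver.backup_mix (ω₀ ω : Seed A → E) (V : History A → ℝ) (h : History A) :
    T.backup (mix (centerSeeds A) ω₀ ω) V h = T.backup ω₀ V h := by
  funext a
  simp only [Solver.backup, T.belief_mix, T.center_mix]

theorem Solver.partValue_mix [Fintype A] (ω₀ ω : Seed A → E) (k : ℕ) :
    T.partValue (mix (centerSeeds A) ω₀ ω) k = T.partValue ω₀ k := by
  induction k with
  | zero => funext h; simp only [Solver.partValue, T.belief_mix]
  | succ k ih => funext h; simp only [Solver.partValue, ih, T.backup_mix]

theorem Solver.minGap_mix [Fintype A] [DecidableEq A] (ω₀ ω : Seed A → E) :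
    T.minGap (mix (centerSeeds A) ω₀ ω) = T.minGap ω₀ := by
  have : T.partQ (mix (centerSeeds A) ω₀ ω) = T.partQ ω₀ := by
    funext h a
    simp only [Solver.partQ, T.partValue_mix, T.backup_mix]
  unfold Solver.minGap
  rw [this]

end PartitionedMix

/-- The root estimate converges to the value of the partitioned problem at a polynomial rate. -/
theorem exists_estimate_rate (K M S L : ℕ) (R γ : ℝ) (q : UCBParams)
    (hL : 1 ≤ L) (hγ0 : 0 ≤ γ) (hγ1 : γ < 1) (hq : q.Valid L) :
    ∃ β₀ : ℝ → ℝ, (∀ Δ, 1 < β₀ Δ) ∧ ∀ {X A Z E : Type*} [MeasurableSpace X] [MeasurableSpace Z]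
      [PseudoMetricSpace Z] [OpensMeasurableSpace Z] [SecondCountableTopology Z] [Fintype A]
      [DecidableEq A] [Nonempty A] [MeasurableSpace E]
      (ρ : Measure E) [IsProbabilityMeasure ρ] (P : POMDP X A Z) (T : Solver P ρ M S),
      Fintype.card A ≤ K → P.discount = γ → T.L = L → T.q = q →
      (∀ x a, |P.reward x a| ≤ R) →
      (∀ h b e, |T.rollout h b e| ≤ R * ∑ i ∈ Finset.range (L - h.length + 1), γ ^ i) →
      ∀ n : ℕ, 1 ≤ n → ∀ δ : ℝ, 0 < δ →
      T.seedLaw {ω | 0 < T.minGap ω ∧ ¬ |T.estimate ω n - T.partValue ω L []| ≤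
        (n : ℝ) ^ (-(1 - q.η 0)) * (2 * β₀ (T.minGap ω) / δ) ^ (1 / q.ξ 0)} ≤ ENNReal.ofReal δ := by
  -- One constant per gap level `1/(N+1)`; a gap `Δ` uses the level `N = ⌈1/Δ⌉₊`, for which `1/(N+1)
  -- ≤ Δ`. Factoring through `ℕ` makes `β₀` measurable, as Fubini requires of the event.
  choose g hg0 hg using fun N : ℕ => exists_hasTail_nodeReturn K M S L R γ (1 / ((N : ℝ) + 1)) q hL
    hγ0 hγ1 hq (by positivity) L le_rfl
  refine ⟨fun Δ => max 2 (g ⌈1 / Δ⌉₊), fun Δ => lt_of_lt_of_le one_lt_two (le_max_left _ _), ?_⟩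
  intro X A Z E _ _ _ _ _ _ _ _ _ ρ _ P T hK hdisc hTL hTq hR hroll n hn δ hδ
  set β₀ : ℝ → ℝ := fun Δ => max 2 (g ⌈1 / Δ⌉₊) with hβ₀
  have hβmeas : Measurable β₀ :=
    measurable_const.max ((measurable_from_nat (f := g)).comp
      (Nat.measurable_ceil.comp (measurable_const.div measurable_id)))
  have hξ : 0 < q.ξ 0 := by
    have := hq.ξ_rec 0 hL
    have := hq.α_one
    simp only [zero_add] at *
    linarith
  have hnR : (0 : ℝ) < n := by exact_mod_cast hn
  -- Once the center seeds are fixed, the gap and the partitioned value are constants and only the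
  -- simulation and rollout seeds remain random.
  refine infinitePi_le_of_mix (centerSeeds A) ρ ?_ (ae_of_all _ fun ω₀ => ?_)
  · refine measurableSet_setOfPred.2 (.and ?_ (.not ?_))
    · exact measurableSet_setOfPred.1 (measurableSet_lt measurable_const T.measurable_minGap)
    · refine measurableSet_setOfPred.1 (measurableSet_le
        (((T.measurable_estimate n).sub (T.measurable_partValue L [])).abs) ?_)
      exact (((hβmeas.comp T.measurable_minGap).const_mul 2).div_const δ |>.pow_const _).const_mul _
  · simp only [Set.mem_ofPred_eq, T.minGap_mix, T.partValue_mix]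
    by_cases hgap : 0 < T.minGap ω₀
    swap
    · simp [hgap]
    set Δ := T.minGap ω₀ with hΔ
    have hΔle : 1 / ((⌈1 / Δ⌉₊ : ℝ) + 1) ≤ Δ := by
      rw [div_le_iff₀ (by positivity)]
      have h1 : 1 / Δ ≤ ⌈1 / Δ⌉₊ := Nat.le_ceil _
      rw [div_le_iff₀ hgap] at h1
      nlinarith
    have htail := (hg ⌈1 / Δ⌉₊ ρ P T ω₀ hK hdisc hTL hTq hR hroll hΔle [] (by
      simp [Widening.histories]) n hn).mono_const (le_max_right 2 _)
    rw [Nat.sub_self] at htail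
    change HasTail _ _ _ (β₀ Δ) _ at htail
    have hβpos : 0 < β₀ Δ := lt_of_lt_of_le two_pos (le_max_left _ _)
    -- Chosen so that `β₀ z ^ (-ξ) = δ / 2`.
    set z : ℝ := (2 * β₀ Δ / δ) ^ (1 / q.ξ 0) with hz
    have hz0 : 0 < z := by positivity
    refine (measure_mono ?_).trans ((htail z hz0).trans (ENNReal.ofReal_le_ofReal ?_))
    · rintro ω ⟨-, hω⟩
      rw [not_le] at hω
      rw [Set.mem_ofPred_eq]
      beta_reduce
      have hest : T.estimate (mix (centerSeeds A) ω₀ ω) n * n =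
          ∑ i ∈ Finset.range n, T.nodeReturn (mix (centerSeeds A) ω₀ ω) L [] i := by
        rw [Solver.estimate, hTL, div_mul_cancel₀ _ hnR.ne']
      rw [← hest, show T.estimate (mix (centerSeeds A) ω₀ ω) n * n - n * T.partValue ω₀ L [] =
        n * (T.estimate (mix (centerSeeds A) ω₀ ω) n - T.partValue ω₀ L []) by ring, abs_mul,
        abs_of_pos hnR]
      have : (n : ℝ) ^ q.η 0 = n * (n : ℝ) ^ (-(1 - q.η 0)) := by
        conv_rhs => rw [← Real.rpow_one_add' hnR.le (by
          have := (hq.η_mem (Nat.zero_le L)).1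
          linarith)]
        ring_nf
      rw [this, mul_assoc]
      exact mul_le_mul_of_nonneg_left hω.le hnR.le
    · rw [hz, ← Real.rpow_mul (by positivity), show 1 / q.ξ 0 * -q.ξ 0 = -1 by field_simp,
        Real.rpow_neg_one, inv_div]
      have : β₀ Δ * (δ / (2 * β₀ Δ)) = δ / 2 := by field_simp
      rw [this]
      linarith

/-! ## The Bellman equation -/

section Bellman

variable {X A Z : Type*} [MeasurableSpace X] [MeasurableSpace Z] (P : POMDP X A Z)

/-- One Bellman backup in the belief space. -/
def POMDP.bellmanQ (V : ProbabilityMeasure X → ℝ) (b : ProbabilityMeasure X) (a : A) : ℝ :=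
  P.beliefReward b a + P.discount * ∫ z, V (P.update b a z) ∂(P.obsLaw b a)

/-- The values computed by dynamic programming. -/
def POMDP.dpValue : ℕ → ProbabilityMeasure X → ℝ
  | 0, b => ⨆ a, P.beliefReward b a
  | k + 1, b => ⨆ a, P.bellmanQ (POMDP.dpValue k) b a

theorem POMDP.measurable_bellmanQ {V : ProbabilityMeasure X → ℝ} (hV : Measurable V) (a : A) :
    Measurable fun b => P.bellmanQ V b a := by
  have h := StronglyMeasurable.integral_kernel_prod_right (κ := P.obsLawKernel a)
    (f := fun b z => V (P.update b a z))
    (hV.comp (P.measurable_update a)).stronglyMeasurable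
  have h' := h.measurable
  simp only [P.obsLawKernel_apply] at h'
  exact (P.measurable_beliefReward a).add (h'.const_mul _)

theorem POMDP.integrable_comp_update {V : ProbabilityMeasure X → ℝ} (hV : Measurable V) {B : ℝ}
    (hB : ∀ b, |V b| ≤ B) (b : ProbabilityMeasure X) (a : A) :
    Integrable (fun z => V (P.update b a z)) (P.obsLaw b a) :=
  Integrable.of_bound (hV.comp ((P.measurable_update a).comp
    measurable_prodMk_left)).aestronglyMeasurable B (ae_of_all _ fun _ => hB _)

variable {P} {R γ : ℝ}

theorem POMDP.abs_bellmanQ_le (hγ0 : 0 ≤ γ) (hγ1 : γ < 1) (hdisc : P.discount = γ)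
    (hR : ∀ x a, |P.reward x a| ≤ R) {V : ProbabilityMeasure X → ℝ}
    (hV : ∀ b, |V b| ≤ returnBound R γ) (b : ProbabilityMeasure X) (a : A) :
    |P.bellmanQ V b a| ≤ returnBound R γ := by
  unfold POMDP.bellmanQ
  rw [hdisc]
  refine abs_add_mul_le_returnBound hγ0 hγ1 (P.abs_beliefReward_le hR _ _) ?_
  have := norm_integral_le_of_norm_le_const (μ := P.obsLaw b a)
    (f := fun z => V (P.update b a z)) (ae_of_all _ fun z => hV (P.update b a z))
  simpa using this

theorem POMDP.bellmanQ_mono (hγ0 : 0 ≤ γ) (hdisc : P.discount = γ)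
    {V V' : ProbabilityMeasure X → ℝ} (hVm : Measurable V) (hVm' : Measurable V') {B : ℝ}
    (hV : ∀ b, |V b| ≤ B) (hV' : ∀ b, |V' b| ≤ B) (hle : ∀ b, V b ≤ V' b)
    (b : ProbabilityMeasure X) (a : A) : P.bellmanQ V b a ≤ P.bellmanQ V' b a := by
  unfold POMDP.bellmanQ
  gcongr
  · rw [hdisc]; exact hγ0
  · exact P.integrable_comp_update hVm hV b a
  · exact P.integrable_comp_update hVm' hV' b a
  · exact fun _ => hle _

theorem POMDP.measurable_value [Finite A] (π : POMDP.Policy X A) (k : ℕ) :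
    Measurable (P.value π k) := by
  induction k with
  | zero =>
    exact MeasurableFibers.eval (g := π.act 0) (π.measurable_act 0)
      (F := fun a b => P.beliefReward b a) P.measurable_beliefReward
  | succ k ih =>
    exact MeasurableFibers.eval (g := π.act (k + 1)) (π.measurable_act (k + 1))
      (F := fun a b => P.bellmanQ (P.value π k) b a) (P.measurable_bellmanQ ih)

theorem POMDP.abs_value_le (hγ0 : 0 ≤ γ) (hγ1 : γ < 1) (hdisc : P.discount = γ)
    (hR : ∀ x a, |P.reward x a| ≤ R) (π : POMDP.Policy X A) (k : ℕ) (b : ProbabilityMeasure X) :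
    |P.value π k b| ≤ returnBound R γ := by
  induction k generalizing b with
  | zero => exact (P.abs_beliefReward_le hR _ _).trans (abs_le_returnBound R hγ0 hγ1)
  | succ k ih => exact POMDP.abs_bellmanQ_le hγ0 hγ1 hdisc hR ih b _

/-- The action values that a greedy policy maximizes. -/
def POMDP.greedyIndex (P : POMDP X A Z) : ℕ → ProbabilityMeasure X → A → ℝ
  | 0 => P.beliefReward
  | k + 1 => P.bellmanQ (P.dpValue k)

theorem POMDP.dpValue_eq_iSup (k : ℕ) (b : ProbabilityMeasure X) :
    P.dpValue k b = ⨆ a, P.greedyIndex k b a := by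
  cases k <;> rfl

variable [Fintype A]

theorem POMDP.measurable_dpValue (k : ℕ) : Measurable (P.dpValue k) := by
  induction k with
  | zero => exact Measurable.iSup P.measurable_beliefReward
  | succ k ih => exact Measurable.iSup fun a => P.measurable_bellmanQ ih a

variable [Nonempty A]

theorem POMDP.abs_dpValue_le (hγ0 : 0 ≤ γ) (hγ1 : γ < 1) (hdisc : P.discount = γ)
    (hR : ∀ x a, |P.reward x a| ≤ R) (k : ℕ) (b : ProbabilityMeasure X) :
    |P.dpValue k b| ≤ returnBound R γ := by
  induction k generalizing b with
  | zero =>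
    exact abs_ciSup_le fun a => (P.abs_beliefReward_le hR _ _).trans (abs_le_returnBound R hγ0 hγ1)
  | succ k ih => exact abs_ciSup_le fun a => POMDP.abs_bellmanQ_le hγ0 hγ1 hdisc hR ih b a

theorem POMDP.value_le_dpValue (hγ0 : 0 ≤ γ) (hγ1 : γ < 1) (hdisc : P.discount = γ)
    (hR : ∀ x a, |P.reward x a| ≤ R) (π : POMDP.Policy X A) (k : ℕ) (b : ProbabilityMeasure X) :
    P.value π k b ≤ P.dpValue k b := by
  have hbdd : ∀ f : A → ℝ, BddAbove (Set.range f) := fun f => (Set.finite_range f).bddAbove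
  induction k generalizing b with
  | zero => exact le_ciSup (hbdd (P.beliefReward b)) (π.act 0 b)
  | succ k ih =>
    exact (POMDP.bellmanQ_mono hγ0 hdisc (POMDP.measurable_value π k) (POMDP.measurable_dpValue k)
      (POMDP.abs_value_le hγ0 hγ1 hdisc hR π k) (POMDP.abs_dpValue_le hγ0 hγ1 hdisc hR k) ih b
      _).trans (le_ciSup (hbdd (P.bellmanQ (P.dpValue k) b)) (π.act (k + 1) b))

/-- The greedy policy. -/
def POMDP.greedyPolicy (P : POMDP X A Z) (tie : Finset A → A) : POMDP.Policy X A where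
  act k b := tie (argmax (P.greedyIndex k b))
  -- The set of maximizers takes finitely many values on measurable fibres, so any selector applied
  -- to it is measurable.
  measurable_act k := (measurableFibers_argmax fun a => by
    cases k with
    | zero => exact P.measurable_beliefReward a
    | succ k => exact P.measurable_bellmanQ (POMDP.measurable_dpValue k) a).comp tie

theorem POMDP.value_greedyPolicy {tie : Finset A → A}
    (htie : ∀ s : Finset A, s.Nonempty → tie s ∈ s) (k : ℕ) (b : ProbabilityMeasure X) :
    P.value (P.greedyPolicy tie) k b = P.dpValue k b := by
  have hmax : ∀ k b, P.greedyIndex k b (tie (argmax (P.greedyIndex k b))) = P.dpValue k b :=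
    fun k b => by
    rw [POMDP.dpValue_eq_iSup]
    exact le_antisymm (le_ciSup (Set.finite_range (P.greedyIndex k b)).bddAbove _)
      (ciSup_le fun a => apply_tie_argmax htie _ a)
  induction k generalizing b with
  | zero => exact hmax 0 b
  | succ k ih =>
    have hfun : P.value (P.greedyPolicy tie) k = P.dpValue k := funext ih
    rw [← hmax (k + 1) b]
    simp only [POMDP.value, hfun]
    rfl

/-- The optimal value solves the dynamic programming recursion. -/
theorem POMDP.optValue_eq_dpValue (hγ0 : 0 ≤ γ) (hγ1 : γ < 1) (hdisc : P.discount = γ)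
    (hR : ∀ x a, |P.reward x a| ≤ R) {tie : Finset A → A}
    (htie : ∀ s : Finset A, s.Nonempty → tie s ∈ s) (k : ℕ) :
    P.optValue k = P.dpValue k := by
  funext b
  have : Nonempty (POMDP.Policy X A) := ⟨P.greedyPolicy tie⟩
  have hle := fun π => POMDP.value_le_dpValue hγ0 hγ1 hdisc hR π k b
  refine le_antisymm (ciSup_le hle) ?_
  rw [← POMDP.value_greedyPolicy htie]
  -- Boundedness over policies is essential here, since an unbounded real supremum defaults to 0.
  exact le_ciSup (f := fun π => P.value π k b) ⟨P.dpValue k b, by rintro _ ⟨π, rfl⟩; exact hle π⟩ _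

end Bellman

/-! ## Admissibility of the generated observations -/

section Admissible

variable {X A Z : Type*} [MeasurableSpace X] [MeasurableSpace Z] (P : POMDP X A Z)

/-- The normalizer integrates to 1, so it is finite almost everywhere; and a density vanishes only
on a null set of the measure it defines. -/
theorem POMDP.ae_admissible (b : ProbabilityMeasure X) (a : A) :
    ∀ᵐ z ∂(P.obsLaw b a), P.Admissible b a z := by
  have hmeas : Measurable (P.evidence b a) :=
    Measurable.of_uncurry_left (f := fun b z => P.evidence b a z) (P.measurable_evidence a)
  have hint : ∫⁻ z, P.evidence b a z ∂P.ref = 1 := by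
    have : P.obsLaw b a Set.univ = 1 := measure_univ
    rwa [POMDP.obsLaw, withDensity_apply _ MeasurableSet.univ, setLIntegral_univ] at this
  have h1 : ∀ᵐ z ∂P.ref, P.evidence b a z < ∞ := ae_lt_top hmeas (by rw [hint]; exact ENNReal.one_ne_top)
  have h2 : ∀ᵐ z ∂(P.obsLaw b a), P.evidence b a z < ∞ :=
    (withDensity_absolutelyContinuous P.ref (P.evidence b a)).ae_le h1
  have h3 : ∀ᵐ z ∂(P.obsLaw b a), P.evidence b a z ≠ 0 := by
    unfold POMDP.obsLaw
    rw [ae_withDensity_iff hmeas]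
    exact ae_of_all _ fun z hz => hz
  filter_upwards [h2, h3] with z hz hz'
  exact ⟨hz', hz.ne⟩

/-- The seeds of the cell centers above depth `d`. -/
def ancestorSeeds (A : Type*) (d : ℕ) : Set (Seed A) :=
  {i | ∃ h a j, h.length < d ∧ i = .center h a j}

variable {P} {E : Type*} [MeasurableSpace E] {ρ : Measure E} {M S : ℕ} (T : Solver P ρ M S)

/-- Ancestor seeds determine the belief at `h`, while its centers use seeds outside that block. This
is the conditional independence of the centers given the belief. -/
theorem Solver.center_mix_ancestorSeeds (ω ω' : Seed A → E) (h : History A) (a : A) (j : ℕ) :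
    T.belief (mix (ancestorSeeds A h.length) ω ω') h = T.belief ω h ∧
    T.center (mix (ancestorSeeds A h.length) ω ω') h a j =
      (T.G.gen (T.belief ω h) a (ω' (.center h a j))).2 := by
  have h1 : T.belief (mix (ancestorSeeds A h.length) ω ω') h = T.belief ω h :=
    T.belief_congr fun h' a j hlt => mix_of_mem (show Seed.center h' a j ∈ ancestorSeeds A h.length
      from ⟨_, _, _, hlt, rfl⟩) _ _
  refine ⟨h1, ?_⟩
  simp only [Solver.center, Solver.centerDraw, h1]
  rw [mix_of_notMem]
  rintro ⟨h', a', j', hlt, heq⟩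
  cases heq
  exact lt_irrefl _ hlt

variable [IsProbabilityMeasure ρ]

theorem Solver.ae_admissible_center (h : History A) (a : A) (j : ℕ) :
    ∀ᵐ ω ∂T.seedLaw, P.Admissible (T.belief ω h) a (T.center ω h a j) := by
  rw [ae_iff, ← nonpos_iff_eq_zero]
  refine infinitePi_le_of_mix (ancestorSeeds A h.length) ρ ?_ (ae_of_all _ fun ω => ?_)
  · exact (((T.measurable_belief h).prodMk (T.measurable_center h a j))
      (P.measurableSet_admissible a)).compl
  · simp only [Set.mem_ofPred_eq, (T.center_mix_ancestorSeeds ω _ h a j).1,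
      (T.center_mix_ancestorSeeds ω _ h a j).2]
    rw [nonpos_iff_eq_zero]
    have hP := P.ae_admissible (T.belief ω h) a
    rw [← T.G.map_snd] at hP
    have h2 := ae_of_ae_map (T.G.measurable_gen_right (T.belief ω h) a).snd.aemeasurable hP
    exact (measurePreserving_eval_infinitePi (fun _ : Seed A => ρ)
      (.center h a j)).quasiMeasurePreserving.ae h2

/-- There are countably many nodes, so almost surely all centers are admissible together; closure of
`B` under admissible updates then gives membership by induction along the history. -/
theorem Solver.ae_belief_mem [Countable A] {B : Set (ProbabilityMeasure X)}
    (hB : IsBeliefSpace P B) : ∀ᵐ ω ∂T.seedLaw,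
      (∀ h, T.belief ω h ∈ B) ∧ ∀ h a j, P.Admissible (T.belief ω h) a (T.center ω h a j) := by
  have hall : ∀ᵐ ω ∂T.seedLaw, ∀ h a j, P.Admissible (T.belief ω h) a (T.center ω h a j) := by
    simp only [ae_all_iff]
    exact T.ae_admissible_center
  filter_upwards [hall] with ω hω
  refine ⟨fun h => ?_, hω⟩
  induction h with
  | nil => exact hB.1
  | cons p h ih => exact hB.update _ ih p.1 _ (hω h p.1 p.2)

end Admissible

/-! ## The fill distance of the cell centers -/

section Cover

variable {Z : Type*} [PseudoMetricSpace Z] {Ccov kZ : ℝ}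

theorem CoveringBound.exists_cover (h : CoveringBound Z Ccov kZ) {r : ℝ} (hr : 0 < r) (hr1 : r ≤ 1) :
    ∃ N : Finset Z, (N.card : ℝ≥0∞) ≤ ENNReal.ofReal (Ccov * r ^ (-kZ)) ∧
      ∀ z, ∃ y ∈ N, dist z y ≤ r := by
  lift r to ℝ≥0 using hr.le
  have hb := h r (by exact_mod_cast hr) (by exact_mod_cast hr1)
  have hne : Metric.coveringNumber r (Set.univ : Set Z) ≠ ⊤ := by
    intro htop
    rw [htop] at hb
    simp at hb
  refine ⟨(Metric.finite_minimalCover (ε := r) (A := (Set.univ : Set Z))).toFinset, ?_, fun z => ?_⟩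
  · refine le_trans (le_of_eq ?_) hb
    rw [← Metric.encard_minimalCover hne,
      Metric.finite_minimalCover.encard_eq_coe_toFinset_card]
    simp
  · obtain ⟨y, hy, hd⟩ := Metric.isCover_minimalCover hne (Set.mem_univ z)
    refine ⟨y, by simpa using hy, ?_⟩
    have hd' : edist z y ≤ r := hd
    rw [edist_nndist] at hd'
    have : nndist z y ≤ r := by exact_mod_cast hd'
    exact_mod_cast this

theorem CoveringBound.secondCountableTopology (h : CoveringBound Z Ccov kZ) :
    SecondCountableTopology Z := by
  refine Metric.secondCountable_of_almost_dense_set fun ε hε => ?_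
  obtain ⟨N, -, hN⟩ := h.exists_cover (r := min ε 1) (by positivity) (min_le_right _ _)
  refine ⟨N, N.countable_toSet, fun z => ?_⟩
  obtain ⟨y, hy, hd⟩ := hN z
  exact ⟨y, hy, hd.trans (min_le_left _ _)⟩

end Cover

/-! ### Random centers as a net of the observation space -/

section Fill

variable {X A Z : Type*} [MeasurableSpace X] [MeasurableSpace Z] {P : POMDP X A Z}
  {E : Type*} [MeasurableSpace E] {ρ : Measure E} [IsProbabilityMeasure ρ] {M S : ℕ}
  (T : Solver P ρ M S)

/-- The probability that no center of a node falls into a set of large mass. -/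
theorem Solver.seedLaw_center_notMem_le {U : Set Z} (hU : MeasurableSet U) (h : History A)
    (a : A) (m : ℕ) {t : ℝ}
    (hmass : ∀ᵐ ω ∂T.seedLaw, ENNReal.ofReal t ≤ P.obsLaw (T.belief ω h) a U) :
    T.seedLaw {ω | ∀ j < m, T.center ω h a j ∉ U} ≤ ENNReal.ofReal (Real.exp (-(m * t))) := by
  classical
  refine infinitePi_le_of_mix (ancestorSeeds A h.length) ρ ?_ ?_
  · exact measurableSet_setOfPred.2 (.forall fun j => .forall fun _ =>
      measurableSet_setOfPred.1 ((T.measurable_center h a j) hU.compl))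
  · filter_upwards [hmass] with ω hω
    simp only [(T.center_mix_ancestorSeeds ω _ h a _).2]
    set b := T.belief ω h
    have hgen := (T.G.measurable_gen_right b a).snd
    set F : Set E := (fun e => (T.G.gen b a e).2) ⁻¹' Uᶜ with hF
    have hset : {ω' : Seed A → E | ∀ j < m, (T.G.gen b a (ω' (.center h a j))).2 ∉ U} =
        Set.pi ((Finset.range m).image (Seed.center h a) : Finset (Seed A)) fun _ => F := by
      ext ω'
      simp [hF, Set.mem_pi]
    have hcard : ((Finset.range m).image (Seed.center h a)).card = m := by
      rw [Finset.card_image_of_injective _ (fun i j hij => by simpa using hij), Finset.card_range]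
    rw [hset, Measure.infinitePi_pi _ (fun _ _ => hgen hU.compl), Finset.prod_const, hcard]
    have h1 : ρ F = P.obsLaw b a Uᶜ := by
      rw [← T.G.map_snd, Measure.map_apply hgen hU.compl]
    have h2 : ρ F ≤ ENNReal.ofReal (Real.exp (-t)) := by
      rw [h1, ← ofReal_measureReal, probReal_compl_eq_one_sub hU]
      refine ENNReal.ofReal_le_ofReal ?_
      have h3 : t ≤ (P.obsLaw b a).real U := by
        rw [← ofReal_measureReal (μ := P.obsLaw b a),
          ENNReal.ofReal_le_ofReal_iff measureReal_nonneg] at hω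
        exact hω
      have := Real.add_one_le_exp (-t)
      linarith
    refine (pow_le_pow_left' h2 m).trans_eq ?_
    rw [← ENNReal.ofReal_pow (Real.exp_pos _).le, ← Real.exp_nat_mul]
    ring_nf

variable [PseudoMetricSpace Z] [OpensMeasurableSpace Z] {B : Set (ProbabilityMeasure X)}
  {Ccov cν r₀ kZ : ℝ}

/-- If each ball of an `r`-cover contains a center, every point is within `2r` of one. The two
factors are the size of the cover and the probability that all centers miss a given ball. -/
theorem Solver.seedLaw_fill_le (hB : BallMass P B cν r₀ kZ) (hcov : CoveringBound Z Ccov kZ)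
    {h : History A} (hmem : ∀ᵐ ω ∂T.seedLaw, T.belief ω h ∈ B) (a : A) (m : ℕ) {r : ℝ} (hr : 0 < r)
    (hr1 : r ≤ 1) (hr0 : r ≤ r₀) :
    T.seedLaw {ω | ¬ ∀ z, ∃ j < m, dist z (T.center ω h a j) ≤ 2 * r} ≤
      ENNReal.ofReal (Ccov * r ^ (-kZ) * Real.exp (-(m * (cν * r ^ kZ)))) := by
  obtain ⟨N, hN, hcover⟩ := hcov.exists_cover hr hr1
  have hsub : {ω | ¬ ∀ z, ∃ j < m, dist z (T.center ω h a j) ≤ 2 * r} ⊆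
      ⋃ y ∈ N, {ω | ∀ j < m, T.center ω h a j ∉ Metric.closedBall y r} := by
    intro ω hω
    by_contra hcon
    refine hω fun z => ?_
    obtain ⟨y, hy, hd⟩ := hcover z
    simp only [Set.mem_iUnion, Set.mem_ofPred_eq, not_exists, not_forall, not_not] at hcon
    obtain ⟨j, hj, hball⟩ := hcon y hy
    refine ⟨j, hj, ?_⟩
    have := dist_triangle_right z (T.center ω h a j) y
    rw [Metric.mem_closedBall] at hball
    linarith
  refine (measure_mono hsub).trans ((measure_biUnion_finset_le _ _).trans ?_)
  have hball : ∀ y ∈ N, T.seedLaw {ω | ∀ j < m, T.center ω h a j ∉ Metric.closedBall y r} ≤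
      ENNReal.ofReal (Real.exp (-(m * (cν * r ^ kZ)))) := fun y _ =>
    T.seedLaw_center_notMem_le Metric.isClosed_closedBall.measurableSet h a m (by
      filter_upwards [hmem] with ω hω
      exact hB _ hω a y r hr hr0)
  refine (Finset.sum_le_sum hball).trans ?_
  rw [Finset.sum_const, nsmul_eq_mul, ENNReal.ofReal_mul' (Real.exp_pos _).le]
  gcongr

end Fill

/-- With high probability the centers of a node are a fine net of the observation space. -/
theorem exists_fill_const (Ccov cν r₀ kZ DZ : ℝ) (hCcov : 0 < Ccov) (hcν : 0 < cν) (hr₀ : 0 < r₀)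
    (hkZ : 0 < kZ) :
    ∃ C : ℝ, 0 < C ∧ ∀ {X A Z E : Type*} [MeasurableSpace X] [MeasurableSpace Z]
      [PseudoMetricSpace Z] [OpensMeasurableSpace Z] [MeasurableSpace E] (ρ : Measure E)
      [IsProbabilityMeasure ρ] {M S : ℕ} {P : POMDP X A Z} (T : Solver P ρ M S)
      {B : Set (ProbabilityMeasure X)}, BallMass P B cν r₀ kZ → CoveringBound Z Ccov kZ →
      (∀ z z' : Z, dist z z' ≤ DZ) → ∀ h : History A, (∀ᵐ ω ∂T.seedLaw, T.belief ω h ∈ B) →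
      ∀ (a : A) (m H : ℕ) (δ : ℝ), 1 ≤ m → 2 ≤ H → 0 < δ → δ < 1 →
      T.seedLaw {ω | ¬ ∀ z, ∃ j < m, dist z (T.center ω h a j) ≤
        C * (Real.log (m * H / δ) / m) ^ (1 / kZ)} ≤ ENNReal.ofReal (δ / H) := by
  -- For `r^kZ = K ℓ / m`: the part `1/cν` brings the exponential down to `δ / (m H)`, and the part
  -- `Ccov / log 2` makes `Ccov / (K ℓ) ≤ 1`, as `ℓ ≥ log 2`.
  set K : ℝ := Ccov / Real.log 2 + 1 / cν with hK
  have hlog2 : 0 < Real.log 2 := Real.log_pos one_lt_two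
  have hK0 : 0 < K := by positivity
  set r₁ : ℝ := min 1 r₀ with hr₁
  have hr₁0 : 0 < r₁ := lt_min one_pos hr₀
  set κ : ℝ := K ^ (1 / kZ) with hκ
  have hκ0 : 0 < κ := by positivity
  -- The term `2κ` is the net radius `2r` at `r = κ s`. The other term makes the bound exceed the
  -- diameter when `κ s > r₁`, where cover and ball masses are unavailable and any center will do.
  refine ⟨κ * (2 + |DZ| / r₁), by positivity, ?_⟩
  intro X A Z E _ _ _ _ _ ρ _ M S P T B hball hcov hdiam h hmem a m H δ hm hH hδ hδ1
  have hm0 : (0 : ℝ) < m := by exact_mod_cast hm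
  have hm1 : (1 : ℝ) ≤ m := by exact_mod_cast hm
  have hH2 : (2 : ℝ) ≤ H := by exact_mod_cast hH
  set y : ℝ := m * H / δ with hy
  have hy2 : 2 ≤ y := by
    rw [hy, le_div_iff₀ hδ]
    nlinarith
  have hy0 : 0 < y := by linarith
  set ℓ := Real.log y with hℓ
  have hℓ2 : Real.log 2 ≤ ℓ := Real.log_le_log two_pos hy2
  have hℓ0 : 0 < ℓ := by linarith
  set s : ℝ := (ℓ / m) ^ (1 / kZ) with hs
  have hs0 : 0 < s := by positivity
  rcases le_or_gt (κ * s) r₁ with hr | hr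
  · have hrk : (κ * s) ^ kZ = K * ℓ / m := by
      rw [hκ, hs, ← Real.mul_rpow (by positivity) (by positivity), ← Real.rpow_mul (by positivity),
        one_div_mul_cancel hkZ.ne', Real.rpow_one]
      ring
    refine (measure_mono ?_).trans ((T.seedLaw_fill_le hball hcov hmem a m (r := κ * s)
      (by positivity) (hr.trans (min_le_left _ _)) (hr.trans (min_le_right _ _))).trans
      (ENNReal.ofReal_le_ofReal ?_))
    · intro ω hω hcon
      refine hω fun z => ?_
      obtain ⟨j, hj, hd⟩ := hcon z
      refine ⟨j, hj, hd.trans ?_⟩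
      have : 0 ≤ κ * (|DZ| / r₁) * s := by positivity
      nlinarith
    · rw [Real.rpow_neg (by positivity), hrk, inv_div,
        show (m : ℝ) * (cν * (K * ℓ / m)) = cν * K * ℓ by field_simp]
      have hcK : 1 ≤ cν * K := by
        rw [hK, mul_add, mul_one_div_cancel hcν.ne']
        have : 0 ≤ cν * (Ccov / Real.log 2) := by positivity
        linarith
      have hexp : Real.exp (-(cν * K * ℓ)) ≤ y⁻¹ := by
        rw [← Real.exp_log (inv_pos.2 hy0), Real.log_inv]
        refine Real.exp_le_exp.2 ?_
        nlinarith
      have hCK : Ccov ≤ K * ℓ := by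
        have h1 : Ccov / Real.log 2 ≤ K := by
          have : 0 < 1 / cν := by positivity
          linarith
        rw [div_le_iff₀ hlog2] at h1
        nlinarith
      calc Ccov * (m / (K * ℓ)) * Real.exp (-(cν * K * ℓ)) ≤ Ccov * (m / (K * ℓ)) * y⁻¹ := by
            gcongr
        _ = Ccov / (K * ℓ) * (m * y⁻¹) := by ring
        _ ≤ 1 * (m * y⁻¹) := by
            gcongr
            exact (div_le_one (by positivity)).2 hCK
        _ = δ / H := by rw [hy]; field_simp
  · have : {ω | ¬ ∀ z, ∃ j < m, dist z (T.center ω h a j) ≤ κ * (2 + |DZ| / r₁) * s} = ∅ := by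
      ext ω
      simp only [Set.mem_ofPred_eq, Set.mem_empty_iff_false, iff_false, not_not]
      intro z
      refine ⟨0, hm, (hdiam _ _).trans ((le_abs_self DZ).trans ?_)⟩
      have h1 : |DZ| ≤ |DZ| / r₁ * (κ * s) := by
        rw [div_mul_eq_mul_div, le_div_iff₀ hr₁0]
        gcongr
      have h2 : 0 ≤ 2 * (κ * s) := by positivity
      nlinarith
    rw [this]
    simp

/-! ## The partition loss -/

theorem abs_ciSup_sub_ciSup_le {ι : Type*} [Finite ι] [Nonempty ι] {f g : ι → ℝ} {c : ℝ}
    (h : ∀ i, |f i - g i| ≤ c) : |(⨆ i, f i) - ⨆ i, g i| ≤ c := by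
  have hf := (Set.finite_range f).bddAbove
  have hg := (Set.finite_range g).bddAbove
  rw [abs_le]
  constructor
  · have : ⨆ i, g i ≤ (⨆ i, f i) + c := ciSup_le fun i => by
      linarith [(abs_le.1 (h i)).1, le_ciSup hf i]
    linarith
  · have : ⨆ i, f i ≤ (⨆ i, g i) + c := ciSup_le fun i => by
      linarith [(abs_le.1 (h i)).2, le_ciSup hg i]
    linarith

/-- Writing the cell sum as an integral lets the partitioned and the exact backup be compared
pointwise under one observation law. -/
theorem integral_comp_nearest {Z : Type*} [PseudoMetricSpace Z] [MeasurableSpace Z]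
    [OpensMeasurableSpace Z] (ν : Measure Z) [IsProbabilityMeasure ν] (c : ℕ → Z) {m : ℕ}
    (hm : 1 ≤ m) (f : ℕ → ℝ) :
    Integrable (fun z => f (nearest c m z)) ν ∧
    ∫ z, f (nearest c m z) ∂ν =
      ∑ j ∈ Finset.range m, ν.real {z | nearest c m z = j} * f j := by
  have hset := measurableSet_nearest_eq c hm
  have hfun : (fun z => f (nearest c m z)) = fun z => ∑ j ∈ Finset.range m,
      {z | nearest c m z = j}.indicator (fun _ => f j) z := by
    funext z
    rw [Finset.sum_eq_single_of_mem _ (Finset.mem_range.2 (nearest_spec c hm z).1)]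
    · simp
    · intro j _ hj
      simp [hj.symm]
  have hint : ∀ j ∈ Finset.range m,
      Integrable ({z | nearest c m z = j}.indicator fun _ => f j) ν := fun j _ =>
    (integrable_const _).indicator (hset j)
  rw [hfun]
  refine ⟨integrable_finsetSum _ hint, ?_⟩
  rw [integral_finsetSum _ hint]
  exact Finset.sum_congr rfl fun j _ => by rw [integral_indicator_const _ (hset j), smul_eq_mul]

/-! ### Discretization error of the Bellman backups -/

section Loss

variable {X A Z : Type*} [MeasurableSpace X] [PseudoEMetricSpace X] [MeasurableSpace Z]
  [PseudoMetricSpace Z] {P : POMDP X A Z} {B : Set (ProbabilityMeasure X)} {Lψ α LV β γ R : ℝ}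

/-- Hölder continuity of the optimal value along the belief update. -/
theorem abs_optValue_update_sub_le {L : ℕ} (hB : IsBeliefSpace P B) (hLψ : 0 < Lψ)
    (hψ : HolderUpdate P B Lψ α) (hLV : 0 < LV) (hβ : 0 < β) (hV : HolderValue P B L LV β)
    {k : ℕ} (hk : k ≤ L) {b : ProbabilityMeasure X} (hb : b ∈ B) {a : A} {z z' : Z}
    (hz : P.Admissible b a z) (hz' : P.Admissible b a z') :
    |P.optValue k (P.update b a z) - P.optValue k (P.update b a z')| ≤
      LV * Lψ ^ β * dist z z' ^ (α * β) := by
  have h1 := hV k hk _ (hB.update b hb a z hz) _ (hB.update b hb a z' hz')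
  have h2 := ENNReal.rpow_le_rpow (hψ b hb a z z' hz hz') hβ.le
  have hd : 0 ≤ Lψ * dist z z' ^ α := by positivity
  rw [ENNReal.ofReal_rpow_of_nonneg hd hβ.le, Real.mul_rpow hLψ.le (by positivity),
    ← Real.rpow_mul dist_nonneg] at h2
  have h3 := h1.trans (mul_le_mul_right h2 _)
  rw [← ENNReal.ofReal_mul hLV.le, ENNReal.ofReal_le_ofReal_iff (by positivity), ← mul_assoc] at h3
  exact h3

variable [OpensMeasurableSpace Z] [Fintype A] [DecidableEq A] [Nonempty A]
  {E : Type*} [MeasurableSpace E] {ρ : Measure E} {M S : ℕ} (T : Solver P ρ M S)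

/-- Propagation of the discretization error through the partitioned tree. -/
theorem Solver.abs_partValue_sub_optValue_le {L : ℕ} (hγ0 : 0 ≤ γ) (hγ1 : γ < 1)
    (hdisc : P.discount = γ) (hR : ∀ x a, |P.reward x a| ≤ R) (hB : IsBeliefSpace P B)
    (hLψ : 0 < Lψ) (hα : 0 < α) (hψ : HolderUpdate P B Lψ α) (hLV : 0 < LV) (hβ : 0 < β)
    (hV : HolderValue P B L LV β) {ω : Seed A → E} (hmem : ∀ h, T.belief ω h ∈ B)
    (hadm : ∀ h a j, P.Admissible (T.belief ω h) a (T.center ω h a j))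
    {ε : History A × A → ℝ} {e : ℝ} (hε : ∀ p ∈ T.W.actionNodes L, ε p ^ (α * β) ≤ e)
    (hfill : ∀ p ∈ T.W.actionNodes L, ∀ z, ∃ j < T.W.m p.1 p.2,
      dist z (T.center ω p.1 p.2 j) ≤ ε p) (k : ℕ) (hk : k ≤ L) (h : History A)
    (hh : h ∈ T.W.histories (L - k)) :
    |T.partValue ω k h - P.optValue k (T.belief ω h)| ≤
      (∑ i ∈ Finset.range k, γ ^ (i + 1)) * (LV * Lψ ^ β * e) := by
  have hopt := P.optValue_eq_dpValue hγ0 hγ1 hdisc hR T.tie_mem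
  induction k generalizing h with
  | zero =>
    simp [Solver.partValue, hopt, POMDP.dpValue]
  | succ k ih =>
    have hd : L - (k + 1) < L := by omega
    set D : ℝ := (∑ i ∈ Finset.range k, γ ^ (i + 1)) * (LV * Lψ ^ β * e) with hD
    -- Each level turns the error `D` of the children into `γ (D + one Hölder error)`, starting from
    -- 0 at the leaves, where both values are the best immediate reward.
    have hDsucc : (∑ i ∈ Finset.range (k + 1), γ ^ (i + 1)) * (LV * Lψ ^ β * e) =
        γ * (D + LV * Lψ ^ β * e) := by
      rw [Finset.sum_range_succ', hD]
      simp only [pow_succ _ (_ + 1), ← Finset.sum_mul]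
      ring
    rw [hDsucc, hopt]
    simp only [Solver.partValue, POMDP.dpValue]
    refine abs_ciSup_sub_ciSup_le fun a => ?_
    have hp : (h, a) ∈ T.W.actionNodes L :=
      Finset.mem_product.2 ⟨T.W.mem_decisionNodes hd hh, Finset.mem_univ a⟩
    set b := T.belief ω h with hb
    set c := T.center ω h a with hc
    set m := T.W.m h a with hm
    have hm1 : 1 ≤ m := T.W.m_pos h a
    obtain ⟨hint, hsum⟩ := integral_comp_nearest (P.obsLaw b a) c hm1
      fun j => T.partValue ω k ((a, j) :: h)
    have hint' := P.integrable_comp_update (POMDP.measurable_dpValue k)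
      (POMDP.abs_dpValue_le hγ0 hγ1 hdisc hR k) b a
    simp only [Solver.backup, POMDP.bellmanQ, hdisc, ← hb, ← hc, ← hm]
    rw [← hsum, add_sub_add_left_eq_sub, ← mul_sub, abs_mul, abs_of_nonneg hγ0,
      ← integral_sub hint hint']
    refine mul_le_mul_of_nonneg_left ?_ hγ0
    -- For each `z`, the induction hypothesis compares the two values at the belief of the nearest
    -- center, and Hölder continuity moves from that center to `z`.
    have hbound : ∀ᵐ z ∂(P.obsLaw b a), ‖T.partValue ω k ((a, nearest c m z) :: h) -
        P.dpValue k (P.update b a z)‖ ≤ D + LV * Lψ ^ β * e := by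
      filter_upwards [P.ae_admissible b a] with z hz
      set j := nearest c m z with hj
      obtain ⟨hjm, hjmin⟩ := nearest_spec c hm1 z
      have hchild := ih (by omega) ((a, j) :: h) (by
        have := T.W.mem_histories_succ hh a hjm
        rwa [show L - (k + 1) + 1 = L - k by omega] at this)
      have hbel : T.belief ω ((a, j) :: h) = P.update b a (c j) := rfl
      have hhold := abs_optValue_update_sub_le hB hLψ hψ hLV hβ hV (k := k) (by omega) (hmem h)
        (hadm h a j) hz
      rw [hbel] at hchild
      obtain ⟨i, him, hdi⟩ := hfill (h, a) hp z
      have hdist : dist (c j) z ^ (α * β) ≤ e := by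
        refine le_trans (Real.rpow_le_rpow dist_nonneg ?_ (by positivity)) (hε (h, a) hp)
        rw [dist_comm]
        exact (hjmin i him).trans hdi
      rw [Real.norm_eq_abs, ← hopt]
      calc _ ≤ |T.partValue ω k ((a, j) :: h) - P.optValue k (P.update b a (c j))| +
            |P.optValue k (P.update b a (c j)) - P.optValue k (P.update b a z)| :=
            abs_sub_le _ _ _
        _ ≤ D + LV * Lψ ^ β * e := by
            refine add_le_add hchild (hhold.trans ?_)
            gcongr
    have := norm_integral_le_of_norm_le_const hbound
    simpa using this

end Loss

theorem sum_pow_succ_eq {γ : ℝ} (hγ1 : γ < 1) (L : ℕ) :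
    ∑ i ∈ Finset.range L, γ ^ (i + 1) = γ * (1 - γ ^ L) / (1 - γ) := by
  have h1 : 1 - γ ≠ 0 := by linarith
  have := geom_sum_mul_neg γ L
  simp only [pow_succ, ← Finset.sum_mul]
  rw [eq_div_iff h1, mul_right_comm, this]
  ring

/-- The value of the partitioned problem is close to the optimal value with high probability. -/
theorem exists_partition_const (Ccov cν r₀ kZ DZ : ℝ) (hCcov : 0 < Ccov) (hcν : 0 < cν)
    (hr₀ : 0 < r₀) (hkZ : 0 < kZ) :
    ∃ C : ℝ, 0 < C ∧ ∀ {X A Z E : Type*} [PseudoEMetricSpace X] [MeasurableSpace X]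
      [MeasurableSpace Z] [PseudoMetricSpace Z] [OpensMeasurableSpace Z] [Fintype A]
      [DecidableEq A] [Nontrivial A] [MeasurableSpace E] (ρ : Measure E) [IsProbabilityMeasure ρ]
      {M S L : ℕ} (P : POMDP X A Z) (T : Solver P ρ M S)
      (B : Set (ProbabilityMeasure X)) (R γ Lψ α LV β : ℝ), 1 ≤ L → 0 ≤ γ → γ < 1 →
      P.discount = γ → (∀ x a, |P.reward x a| ≤ R) → IsBeliefSpace P B →
      0 < Lψ → 0 < α → HolderUpdate P B Lψ α → 0 < LV → 0 < β → HolderValue P B L LV β →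
      CoveringBound Z Ccov kZ → (∀ z z' : Z, dist z z' ≤ DZ) → BallMass P B cν r₀ kZ →
      ∀ δ : ℝ, 0 < δ → δ < 1 →
      T.seedLaw {ω | ¬ |T.partValue ω L [] - P.optValue L P.b₀| ≤
        T.W.partitionLoss L γ LV Lψ α β C kZ δ} ≤ ENNReal.ofReal δ := by
  obtain ⟨C, hC, hfill⟩ := exists_fill_const Ccov cν r₀ kZ DZ hCcov hcν hr₀ hkZ
  refine ⟨C, hC, ?_⟩
  intro X A Z E _ _ _ _ _ _ _ _ _ ρ _ M S L P T B R γ Lψ α LV β hL hγ0 hγ1 hdisc hR hB hLψ hα hψ hLV hβ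
    hV hcov hdiam hball δ hδ hδ1
  have hae := T.ae_belief_mem hB
  set H := (T.W.actionNodes L).card with hH
  -- The root is a decision node as `L ≥ 1`, and it has at least two actions; this keeps `log (m H /
  -- δ) ≥ log 2`.
  have hH2 : 2 ≤ H := by
    have h1 : 1 ≤ (T.W.decisionNodes L).card := Finset.card_pos.2
      ⟨[], T.W.mem_decisionNodes (d := 0) hL (by simp [Widening.histories])⟩
    have h2 : 1 < Fintype.card A := Fintype.one_lt_card
    rw [hH, Widening.actionNodes, Finset.card_product, Finset.card_univ]
    nlinarith
  set ε : History A × A → ℝ := fun p =>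
    C * (Real.log ((T.W.m p.1 p.2 : ℝ) * (H : ℝ) / δ) / (T.W.m p.1 p.2 : ℝ)) ^ (1 / kZ) with hε
  set bad : History A × A → Set (Seed A → E) := fun p =>
    {ω | ¬ ∀ z, ∃ j < T.W.m p.1 p.2, dist z (T.center ω p.1 p.2 j) ≤ ε p} with hbad
  set null : Set (Seed A → E) := {ω | ¬ ((∀ h, T.belief ω h ∈ B) ∧
    ∀ h a j, P.Admissible (T.belief ω h) a (T.center ω h a j))} with hnull
  have hnull0 : T.seedLaw null = 0 := ae_iff.1 hae
  have hsub : {ω | ¬ |T.partValue ω L [] - P.optValue L P.b₀| ≤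
      T.W.partitionLoss L γ LV Lψ α β C kZ δ} ⊆ null ∪ ⋃ p ∈ T.W.actionNodes L, bad p := by
    intro ω hω
    by_contra hcon
    rw [Set.mem_union, not_or] at hcon
    obtain ⟨hn, hb⟩ := hcon
    simp only [hnull, Set.mem_ofPred_eq, not_not] at hn
    simp only [hbad, Set.mem_iUnion, Set.mem_ofPred_eq, not_exists, not_not] at hb
    refine hω ?_
    set e : ℝ := ⨆ p : {p // p ∈ T.W.actionNodes L}, ε p.1 ^ (α * β) with he
    have hεe : ∀ p ∈ T.W.actionNodes L, ε p ^ (α * β) ≤ e := fun p hp =>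
      le_ciSup (f := fun p : {p // p ∈ T.W.actionNodes L} => ε p.1 ^ (α * β))
        (Set.finite_range _).bddAbove ⟨p, hp⟩
    have := T.abs_partValue_sub_optValue_le hγ0 hγ1 hdisc hR hB hLψ hα hψ hLV hβ hV hn.1 hn.2 hεe hb
      L le_rfl [] (by simp [Widening.histories])
    refine this.trans_eq ?_
    rw [sum_pow_succ_eq hγ1, Widening.partitionLoss, ← hH]
    simp only [he, hε]
    ring
  refine (measure_mono hsub).trans ((measure_union_le _ _).trans ?_)
  rw [hnull0, zero_add]
  -- Each of the `H` nodes is badly filled with probability at most `δ / H`.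
  refine (measure_biUnion_finset_le _ _).trans ?_
  refine (Finset.sum_le_sum fun p _ => hfill ρ T hball hcov hdiam p.1
    (hae.mono fun ω hω => hω.1 p.1) p.2 (T.W.m p.1 p.2) H δ (T.W.m_pos _ _) hH2 hδ hδ1).trans ?_
  have hH0 : (0 : ℝ) < H := by exact_mod_cast (by omega : 0 < H)
  rw [Finset.sum_const, ← hH, nsmul_eq_mul, ← ENNReal.ofReal_natCast,
    ← ENNReal.ofReal_mul hH0.le, mul_div_cancel₀ _ hH0.ne']

end ContPOMDP

end

/-! ### Combination of the search error and the partition error -/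

open ContPOMDP MeasureTheory in
theorem theorem3
    (Ccov cν r₀ kZ DZ : ℝ) (hCcov : 0 < Ccov) (hcν : 0 < cν) (hr₀ : 0 < r₀) (hkZ : 0 < kZ) :
    -- `C` depends only on the constants of the covering and ball-mass assumptions
    ∃ C : ℝ, 0 < C ∧
    ∀ (A : Type*) [Fintype A] [DecidableEq A] [Nontrivial A]
      (L : ℕ) (Rmax γ : ℝ) (q : UCBParams) (M S : ℕ),
      1 ≤ L → 0 ≤ γ → γ < 1 → q.Valid L →
    -- `β⁽⁰⁾` depends only on the constants introduced so far and on `Δ_min`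
    ∃ β₀ : ℝ → ℝ, (∀ Δ, 0 < Δ → 1 < β₀ Δ) ∧
    ∀ (X Z E : Type*) [MetricSpace X] [SecondCountableTopology X] [MeasurableSpace X] [BorelSpace X]
      [MetricSpace Z] [MeasurableSpace Z] [BorelSpace Z]
      [MeasurableSpace E] (ρ : Measure E) [IsProbabilityMeasure ρ]
      (P : POMDP X A Z) (T : Solver P ρ M S) (B : Set (ProbabilityMeasure X))
      (Lψ α LV β : ℝ),
      P.discount = γ → T.L = L → T.q = q →
      -- bounded rewards and rollout returns
      (∀ x a, |P.reward x a| ≤ Rmax) →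
      (∀ h b e, |T.rollout h b e| ≤ Rmax * ∑ i ∈ Finset.range (L - h.length + 1), γ ^ i) →
      -- Hölder continuity, covering and ball-mass assumptions
      IsBeliefSpace P B →
      0 < Lψ → 0 < α → α ≤ 1 → HolderUpdate P B Lψ α →
      0 < LV → 0 < β → β ≤ 1 → HolderValue P B L LV β →
      CoveringBound Z Ccov kZ → (∀ z z' : Z, dist z z' ≤ DZ) →
      BallMass P B cν r₀ kZ →
      -- the partitioned problem has a positive action gap
      (∀ᵐ ω ∂T.seedLaw, 0 < T.minGap ω) →
      ∀ n : ℕ, 1 ≤ n →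
      (∀ δ₁ δ₂ : ℝ, 0 < δ₁ → δ₁ < 1 → 0 < δ₂ → δ₂ < 1 →
        T.seedLaw {ω | ¬ |T.estimate ω n - P.optValue L P.b₀| ≤
            (n : ℝ) ^ (-(1 - q.η 0)) * (2 * β₀ (T.minGap ω) / δ₁) ^ (1 / q.ξ 0) +
              T.W.partitionLoss L γ LV Lψ α β C kZ δ₂}
          ≤ ENNReal.ofReal (δ₁ + δ₂)) ∧
      (∀ δ : ℝ, 0 < δ → δ < 1 →
        T.seedLaw {ω | ¬ |T.estimate ω n - P.optValue L P.b₀| ≤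
            (n : ℝ) ^ (-(1 - q.η 0)) * (2 * β₀ (T.minGap ω) / (δ / 2)) ^ (1 / q.ξ 0) +
              T.W.partitionLoss L γ LV Lψ α β C kZ (δ / 2)}
          ≤ ENNReal.ofReal δ) := by
  obtain ⟨C, hC, hpart⟩ := exists_partition_const Ccov cν r₀ kZ DZ hCcov hcν hr₀ hkZ
  refine ⟨C, hC, ?_⟩
  intro A _ _ _ L Rmax γ q M S hL hγ0 hγ1 hq
  obtain ⟨β₀, hβ₀, hest⟩ := exists_estimate_rate (Fintype.card A) M S L Rmax γ q hL hγ0 hγ1 hq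
  refine ⟨β₀, fun Δ _ => hβ₀ Δ, ?_⟩
  intro X Z E _ _ _ _ _ _ _ _ ρ _ P T B Lψ α LV β hdisc hTL hTq hR hroll hB hLψ hα _ hψ hLV hβ _ hV
    hcov hdiam hball hgap n hn
  -- Finite covers at all small radii make `Z` second countable, as the measurability of the solver
  -- requires.
  have := hcov.secondCountableTopology
  have main : ∀ δ₁ δ₂ : ℝ, 0 < δ₁ → 0 < δ₂ → δ₂ < 1 →
      T.seedLaw {ω | ¬ |T.estimate ω n - P.optValue L P.b₀| ≤
        (n : ℝ) ^ (-(1 - q.η 0)) * (2 * β₀ (T.minGap ω) / δ₁) ^ (1 / q.ξ 0) +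
          T.W.partitionLoss L γ LV Lψ α β C kZ δ₂} ≤ ENNReal.ofReal (δ₁ + δ₂) := by
    intro δ₁ δ₂ hδ₁ hδ₂ hδ₂1
    have h1 := hest ρ P T le_rfl hdisc hTL hTq hR hroll n hn δ₁ hδ₁
    have h2 := hpart ρ P T B Rmax γ Lψ α LV β hL hγ0 hγ1 hdisc hR hB hLψ hα hψ hLV hβ hV hcov hdiam
      hball δ₂ hδ₂ hδ₂1
    have h3 : T.seedLaw {ω | ¬ 0 < T.minGap ω} = 0 := ae_iff.1 hgap
    -- Triangle inequality through the partitioned value, after discarding the null event on which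
    -- the gap is not positive.
    have hsub : {ω | ¬ |T.estimate ω n - P.optValue L P.b₀| ≤
        (n : ℝ) ^ (-(1 - q.η 0)) * (2 * β₀ (T.minGap ω) / δ₁) ^ (1 / q.ξ 0) +
          T.W.partitionLoss L γ LV Lψ α β C kZ δ₂} ⊆
        {ω | ¬ 0 < T.minGap ω} ∪
        ({ω | 0 < T.minGap ω ∧ ¬ |T.estimate ω n - T.partValue ω L []| ≤
          (n : ℝ) ^ (-(1 - q.η 0)) * (2 * β₀ (T.minGap ω) / δ₁) ^ (1 / q.ξ 0)} ∪
        {ω | ¬ |T.partValue ω L [] - P.optValue L P.b₀| ≤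
          T.W.partitionLoss L γ LV Lψ α β C kZ δ₂}) := by
      intro ω hω
      by_contra hcon
      simp only [Set.mem_union, Set.mem_ofPred_eq, not_or, not_not, not_and] at hcon
      obtain ⟨hg, he, hp⟩ := hcon
      exact hω ((abs_sub_le _ _ _).trans (add_le_add (he hg) hp))
    refine (measure_mono hsub).trans ((measure_union_le _ _).trans ?_)
    rw [h3, zero_add, ENNReal.ofReal_add hδ₁.le hδ₂.le]
    exact (measure_union_le _ _).trans (add_le_add h1 h2)
  refine ⟨fun δ₁ δ₂ h1 _ h2 h3 => main δ₁ δ₂ h1 h2 h3, fun δ h1 h2 => ?_⟩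
  have := main (δ / 2) (δ / 2) (by linarith) (by linarith) (by linarith)
  rwa [add_halves] at this
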